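/- Let $n\ge 1$. Let $\varphi:[0,\infty)\to[0,\infty)$ be an Orlicz function, i.e. convex with $\varphi(0)=0$, $\varphi(t)>0$ for $t>0$ and $\varphi(t)\to\infty$ as $t\to\infty$, and let $\omega:(0,1)\to(0,\infty)$ be a weight function, i.e. nonincreasing with $\int_0^1\omega(t)\,dt<\infty$. Let $\mathcal K_0^n$ be the set of compact convex subsets of $\mathbb R^n$ containing the origin in their interior. For $K\in\mathcal K_0^n$ and $x\in\mathbb R^n$ let $f_{x,K}(y)=x\cdot y$ on $K$, and let $$f_{x,K}^*(t)=\inf\Big\{s>0:\ \frac{|\{y\in K: |x\cdot y|>s\}|}{|K|}\le t\Big\},\qquad 0<t<1,$$ be its decreasing rearrangement with respect to normalized Lebesgue measure on $K$. The Orlicz–Lorentz centroid body $\Gamma_{\varphi,\omega}K$ is the convex body with support function $$h(\Gamma_{\varphi,\omega}K,x)=\inf\Big\{\lambda>0:\ \int_0^1\varphi\Big(\frac{f_{x,K}^*(t)}{\lambda}\Big)\omega(t)\,dt\le 1\Big\}.$$ For $u\in S^{n-1}$ let $S_uK$ denote the Steiner symmetrization of $K$ in the direction $u$. For $L\in\mathcal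 K_0^n$ let $r_L$ and $R_L$ denote the minimum and the maximum over $S^{n-1}$ of the radial function $\rho_L(v)=\max\{\lambda>0:\lambda v\in L\}$. Then, for every $K\in\mathcal K_0^n$: (0) $\Gamma_{\varphi,\omega}K$ is well defined and belongs to $\mathcal K_0^n$. (1) For every $u\in S^{n-1}$, $\Gamma_{\varphi,\omega}(S_uK)\subseteq S_u(\Gamma_{\varphi,\omega}K)$. (2) If $u\in S^{n-1}$ and $\Gamma_{\varphi,\omega}(S_uK)=S_u(\Gamma_{\varphi,\omega}K)$, then the midpoints of all chords of $K$ parallel to $u$ whose distance from the origin is less than $\dfrac{r_K\,r_{\Gamma_{\varphi,\omega}K}}{4R_{\Gamma_{\varphi,\omega}K}}$ lie in one $(n-1)$-dimensional linear subspace of $\mathbb R^n$. (3) If $\Gamma_{\varphi,\omega}(S_uK)=S_u(\Gamma_{\varphi,\omega}K)$ for every $u\in S^{n-1}$, then $K$ is an origin-centered ellipsoid. -/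

import Mathlib

open MeasureTheory Set

noncomputable section

namespace OrliczLorentz

/-- `φ` (used only on `[0,∞)`) is an Orlicz function: convex, zero at zero, positive on `(0,∞)`
and tending to infinity at infinity. -/
structure IsOrliczFunction (φ : ℝ → ℝ) : Prop where
  convexOn : ConvexOn ℝ (Ici 0) φ
  map_zero : φ 0 = 0
  pos : ∀ t : ℝ, 0 < t → 0 < φ t
  tendsto : Filter.Tendsto φ Filter.atTop Filter.atTop

/-- `ω` (used only on `(0,1)`) is a weight function on `(0,1)`: positive, nonincreasing and
integrable. -/
structure IsWeight (ω : ℝ → ℝ) : Prop where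
  pos : ∀ t ∈ Ioo (0 : ℝ) 1, 0 < ω t
  antitoneOn : AntitoneOn ω (Ioo 0 1)
  integrableOn : IntegrableOn ω (Ioo 0 1) volume

/-- The distribution function `μ_f(s) = μ {x : |f x| > s}`. -/
def distribution {Ω : Type*} [MeasurableSpace Ω] (μ : Measure Ω) (f : Ω → ℝ) (s : ℝ) : ENNReal :=
  μ {x | s < |f x|}

/-- The decreasing rearrangement `f^*(t) = inf {s > 0 : μ_f(s) ≤ t}`. It is used for `t > 0` and
finite measures `μ` only, in which case the set is never empty. -/
def rearrangement {Ω : Type*} [MeasurableSpace Ω] (μ : Measure Ω) (f : Ω → ℝ) (t : ℝ) : ℝ :=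
  sInf {s : ℝ | 0 < s ∧ distribution μ f s ≤ ENNReal.ofReal t}

/-- The modular `∫₀¹ φ(f^*(t)/lam) ω(t) dt`, an extended nonnegative number. -/
def modular {Ω : Type*} [MeasurableSpace Ω] (μ : Measure Ω) (φ ω : ℝ → ℝ) (f : Ω → ℝ)
    (lam : ℝ) : ENNReal :=
  ∫⁻ t in Ioo (0 : ℝ) 1, ENNReal.ofReal (φ (rearrangement μ f t / lam) * ω t)

/-- The Orlicz-Lorentz (Luxemburg) norm of `f` on a probability space. -/
def luxNorm {Ω : Type*} [MeasurableSpace Ω] (μ : Measure Ω) (φ ω : ℝ → ℝ) (f : Ω → ℝ) : ℝ :=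
  sInf {lam : ℝ | 0 < lam ∧ modular μ φ ω f lam ≤ 1}

variable {n : ℕ}

/-- Convex bodies containing the origin in their interior. -/
structure IsConvexBodyZero (K : Set (EuclideanSpace ℝ (Fin n))) : Prop where
  convex : Convex ℝ K
  isCompact : IsCompact K
  zero_mem_interior : (0 : EuclideanSpace ℝ (Fin n)) ∈ interior K

/-- The support function `h(K,x) = max_{y ∈ K} x · y`. -/
def supportFn (K : Set (EuclideanSpace ℝ (Fin n))) (x : EuclideanSpace ℝ (Fin n)) : ℝ :=
  sSup ((fun y => inner ℝ x y) '' K)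

/-- The norm `‖f_{x,K}‖` of `f_{x,K}(y) = x · y` with respect to the normalized Lebesgue measure
on `K`. -/
def centroidNorm (φ ω : ℝ → ℝ) (K : Set (EuclideanSpace ℝ (Fin n)))
    (x : EuclideanSpace ℝ (Fin n)) : ℝ :=
  luxNorm (ProbabilityTheory.cond volume K) φ ω (fun y => inner ℝ x y)

/-- The Orlicz-Lorentz centroid body of `K`: the closed convex set with support function
`centroidNorm φ ω K`, written as the intersection of its supporting half-spaces. -/
def centroidBody (φ ω : ℝ → ℝ) (K : Set (EuclideanSpace ℝ (Fin n))) :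
    Set (EuclideanSpace ℝ (Fin n)) :=
  {y | ∀ x, inner ℝ x y ≤ centroidNorm φ ω K x}

/-- The radial function `ρ_K(x) = max {lam > 0 : lam x ∈ K}`. -/
def radialFn (K : Set (EuclideanSpace ℝ (Fin n))) (x : EuclideanSpace ℝ (Fin n)) : ℝ :=
  sSup {lam : ℝ | 0 < lam ∧ lam • x ∈ K}

/-- `R_K`, the maximum of the radial function on the unit sphere. -/
def outerRadius (K : Set (EuclideanSpace ℝ (Fin n))) : ℝ :=
  sSup (radialFn K '' Metric.sphere 0 1)

/-- `r_K`, the minimum of the radial function on the unit sphere. -/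
def innerRadius (K : Set (EuclideanSpace ℝ (Fin n))) : ℝ :=
  sInf (radialFn K '' Metric.sphere 0 1)

/-- `K_u`, the orthogonal projection of `K` on `u^⊥`. -/
def shadow (K : Set (EuclideanSpace ℝ (Fin n))) (u : EuclideanSpace ℝ (Fin n)) :
    Set (EuclideanSpace ℝ (Fin n)) :=
  (fun x => (ℝ ∙ u)ᗮ.starProjection x) '' K

/-- The overgraph function `g_u(y') = max {t : y' + t u ∈ K}`. -/
def overgraph (K : Set (EuclideanSpace ℝ (Fin n))) (u y : EuclideanSpace ℝ (Fin n)) : ℝ :=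
  sSup {t : ℝ | y + t • u ∈ K}

/-- The undergraph function `f_u(y') = - min {t : y' + t u ∈ K}`. -/
def undergraph (K : Set (EuclideanSpace ℝ (Fin n))) (u y : EuclideanSpace ℝ (Fin n)) : ℝ :=
  -sInf {t : ℝ | y + t • u ∈ K}

/-- `σ(y')`, half the length of the chord of `K` through `y'` parallel to `u`. -/
def halfLength (K : Set (EuclideanSpace ℝ (Fin n))) (u y : EuclideanSpace ℝ (Fin n)) : ℝ :=
  (undergraph K u y + overgraph K u y) / 2

/-- The midpoint `y' + m(y') u` of the chord of `K` through `y'` parallel to `u`. -/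
def chordMidpoint (K : Set (EuclideanSpace ℝ (Fin n))) (u y : EuclideanSpace ℝ (Fin n)) :
    EuclideanSpace ℝ (Fin n) :=
  y + ((overgraph K u y - undergraph K u y) / 2) • u

/-- The chord `K ∩ (y' + ℝ u)`. -/
def chord (K : Set (EuclideanSpace ℝ (Fin n))) (u y : EuclideanSpace ℝ (Fin n)) :
    Set (EuclideanSpace ℝ (Fin n)) :=
  K ∩ range (fun t : ℝ => y + t • u)

/-- The Steiner symmetrization `S_u K = {y' + t u : |t| ≤ σ(y'), y' ∈ K_u}`. -/
def steiner (u : EuclideanSpace ℝ (Fin n)) (K : Set (EuclideanSpace ℝ (Fin n))) :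
    Set (EuclideanSpace ℝ (Fin n)) :=
  {x | ∃ y ∈ shadow K u, ∃ t : ℝ, |t| ≤ halfLength K u y ∧ x = y + t • u}

/-- Origin-centered ellipsoids: images of the closed unit ball under linear automorphisms. -/
def IsOriginEllipsoid (K : Set (EuclideanSpace ℝ (Fin n))) : Prop :=
  ∃ A : EuclideanSpace ℝ (Fin n) ≃ₗ[ℝ] EuclideanSpace ℝ (Fin n),
    K = A '' Metric.closedBall 0 1

end OrliczLorentz

end

/-! The Luxemburg norm of a function depends only on its distribution. Since `ω` is nonincreasing,
`∫ f^* ω` is subadditive, and convexity of `φ` turns this into the triangle inequality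
`luxNorm_add_le`. Hence the norm of `y ↦ x · y` is a positive sublinear function of `x`, and by
Hahn–Banach it is the support function of the intersection of its half-spaces. This is (0).

For (1), the symmetral of `K` is the preimage of `K` under a volume preserving shear along `u`, and
it is invariant under the reflection in `u^⊥`. Let `x₁`, `x₂` have `u`-components `1` and `-1`. On
the symmetral, the functional of `(x₁ + refl u x₂) / 2` is the mean of two functions distributed
like those of `x₁` and `x₂` on `K`, because the midpoint shifts cancel. The triangle inequality
(`centroidNorm_steiner_half_le`), used for all such pairs, bounds the chords of the centroid body of
the symmetral by those of the centroid body of `K`.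

For (2), let `x₁`, `x₂` be normals of the centroid body at the two ends of one chord parallel to
`u`. Equality forbids strictness in that triangle inequality, so the two functions almost never have
opposite signs (`centroidNorm_steiner_half_lt`). Along a line parallel to `u` they are affine with
slope one, so their zeros coincide if one of them corresponds to an interior point of `K`. This
expresses the midpoint of the chord of `K` linearly (`two_mul_midShift_eq`). The chord through the
origin gives (2).

For (3), comparing different chords of the centroid body shows that the two normals at the ends
differ by a fixed vector `2w`. A summation argument, which needs no smoothness, then shows that
`w^⊥` bisects every chord through the interior. The centroid body is therefore invariant under an
oblique reflection, which makes `u` and `w` conjugate for its moment form, a form that does not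
depend on `u`. On the other hand `K` is symmetric and has `w` as a normal at its boundary point in
direction `u`. In coordinates where the moment form is standard, each normal of `K` is thus radial,
so the support function is constant on the sphere (`exists_eq_mul_norm`) and `K` is an ellipsoid. -/

namespace OrliczLorentz

section

/-! ### Orlicz functions. -/

section OrliczFunction

variable {φ : ℝ → ℝ}

theorem IsOrliczFunction.nonneg (hφ : IsOrliczFunction φ) {t : ℝ} (ht : 0 ≤ t) : 0 ≤ φ t := by
  rcases ht.eq_or_lt with rfl | ht
  · exact hφ.map_zero.ge
  · exact (hφ.pos t ht).le

theorem IsOrliczFunction.map_mul_le (hφ : IsOrliczFunction φ) {c t : ℝ} (hc0 : 0 ≤ c)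
    (hc1 : c ≤ 1) (ht : 0 ≤ t) : φ (c * t) ≤ c * φ t := by
  have := hφ.convexOn.2 (mem_Ici.2 le_rfl) (mem_Ici.2 ht) (sub_nonneg.2 hc1) hc0 (by ring)
  simpa [hφ.map_zero] using this

theorem IsOrliczFunction.strictMonoOn (hφ : IsOrliczFunction φ) : StrictMonoOn φ (Ici 0) := by
  intro a ha b _ hab
  have ha : 0 ≤ a := ha
  have hb : 0 < b := ha.trans_lt hab
  have h := hφ.map_mul_le (c := a / b) (t := b) (by positivity) ((div_le_one hb).2 hab.le) hb.le
  rw [div_mul_cancel₀ _ hb.ne'] at h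
  have : a / b < 1 := (div_lt_one hb).2 hab
  nlinarith [hφ.pos b hb]

theorem IsOrliczFunction.continuousOn (hφ : IsOrliczFunction φ) : ContinuousOn φ (Ici 0) := by
  intro t ht
  rcases (mem_Ici.1 ht).eq_or_lt with rfl | ht'
  · rw [ContinuousWithinAt, hφ.map_zero]
    have h0 : Filter.Tendsto (fun t : ℝ => t * φ 1) (nhdsWithin 0 (Ici 0)) (nhds 0) := by
      have : Continuous fun t : ℝ => t * φ 1 := by fun_prop
      simpa using (this.tendsto 0).mono_left nhdsWithin_le_nhds
    refine tendsto_of_tendsto_of_tendsto_of_le_of_le' tendsto_const_nhds h0 ?_ ?_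
    · filter_upwards [self_mem_nhdsWithin] with t ht using hφ.nonneg ht
    · filter_upwards [self_mem_nhdsWithin, nhdsWithin_le_nhds (Iic_mem_nhds one_pos)] with t ht h1
      simpa using hφ.map_mul_le (c := t) (t := 1) ht h1 zero_le_one
  · have := hφ.convexOn.continuousOn_interior
    rw [interior_Ici] at this
    exact (this.continuousAt (Ioi_mem_nhds ht')).continuousWithinAt

/-- Every nonnegative threshold is a value of `φ`; this allows a level set of `φ ∘ f` to be
rewritten as a level set of `f`. -/
theorem IsOrliczFunction.exists_eq (hφ : IsOrliczFunction φ) {s : ℝ} (hs : 0 ≤ s) :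
    ∃ r, 0 ≤ r ∧ φ r = s := by
  obtain ⟨b, hb, hb0⟩ := ((hφ.tendsto.eventually_ge_atTop s).and
    (Filter.eventually_ge_atTop (0 : ℝ))).exists
  have := intermediate_value_Icc hb0 (hφ.continuousOn.mono Icc_subset_Ici_self)
  obtain ⟨r, hr, h⟩ := this ⟨by rwa [hφ.map_zero], hb⟩
  exact ⟨r, hr.1, h⟩

end OrliczFunction

/-! ### Decreasing rearrangement and equimeasurability. -/

section Rearrangement

variable {Ω : Type*} [MeasurableSpace Ω] {μ : Measure Ω} {f g : Ω → ℝ}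

/-- Measurable functions which are almost everywhere bounded. -/
structure BddMeas (μ : Measure Ω) (f : Ω → ℝ) : Prop where
  measurable : Measurable f
  bdd : ∃ M, 0 ≤ M ∧ ∀ᵐ x ∂μ, |f x| ≤ M

theorem BddMeas.add (hf : BddMeas μ f) (hg : BddMeas μ g) : BddMeas μ (f + g) := by
  obtain ⟨M, hM, hfM⟩ := hf.bdd
  obtain ⟨N, hN, hgN⟩ := hg.bdd
  refine ⟨hf.measurable.add hg.measurable, M + N, by positivity, ?_⟩
  filter_upwards [hfM, hgN] with x h1 h2
  exact (abs_add_le _ _).trans (add_le_add h1 h2)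

theorem BddMeas.const_mul (hf : BddMeas μ f) (c : ℝ) : BddMeas μ (fun x => c * f x) := by
  obtain ⟨M, hM, hfM⟩ := hf.bdd
  refine ⟨hf.measurable.const_mul c, |c| * M, by positivity, ?_⟩
  filter_upwards [hfM] with x h1
  rw [abs_mul]
  gcongr

theorem BddMeas.abs (hf : BddMeas μ f) : BddMeas μ (fun x => |f x|) :=
  ⟨measurable_norm.comp hf.measurable, by simpa using hf.bdd⟩

theorem distribution_antitone (μ : Measure Ω) (f : Ω → ℝ) : Antitone (distribution μ f) :=
  fun _ _ h => measure_mono fun _ hx => lt_of_le_of_lt h hx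

theorem distribution_eq_zero_of_ae_le {M : ℝ} (h : ∀ᵐ x ∂μ, |f x| ≤ M) :
    distribution μ f M = 0 := by
  rw [ae_iff] at h
  simpa [distribution] using h

theorem rearrangement_nonneg (μ : Measure Ω) (f : Ω → ℝ) (t : ℝ) : 0 ≤ rearrangement μ f t :=
  Real.sInf_nonneg fun _ h => h.1.le

/-- The distribution function is right continuous, so the infimum that defines the rearrangement can
be compared with `s` directly. Essential boundedness of `f` makes the set of admissible levels
nonempty. Nearly every fact about rearrangements is read off from this equivalence. -/
theorem lt_rearrangement_iff (hf : BddMeas μ f) {s t : ℝ} (hs : 0 ≤ s) :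
    s < rearrangement μ f t ↔ ENNReal.ofReal t < distribution μ f s := by
  have hbdd : BddBelow {s : ℝ | 0 < s ∧ distribution μ f s ≤ ENNReal.ofReal t} :=
    ⟨0, fun _ h => h.1.le⟩
  obtain ⟨M, hM, hfM⟩ := hf.bdd
  have hM1 : distribution μ f (M + 1) = 0 :=
    le_antisymm ((distribution_antitone μ f (by linarith)).trans
      (distribution_eq_zero_of_ae_le hfM).le) bot_le
  rw [← not_iff_not, not_lt, not_lt]
  constructor
  · intro h
    have key : ∀ k : ℕ, distribution μ f (s + 1 / (k + 1)) ≤ ENNReal.ofReal t := by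
      intro k
      have hk : (0 : ℝ) < 1 / (k + 1) := by positivity
      obtain ⟨r, ⟨hr0, hr⟩, hlt⟩ := exists_lt_of_csInf_lt
        (s := {s : ℝ | 0 < s ∧ distribution μ f s ≤ ENNReal.ofReal t})
        ⟨M + 1, by linarith, by simp [hM1]⟩ (show _ < s + 1 / ((k : ℝ) + 1) by
          exact lt_of_le_of_lt h (by linarith))
      exact (distribution_antitone μ f hlt.le).trans hr
    have hU : {x | s < |f x|} = ⋃ k : ℕ, {x | s + 1 / ((k : ℝ) + 1) < |f x|} := by
      ext x
      simp only [mem_ofPred_eq, mem_iUnion]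
      constructor
      · intro hx
        obtain ⟨k, hk⟩ := exists_nat_one_div_lt (sub_pos.2 hx)
        exact ⟨k, by linarith⟩
      · rintro ⟨k, hk⟩
        have : (0 : ℝ) < 1 / (k + 1) := by positivity
        linarith
    rw [distribution, hU, Monotone.measure_iUnion]
    · exact iSup_le key
    · intro j k hjk x hx
      have : 1 / ((k : ℝ) + 1) ≤ 1 / ((j : ℝ) + 1) := Nat.one_div_le_one_div hjk
      simp only [mem_ofPred_eq] at hx ⊢
      linarith
  · intro h
    refine le_of_forall_pos_le_add fun ε hε => csInf_le hbdd ⟨by positivity, ?_⟩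
    exact (distribution_antitone μ f (by linarith)).trans h

theorem rearrangement_antitone (hf : BddMeas μ f) : Antitone (rearrangement μ f) := by
  intro a b hab
  by_contra! h
  rw [lt_rearrangement_iff hf (rearrangement_nonneg _ _ _)] at h
  have := (ENNReal.ofReal_le_ofReal hab).trans_lt h
  rw [← lt_rearrangement_iff hf (rearrangement_nonneg _ _ _)] at this
  exact lt_irrefl _ this

theorem rearrangement_le_of_ae_le (hf : BddMeas μ f) {M : ℝ} (hM : 0 ≤ M)
    (h : ∀ᵐ x ∂μ, |f x| ≤ M) (t : ℝ) : rearrangement μ f t ≤ M := by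
  by_contra! h'
  rw [lt_rearrangement_iff hf hM, distribution_eq_zero_of_ae_le h] at h'
  exact not_lt_bot h'

theorem rearrangement_mono (hf : BddMeas μ f) (hg : BddMeas μ g)
    (h : ∀ᵐ x ∂μ, |f x| ≤ |g x|) (t : ℝ) : rearrangement μ f t ≤ rearrangement μ g t := by
  by_contra! h'
  have h0 := rearrangement_nonneg μ g t
  rw [lt_rearrangement_iff hf h0] at h'
  have : distribution μ f (rearrangement μ g t) ≤ distribution μ g (rearrangement μ g t) := by
    refine measure_mono_ae ?_
    filter_upwards [h] with x hx (h2 : _ < _)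
    exact lt_of_lt_of_le h2 hx
  exact lt_irrefl _ ((lt_rearrangement_iff hg h0).2 (h'.trans_le this))

/-- The rearrangement of an increasing function of `|f|`. -/
theorem rearrangement_comp_orlicz {φ : ℝ → ℝ} (hφ : IsOrliczFunction φ) {lam : ℝ}
    (hl : 0 < lam) (hf : BddMeas μ f) (hg : BddMeas μ fun x => φ (|f x| / lam)) (t : ℝ) :
    rearrangement μ (fun x => φ (|f x| / lam)) t = φ (rearrangement μ f t / lam) := by
  have h0 := rearrangement_nonneg μ f t
  refine eq_of_forall_lt_iff fun s => ?_
  rcases lt_or_ge s 0 with hs | hs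
  · exact iff_of_true (hs.trans_le (rearrangement_nonneg _ _ _))
      (hs.trans_le (hφ.nonneg (by positivity)))
  obtain ⟨r, hr, rfl⟩ := hφ.exists_eq hs
  rw [lt_rearrangement_iff hg hs, hφ.strictMonoOn.lt_iff_lt hr (by simp; positivity),
    lt_div_iff₀ hl, lt_rearrangement_iff hf (by positivity)]
  have : ∀ x, φ r < |φ (|f x| / lam)| ↔ r * lam < |f x| := fun x => by
    rw [abs_of_nonneg (hφ.nonneg (by positivity)),
      hφ.strictMonoOn.lt_iff_lt hr (by simp; positivity), lt_div_iff₀ hl]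
  simp only [distribution, this]

theorem BddMeas.comp_orlicz {φ : ℝ → ℝ} (hφ : IsOrliczFunction φ) {lam : ℝ}
    (hl : 0 < lam) (hf : BddMeas μ f) : BddMeas μ fun x => φ (|f x| / lam) := by
  obtain ⟨M, hM, hfM⟩ := hf.bdd
  constructor
  · have h1 : Continuous ((Ici (0 : ℝ)).domRestrict φ) := hφ.continuousOn.domRestrict
    have h2 : Measurable fun x => (⟨|f x| / lam, by simp; positivity⟩ : Ici (0 : ℝ)) :=
      Measurable.subtype_mk (hf.abs.measurable.div_const lam)
    exact h1.measurable.comp h2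
  · refine ⟨φ (M / lam), hφ.nonneg (by positivity), ?_⟩
    filter_upwards [hfM] with x hx
    rw [abs_of_nonneg (hφ.nonneg (by positivity))]
    exact hφ.strictMonoOn.monotoneOn (by simp; positivity) (by simp; positivity) (by gcongr)

/-- `|f|` and its rearrangement are equimeasurable. -/
theorem map_rearrangement [IsProbabilityMeasure μ] (hf : BddMeas μ f) :
    (volume.restrict (Ioo (0 : ℝ) 1)).map (rearrangement μ f) = μ.map fun x => |f x| := by
  have hm := (rearrangement_antitone hf).measurable
  have hp1 : IsProbabilityMeasure (volume.restrict (Ioo (0 : ℝ) 1)) := ⟨by simp⟩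
  have hp2 := Measure.isProbabilityMeasure_map (μ := volume.restrict (Ioo (0 : ℝ) 1))
    hm.aemeasurable
  have hp3 := Measure.isProbabilityMeasure_map (μ := μ) hf.abs.measurable.aemeasurable
  refine Measure.ext_of_Iic _ _ fun s => ?_
  rw [← compl_Ioi, prob_compl_eq_one_sub measurableSet_Ioi,
    prob_compl_eq_one_sub measurableSet_Ioi]
  congr 1
  rw [Measure.map_apply hm measurableSet_Ioi, Measure.map_apply hf.abs.measurable measurableSet_Ioi]
  rcases lt_or_ge s 0 with hs | hs
  · have h1 : rearrangement μ f ⁻¹' Ioi s = univ :=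
      eq_univ_of_forall fun t => hs.trans_le (rearrangement_nonneg μ f t)
    have h2 : (fun x => |f x|) ⁻¹' Ioi s = univ :=
      eq_univ_of_forall fun t => hs.trans_le (abs_nonneg _)
    rw [h1, h2, measure_univ, measure_univ]
  · rw [Measure.restrict_apply (hm measurableSet_Ioi)]
    change _ = distribution μ f s
    have hle : distribution μ f s ≤ 1 := prob_le_one
    have hne : distribution μ f s ≠ ⊤ := ne_top_of_le_ne_top (by simp) hle
    -- Superlevel sets of the rearrangement are intervals starting at `0` whose length is the
    -- distribution function.
    have : rearrangement μ f ⁻¹' Ioi s ∩ Ioo 0 1 = Ioo 0 (distribution μ f s).toReal := by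
      ext t
      simp only [mem_inter_iff, mem_preimage, mem_Ioi, lt_rearrangement_iff hf hs, mem_Ioo]
      have h1 : (distribution μ f s).toReal ≤ 1 := ENNReal.toReal_le_of_le_ofReal (by simp)
        (by simpa using hle)
      constructor
      · rintro ⟨h, h0, -⟩
        exact ⟨h0, (ENNReal.ofReal_lt_iff_lt_toReal h0.le hne).1 h⟩
      · rintro ⟨h0, h⟩
        exact ⟨(ENNReal.ofReal_lt_iff_lt_toReal h0.le hne).2 h, h0, h.trans_le h1⟩
    rw [this, Real.volume_Ioo, sub_zero, ENNReal.ofReal_toReal hne]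

theorem lintegral_rearrangement_comp [IsProbabilityMeasure μ] (hf : BddMeas μ f)
    {F : ℝ → ENNReal} (hF : Measurable F) :
    ∫⁻ t in Ioo (0 : ℝ) 1, F (rearrangement μ f t) = ∫⁻ x, F |f x| ∂μ := by
  rw [← lintegral_map hF (rearrangement_antitone hf).measurable, map_rearrangement hf,
    lintegral_map hF hf.abs.measurable]

end Rearrangement

end

section

/-! ### Subadditivity of the Lorentz functional. -/

section Lorentz

variable {Ω : Type*} [MeasurableSpace Ω] {μ : Measure Ω} {f g : Ω → ℝ}

/-- From `f^* ≤ (f^* - c)₊ + c` and equimeasurability. Together with the equality case for a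
suitable `c`, this is a variational formula for `∫_D f^*` in which the rearrangement no longer
appears on the right. -/
theorem setLIntegral_rearrangement_le [IsProbabilityMeasure μ] (hf : BddMeas μ f) {D : Set ℝ}
    (hD : D ⊆ Ioo 0 1) (c : ℝ) :
    ∫⁻ t in D, ENNReal.ofReal (rearrangement μ f t) ≤
      (∫⁻ x, ENNReal.ofReal (|f x| - c) ∂μ) + ENNReal.ofReal c * volume D := by
  calc ∫⁻ t in D, ENNReal.ofReal (rearrangement μ f t)
      ≤ ∫⁻ t in D, (ENNReal.ofReal (rearrangement μ f t - c) + ENNReal.ofReal c) := by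
        refine lintegral_mono fun t => ?_
        conv_lhs => rw [← sub_add_cancel (rearrangement μ f t) c]
        exact ENNReal.ofReal_add_le
    _ = (∫⁻ t in D, ENNReal.ofReal (rearrangement μ f t - c)) + ENNReal.ofReal c * volume D := by
        rw [lintegral_add_right _ measurable_const, setLIntegral_const]
    _ ≤ (∫⁻ t in Ioo (0 : ℝ) 1, ENNReal.ofReal (rearrangement μ f t - c))
          + ENNReal.ofReal c * volume D := by
        gcongr
    _ = _ := by
        rw [lintegral_rearrangement_comp hf (F := fun r => ENNReal.ofReal (r - c))
          (by fun_prop)]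

/-- On an initial segment `D` the values of `f^*` are at least those off `D`, so some level `c`
separates them; for this `c` the bound by `(f^* - c)₊ + c` loses nothing. -/
theorem exists_setLIntegral_rearrangement_eq [IsProbabilityMeasure μ] (hf : BddMeas μ f)
    {D : Set ℝ} (hD : D ⊆ Ioo 0 1) (hDm : MeasurableSet D)
    (hlow : ∀ s ∈ D, ∀ t ∈ Ioo (0 : ℝ) 1, t ≤ s → t ∈ D) :
    ∃ c, 0 ≤ c ∧ ∫⁻ t in D, ENNReal.ofReal (rearrangement μ f t) =
      (∫⁻ x, ENNReal.ofReal (|f x| - c) ∂μ) + ENNReal.ofReal c * volume D := by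
  have hanti := rearrangement_antitone hf
  obtain ⟨c, hc, h1, h2⟩ : ∃ c : ℝ, 0 ≤ c ∧ (∀ t ∈ D, c ≤ rearrangement μ f t) ∧
      ∀ t ∈ Ioo (0 : ℝ) 1 \ D, rearrangement μ f t ≤ c := by
    rcases (Ioo (0 : ℝ) 1 \ D).eq_empty_or_nonempty with h | h
    · exact ⟨0, le_rfl, fun t _ => rearrangement_nonneg _ _ _, by simp [h]⟩
    · refine ⟨sSup (rearrangement μ f '' (Ioo (0 : ℝ) 1 \ D)),
        Real.sSup_nonneg ?_, fun t ht => csSup_le (h.image _) ?_, fun t ht =>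
          le_csSup ?_ (mem_image_of_mem _ ht)⟩
      · rintro _ ⟨t, -, rfl⟩
        exact rearrangement_nonneg _ _ _
      · rintro _ ⟨s, hs, rfl⟩
        refine hanti (le_of_lt ?_)
        by_contra! hst
        exact hs.2 (hlow t ht s hs.1 hst)
      · refine ⟨rearrangement μ f 0, ?_⟩
        rintro _ ⟨s, hs, rfl⟩
        exact hanti hs.1.1.le
  refine ⟨c, hc, ?_⟩
  rw [← lintegral_rearrangement_comp hf (F := fun r => ENNReal.ofReal (r - c)) (by fun_prop)]
  have h3 : ∫⁻ t in Ioo (0 : ℝ) 1, ENNReal.ofReal (rearrangement μ f t - c) =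
      ∫⁻ t in D, ENNReal.ofReal (rearrangement μ f t - c) := by
    rw [← lintegral_inter_add_sdiff _ (Ioo (0 : ℝ) 1) hDm, inter_eq_self_of_subset_right hD]
    rw [setLIntegral_congr_fun (g := fun _ => 0) (measurableSet_Ioo.diff hDm)]
    · simp
    · intro t ht
      exact ENNReal.ofReal_of_nonpos (sub_nonpos.2 (h2 t ht))
  rw [h3, ← setLIntegral_const, ← lintegral_add_right _ measurable_const]
  refine setLIntegral_congr_fun hDm fun t ht => ?_
  rw [← ENNReal.ofReal_add (sub_nonneg.2 (h1 t ht)) hc, sub_add_cancel]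

/-- With `c`, `d` optimal for `f`, `g`, the level `c + d` is admissible for the sum, and `(|f + g| -
(c + d))₊ ≤ (|f| - c)₊ + (|g| - d)₊`. -/
theorem setLIntegral_rearrangement_add_le [IsProbabilityMeasure μ] (hf : BddMeas μ f)
    (hg : BddMeas μ g) {D : Set ℝ} (hD : D ⊆ Ioo 0 1) (hDm : MeasurableSet D)
    (hlow : ∀ s ∈ D, ∀ t ∈ Ioo (0 : ℝ) 1, t ≤ s → t ∈ D) :
    ∫⁻ t in D, ENNReal.ofReal (rearrangement μ (f + g) t) ≤
      (∫⁻ t in D, ENNReal.ofReal (rearrangement μ f t)) +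
        ∫⁻ t in D, ENNReal.ofReal (rearrangement μ g t) := by
  obtain ⟨c, hc, h1⟩ := exists_setLIntegral_rearrangement_eq hf hD hDm hlow
  obtain ⟨d, hd, h2⟩ := exists_setLIntegral_rearrangement_eq hg hD hDm hlow
  rw [h1, h2]
  refine (setLIntegral_rearrangement_le (hf.add hg) hD (c + d)).trans ?_
  rw [ENNReal.ofReal_add hc hd, add_mul, add_add_add_comm,
    ← lintegral_add_left (by exact ((hf.abs.measurable.sub_const c).ennreal_ofReal))]
  gcongr with x
  refine (ENNReal.ofReal_le_ofReal ?_).trans ENNReal.ofReal_add_le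
  have := abs_add_le (f x) (g x)
  simp only [Pi.add_apply]
  linarith

/-- The Lorentz functional `∫ f^* ω`. -/
noncomputable def lorentz (μ : Measure Ω) (ω : ℝ → ℝ) (f : Ω → ℝ) : ENNReal :=
  ∫⁻ t in Ioo (0 : ℝ) 1, ENNReal.ofReal (rearrangement μ f t) * ENNReal.ofReal (ω t)

theorem IsWeight.aemeasurable {ω : ℝ → ℝ} (hω : IsWeight ω) :
    AEMeasurable ω (volume.restrict (Ioo 0 1)) :=
  aemeasurable_restrict_of_antitoneOn measurableSet_Ioo hω.antitoneOn

/-- Layer-cake decomposition of `ω`. As `ω` is nonincreasing, its superlevel sets are initial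
segments of `(0,1)`, the sets on which subadditivity is available. -/
theorem lorentz_eq_lintegral {ω : ℝ → ℝ} (hω : IsWeight ω) (hf : BddMeas μ f) :
    lorentz μ ω f = ∫⁻ s in Ioi (0 : ℝ), ∫⁻ t in {t ∈ Ioo (0 : ℝ) 1 | s < ω t},
      ENNReal.ofReal (rearrangement μ f t) := by
  have hm : Measurable fun t => ENNReal.ofReal (rearrangement μ f t) :=
    (rearrangement_antitone hf).measurable.ennreal_ofReal
  have hac := withDensity_absolutelyContinuous (volume.restrict (Ioo (0 : ℝ) 1))
    (fun t => ENNReal.ofReal (rearrangement μ f t))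
  have h0 : 0 ≤ᵐ[volume.restrict (Ioo (0 : ℝ) 1)] ω := by
    filter_upwards [ae_restrict_mem measurableSet_Ioo] with t ht using (hω.pos t ht).le
  rw [lorentz]
  change lintegral _ ((fun t => ENNReal.ofReal (rearrangement μ f t)) *
    fun t => ENNReal.ofReal (ω t)) = _
  rw [← lintegral_withDensity_eq_lintegral_mul₀ hm.aemeasurable hω.aemeasurable.ennreal_ofReal,
    lintegral_eq_lintegral_meas_lt _ (hac.ae_le h0) (hω.aemeasurable.mono_ac hac)]
  refine lintegral_congr fun s => ?_
  rw [withDensity_apply']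
  rw [Measure.restrict_restrict' measurableSet_Ioo]
  congr 2
  ext t
  simp [and_comm]

theorem lorentz_add_le [IsProbabilityMeasure μ] {ω : ℝ → ℝ} (hω : IsWeight ω)
    (hf : BddMeas μ f) (hg : BddMeas μ g) :
    lorentz μ ω (f + g) ≤ lorentz μ ω f + lorentz μ ω g := by
  have hlow : ∀ s : ℝ, ∀ a ∈ {t ∈ Ioo (0 : ℝ) 1 | s < ω t}, ∀ t ∈ Ioo (0 : ℝ) 1, t ≤ a →
      t ∈ {t ∈ Ioo (0 : ℝ) 1 | s < ω t} :=
    fun s a ha t ht hta => ⟨ht, ha.2.trans_le (hω.antitoneOn ht ha.1 hta)⟩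
  have hmono : ∀ h : Ω → ℝ, Antitone fun s : ℝ => ∫⁻ t in {t ∈ Ioo (0 : ℝ) 1 | s < ω t},
      ENNReal.ofReal (rearrangement μ h t) := fun h a b hab =>
    lintegral_mono_set fun t ht => ⟨ht.1, hab.trans_lt ht.2⟩
  rw [lorentz_eq_lintegral hω hf, lorentz_eq_lintegral hω hg, lorentz_eq_lintegral hω (hf.add hg),
    ← lintegral_add_left (hmono f).measurable]
  refine lintegral_mono fun s => setLIntegral_rearrangement_add_le hf hg (fun t ht => ht.1) ?_
    (hlow s)
  refine OrdConnected.measurableSet ⟨fun a ha b hb t ht => hlow s b hb t ?_ ht.2⟩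
  exact ⟨ha.1.1.trans_le ht.1, ht.2.trans_lt hb.1.2⟩

theorem rearrangement_const_mul (hf : BddMeas μ f) {c : ℝ} (hc : 0 < c) (t : ℝ) :
    rearrangement μ (fun x => c * f x) t = c * rearrangement μ f t := by
  have h0 := rearrangement_nonneg μ f t
  refine eq_of_forall_lt_iff fun s => ?_
  rcases lt_or_ge s 0 with hs | hs
  · exact iff_of_true (hs.trans_le (rearrangement_nonneg _ _ _)) (hs.trans_le (by positivity))
  rw [lt_rearrangement_iff (hf.const_mul c) hs, ← div_lt_iff₀' hc,
    lt_rearrangement_iff hf (by positivity)]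
  have : ∀ x, s < |c * f x| ↔ s / c < |f x| := fun x => by
    rw [abs_mul, abs_of_pos hc, div_lt_iff₀' hc]
  simp only [distribution, this]

theorem lorentz_const_mul {ω : ℝ → ℝ} (hf : BddMeas μ f) {c : ℝ} (hc : 0 < c) :
    lorentz μ ω (fun x => c * f x) = ENNReal.ofReal c * lorentz μ ω f := by
  rw [lorentz, lorentz, ← lintegral_const_mul' _ _ (by simp)]
  refine lintegral_congr fun t => ?_
  rw [rearrangement_const_mul hf hc, ENNReal.ofReal_mul hc.le, mul_assoc]

theorem lorentz_mono {ω : ℝ → ℝ} (hf : BddMeas μ f) (hg : BddMeas μ g)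
    (h : ∀ᵐ x ∂μ, |f x| ≤ |g x|) : lorentz μ ω f ≤ lorentz μ ω g := by
  refine lintegral_mono fun t => ?_
  gcongr
  exact rearrangement_mono hf hg h t

end Lorentz

/-! ### The modular and the Luxemburg norm. -/

section Modular

variable {Ω : Type*} [MeasurableSpace Ω] {μ : Measure Ω} {f g : Ω → ℝ} {φ ω : ℝ → ℝ}

/-- An increasing function commutes with rearrangement, so `φ` can be moved inside it; the modular
then inherits subadditivity from the Lorentz functional. -/
theorem modular_eq_lorentz (hφ : IsOrliczFunction φ) (hf : BddMeas μ f)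
    {lam : ℝ} (hl : 0 < lam) :
    modular μ φ ω f lam = lorentz μ ω fun x => φ (|f x| / lam) := by
  refine lintegral_congr fun t => ?_
  have := rearrangement_nonneg μ f t
  rw [rearrangement_comp_orlicz hφ hl hf (hf.comp_orlicz hφ hl),
    ENNReal.ofReal_mul (hφ.nonneg (by positivity))]

theorem modular_add_le [IsProbabilityMeasure μ] (hφ : IsOrliczFunction φ) (hω : IsWeight ω)
    (hf : BddMeas μ f) (hg : BddMeas μ g) {a b : ℝ} (ha : 0 < a) (hb : 0 < b) :
    modular μ φ ω (f + g) (a + b) ≤ ENNReal.ofReal (a / (a + b)) * modular μ φ ω f a +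
      ENNReal.ofReal (b / (a + b)) * modular μ φ ω g b := by
  have hab : 0 < a + b := by positivity
  have hf' := hf.comp_orlicz hφ ha
  have hg' := hg.comp_orlicz hφ hb
  rw [modular_eq_lorentz hφ hf ha, modular_eq_lorentz hφ hg hb,
    modular_eq_lorentz hφ (hf.add hg) hab, ← lorentz_const_mul hf' (by positivity),
    ← lorentz_const_mul hg' (by positivity)]
  refine le_trans (lorentz_mono ((hf.add hg).comp_orlicz hφ hab)
    ((hf'.const_mul (a / (a + b))).add (hg'.const_mul (b / (a + b)))) (.of_forall fun x => ?_))
    (lorentz_add_le hω (hf'.const_mul _) (hg'.const_mul _))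
  have h1 : 0 ≤ φ (|f x| / a) := hφ.nonneg (by positivity)
  have h2 : 0 ≤ φ (|g x| / b) := hφ.nonneg (by positivity)
  simp only [Pi.add_apply]
  rw [abs_of_nonneg (hφ.nonneg (t := |f x + g x| / (a + b)) (by positivity)),
    abs_of_nonneg (add_nonneg (mul_nonneg (by positivity) h1) (mul_nonneg (by positivity) h2))]
  have hm : φ (|f x + g x| / (a + b)) ≤ φ (a / (a + b) * (|f x| / a) + b / (a + b) * (|g x| / b)) := by
    refine hφ.strictMonoOn.monotoneOn (by simp; positivity) (by simp; positivity) ?_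
    have : a / (a + b) * (|f x| / a) + b / (a + b) * (|g x| / b) = (|f x| + |g x|) / (a + b) := by
      field_simp
    rw [this]
    gcongr
    exact abs_add_le _ _
  have hc := hφ.convexOn.2 (show |f x| / a ∈ Ici 0 by simp; positivity)
    (show |g x| / b ∈ Ici 0 by simp; positivity) (show 0 ≤ a / (a + b) by positivity)
    (show 0 ≤ b / (a + b) by positivity) (by field_simp)
  exact hm.trans hc

theorem modular_mono (hφ : IsOrliczFunction φ) (hω : IsWeight ω) (hf : BddMeas μ f)
    (hg : BddMeas μ g) (h : ∀ᵐ x ∂μ, |f x| ≤ |g x|) {lam : ℝ} (hl : 0 < lam) :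
    modular μ φ ω f lam ≤ modular μ φ ω g lam := by
  refine setLIntegral_mono_ae' measurableSet_Ioo (.of_forall fun t ht => ?_)
  have h0 := rearrangement_nonneg μ f t
  have h1 := rearrangement_mono hf hg h t
  have h2 := (hω.pos t ht).le
  gcongr
  exact hφ.strictMonoOn.monotoneOn (by simp; positivity)
    (by simp only [mem_Ici]; have := h0.trans h1; positivity) (by gcongr)

theorem modular_antitone (hφ : IsOrliczFunction φ) (hω : IsWeight ω) (μ : Measure Ω) (f : Ω → ℝ)
    {a b : ℝ} (ha : 0 < a) (hab : a ≤ b) : modular μ φ ω f b ≤ modular μ φ ω f a := by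
  refine setLIntegral_mono_ae' measurableSet_Ioo (.of_forall fun t ht => ?_)
  have h0 := rearrangement_nonneg μ f t
  have h2 := (hω.pos t ht).le
  have hb := ha.trans_le hab
  gcongr
  exact hφ.strictMonoOn.monotoneOn (by simp; positivity) (by simp; positivity) (by gcongr)

theorem IsWeight.lintegral_mul_ne_top (hω : IsWeight ω) (c : ℝ) :
    ∫⁻ t in Ioo (0 : ℝ) 1, ENNReal.ofReal (c * ω t) ≠ ⊤ := by
  have := (hω.integrableOn.const_mul c)
  exact (this.lintegral_lt_top).ne

theorem aemeasurable_modular_integrand (hφ : IsOrliczFunction φ) (hω : IsWeight ω)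
    (hf : BddMeas μ f) {lam : ℝ} (hl : 0 < lam) :
    AEMeasurable (fun t => ENNReal.ofReal (φ (rearrangement μ f t / lam) * ω t))
      (volume.restrict (Ioo 0 1)) := by
  have h : Antitone fun t => φ (rearrangement μ f t / lam) := fun a b hab => by
    have h0 := rearrangement_nonneg μ f a
    have h1 := rearrangement_nonneg μ f b
    have := rearrangement_antitone hf hab
    exact hφ.strictMonoOn.monotoneOn (by simp; positivity) (by simp; positivity) (by gcongr)
  exact (h.measurable.aemeasurable.mul hω.aemeasurable).ennreal_ofReal

theorem modular_ne_top (hφ : IsOrliczFunction φ) (hω : IsWeight ω) (hf : BddMeas μ f)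
    {lam : ℝ} (hl : 0 < lam) : modular μ φ ω f lam ≠ ⊤ := by
  obtain ⟨M, hM, hfM⟩ := hf.bdd
  refine ne_top_of_le_ne_top (hω.lintegral_mul_ne_top (φ (M / lam))) ?_
  refine setLIntegral_mono_ae' measurableSet_Ioo (.of_forall fun t ht => ?_)
  have h0 := rearrangement_nonneg μ f t
  have h2 := (hω.pos t ht).le
  gcongr
  exact hφ.strictMonoOn.monotoneOn (by simp; positivity) (by simp; positivity)
    (by gcongr; exact rearrangement_le_of_ae_le hf hM hfM t)

theorem tendsto_modular (hφ : IsOrliczFunction φ) (hω : IsWeight ω) (hf : BddMeas μ f)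
    {lam : ℝ} (hl : 0 < lam) :
    Filter.Tendsto (modular μ φ ω f) (nhds lam) (nhds (modular μ φ ω f lam)) := by
  have hev : ∀ᶠ s in nhds lam, lam / 2 < s := lt_mem_nhds (by linarith)
  refine tendsto_lintegral_filter_of_dominated_convergence'
    -- For parameters above `lam / 2` the integrand at `lam / 2` dominates, and its integral is
    -- finite.
    (fun t => ENNReal.ofReal (φ (rearrangement μ f t / (lam / 2)) * ω t)) ?_ ?_
    (modular_ne_top hφ hω hf (half_pos hl)) ?_
  · filter_upwards [hev] with s hs using
      aemeasurable_modular_integrand hφ hω hf ((half_pos hl).trans hs)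
  · filter_upwards [hev] with s hs
    filter_upwards [ae_restrict_mem measurableSet_Ioo] with t ht
    have h0 := rearrangement_nonneg μ f t
    have h2 := (hω.pos t ht).le
    have hs0 := (half_pos hl).trans hs
    gcongr
    exact hφ.strictMonoOn.monotoneOn (by simp; positivity) (by simp; positivity) (by gcongr)
  · refine .of_forall fun t => ?_
    have h0 := rearrangement_nonneg μ f t
    refine ENNReal.tendsto_ofReal (Filter.Tendsto.mul_const _ ?_)
    have h1 : Filter.Tendsto (fun s => rearrangement μ f t / s) (nhds lam)
        (nhdsWithin (rearrangement μ f t / lam) (Ici 0)) := by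
      refine tendsto_nhdsWithin_iff.2 ⟨tendsto_const_nhds.div Filter.tendsto_id hl.ne', ?_⟩
      filter_upwards [hev] with s hs
      have := (half_pos hl).trans hs
      simp only [mem_Ici]
      positivity
    exact (hφ.continuousOn _ (by simp; positivity)).tendsto.comp h1

theorem exists_modular_le_one (hφ : IsOrliczFunction φ) (hω : IsWeight ω) (hf : BddMeas μ f) :
    ∃ lam, 0 < lam ∧ modular μ φ ω f lam ≤ 1 := by
  have h1 := modular_ne_top (ω := ω) hφ hω hf one_pos
  set A := (modular μ φ ω f 1).toReal with hA
  have hA0 : 0 ≤ A := ENNReal.toReal_nonneg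
  -- Convexity and `φ 0 = 0` divide the modular at `1` by at least `A + 1`, and `A / (A + 1) ≤ 1`.
  refine ⟨A + 1, by positivity, ?_⟩
  calc modular μ φ ω f (A + 1) ≤ ENNReal.ofReal (1 / (A + 1)) * modular μ φ ω f 1 := by
        rw [modular, modular, ← lintegral_const_mul' _ _ (by simp)]
        refine setLIntegral_mono_ae' measurableSet_Ioo (.of_forall fun t ht => ?_)
        have h0 := rearrangement_nonneg μ f t
        have h2 := (hω.pos t ht).le
        rw [← ENNReal.ofReal_mul (by positivity), ← mul_assoc]
        gcongr
        rw [div_one]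
        have := hφ.map_mul_le (c := 1 / (A + 1)) (t := rearrangement μ f t / 1) (by positivity)
          ((div_le_one (by positivity)).2 (by linarith)) (by positivity)
        rwa [one_div_mul_eq_div, div_one] at this
    _ = ENNReal.ofReal (1 / (A + 1) * A) := by
        rw [ENNReal.ofReal_mul (by positivity), hA, ENNReal.ofReal_toReal h1]
    _ ≤ 1 := by
        rw [ENNReal.ofReal_le_one, one_div_mul_eq_div, div_le_one (by positivity)]
        linarith

theorem luxNorm_nonneg (μ : Measure Ω) (φ ω : ℝ → ℝ) (f : Ω → ℝ) : 0 ≤ luxNorm μ φ ω f :=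
  Real.sInf_nonneg fun _ h => h.1.le

theorem luxNorm_le_of_modular_le {lam : ℝ} (hl : 0 < lam) (h : modular μ φ ω f lam ≤ 1) :
    luxNorm μ φ ω f ≤ lam :=
  csInf_le ⟨0, fun _ h => h.1.le⟩ ⟨hl, h⟩

theorem modular_le_one_of_luxNorm_lt (hφ : IsOrliczFunction φ) (hω : IsWeight ω)
    (hf : BddMeas μ f) {lam : ℝ} (h : luxNorm μ φ ω f < lam) : modular μ φ ω f lam ≤ 1 := by
  obtain ⟨a, ha, hal⟩ := exists_lt_of_csInf_lt (exists_modular_le_one hφ hω hf) h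
  exact (modular_antitone hφ hω μ f ha.1 hal.le).trans ha.2

theorem modular_luxNorm_le_one (hφ : IsOrliczFunction φ) (hω : IsWeight ω)
    (hf : BddMeas μ f) (h : 0 < luxNorm μ φ ω f) : modular μ φ ω f (luxNorm μ φ ω f) ≤ 1 := by
  refine le_of_tendsto ((tendsto_modular hφ hω hf h).mono_left
    (nhdsWithin_le_nhds (s := Ioi (luxNorm μ φ ω f)))) ?_
  filter_upwards [self_mem_nhdsWithin] with s hs using modular_le_one_of_luxNorm_lt hφ hω hf hs

theorem luxNorm_mono (hφ : IsOrliczFunction φ) (hω : IsWeight ω) (hf : BddMeas μ f)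
    (hg : BddMeas μ g) (h : ∀ᵐ x ∂μ, |f x| ≤ |g x|) : luxNorm μ φ ω f ≤ luxNorm μ φ ω g := by
  refine le_of_forall_gt_imp_ge_of_dense fun s hs => ?_
  have h0 := (luxNorm_nonneg μ φ ω g).trans_lt hs
  exact luxNorm_le_of_modular_le h0 ((modular_mono hφ hω hf hg h h0).trans
    (modular_le_one_of_luxNorm_lt hφ hω hg hs))

theorem luxNorm_add_le [IsProbabilityMeasure μ] (hφ : IsOrliczFunction φ) (hω : IsWeight ω)
    (hf : BddMeas μ f) (hg : BddMeas μ g) :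
    luxNorm μ φ ω (f + g) ≤ luxNorm μ φ ω f + luxNorm μ φ ω g := by
  refine le_of_forall_pos_le_add fun ε hε => ?_
  have ha : 0 < luxNorm μ φ ω f + ε / 2 := by have := luxNorm_nonneg μ φ ω f; positivity
  have hb : 0 < luxNorm μ φ ω g + ε / 2 := by have := luxNorm_nonneg μ φ ω g; positivity
  have h1 := modular_le_one_of_luxNorm_lt hφ hω hf (lam := luxNorm μ φ ω f + ε / 2) (by linarith)
  have h2 := modular_le_one_of_luxNorm_lt hφ hω hg (lam := luxNorm μ φ ω g + ε / 2) (by linarith)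
  have := luxNorm_le_of_modular_le (add_pos ha hb) ((modular_add_le hφ hω hf hg ha hb).trans
    (le_trans (add_le_add (mul_le_mul_right h1 _) (mul_le_mul_right h2 _)) (by
      rw [mul_one, mul_one, ← ENNReal.ofReal_add (by positivity) (by positivity), ← add_div,
        div_self (by positivity), ENNReal.ofReal_one])))
  linarith

open scoped Pointwise in
theorem luxNorm_const_mul (hf : BddMeas μ f) {c : ℝ} (hc : 0 < c) :
    luxNorm μ φ ω (fun x => c * f x) = c * luxNorm μ φ ω f := by
  have h : {lam : ℝ | 0 < lam ∧ modular μ φ ω (fun x => c * f x) lam ≤ 1} =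
      c • {lam : ℝ | 0 < lam ∧ modular μ φ ω f lam ≤ 1} := by
    ext s
    rw [mem_smul_set_iff_inv_smul_mem₀ hc.ne']
    simp only [mem_ofPred_eq, smul_eq_mul, modular, rearrangement_const_mul hf hc]
    have h1 : ∀ t, c * rearrangement μ f t / s = rearrangement μ f t / (c⁻¹ * s) := fun t => by
      field_simp
    simp only [h1, inv_pos, hc, mul_pos_iff_of_pos_left]
  rw [luxNorm, h, Real.sInf_smul_of_nonneg hc.le, smul_eq_mul, luxNorm]

theorem luxNorm_congr_distribution {Ω' : Type*} [MeasurableSpace Ω'] {ν : Measure Ω'}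
    {g : Ω' → ℝ} (h : ∀ s, distribution μ f s = distribution ν g s) :
    luxNorm μ φ ω f = luxNorm ν φ ω g := by
  have : rearrangement μ f = rearrangement ν g := by
    funext t
    simp only [rearrangement, h]
  simp only [luxNorm, modular, this]

/-- A rearrangement is strictly smaller somewhere if the function is. -/
theorem exists_rearrangement_lt [IsProbabilityMeasure μ] (hf : BddMeas μ f) (hg : BddMeas μ g)
    (h : ∀ᵐ x ∂μ, |f x| ≤ |g x|) (hlt : μ {x | |f x| < |g x|} ≠ 0) :
    ∃ a b, a < b ∧ Ioo a b ⊆ Ioo (0 : ℝ) 1 ∧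
      ∀ t ∈ Ioo a b, rearrangement μ f t < rearrangement μ g t := by
  -- A rational level `q` separates `|f|` from `|g|` on a set of positive measure. The distributions
  -- at `q` then differ, and they are the end points of the interval sought.
  have hU : {x | |f x| < |g x|} ⊆ ⋃ q : ℚ, {x | |f x| ≤ q ∧ (q : ℝ) < |g x|} := by
    intro x hx
    rw [mem_ofPred_eq] at hx
    obtain ⟨q, h1, h2⟩ := exists_rat_btwn hx
    exact mem_iUnion.2 ⟨q, h1.le, h2⟩
  obtain ⟨q, hq⟩ : ∃ q : ℚ, μ {x | |f x| ≤ q ∧ (q : ℝ) < |g x|} ≠ 0 := by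
    by_contra! h0
    exact hlt (measure_mono_null hU (measure_iUnion_null h0))
  have hq0 : (0 : ℝ) ≤ q := by
    obtain ⟨x, hx⟩ := nonempty_of_measure_ne_zero hq
    exact (abs_nonneg _).trans hx.1
  have hm : MeasurableSet {x | (q : ℝ) < |f x|} := measurableSet_lt measurable_const hf.abs.measurable
  have hne : ∀ h : Ω → ℝ, distribution μ h q ≠ ⊤ := fun h => measure_ne_top μ _
  have hlt' : distribution μ f q < distribution μ g q := by
    have h1 : distribution μ f q + μ {x | |f x| ≤ q ∧ (q : ℝ) < |g x|} ≤ distribution μ g q := by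
      rw [distribution, ← measure_union' _ hm]
      · refine measure_mono_ae ?_
        filter_upwards [h] with x hx hx'
        rcases hx' with hx' | hx'
        · exact lt_of_lt_of_le hx' hx
        · exact hx'.2
      · exact disjoint_left.2 fun x (hx : _ < _) hx' => absurd hx'.1 (not_le.2 hx)
    exact (ENNReal.lt_add_right (hne f) hq).trans_le h1
  refine ⟨(distribution μ f q).toReal, (distribution μ g q).toReal,
    (ENNReal.toReal_lt_toReal (hne f) (hne g)).2 hlt', ?_, fun t ht => ?_⟩
  · refine Ioo_subset_Ioo ENNReal.toReal_nonneg ?_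
    exact ENNReal.toReal_le_of_le_ofReal zero_le_one (by rw [ENNReal.ofReal_one]; exact prob_le_one)
  · have ht0 : 0 ≤ t := ENNReal.toReal_nonneg.trans ht.1.le
    have h1 : (q : ℝ) < rearrangement μ g t := by
      rw [lt_rearrangement_iff hg hq0]
      exact (ENNReal.ofReal_lt_iff_lt_toReal ht0 (hne g)).2 ht.2
    refine lt_of_le_of_lt ?_ h1
    rw [← not_lt, lt_rearrangement_iff hf hq0, not_lt]
    exact (ENNReal.le_ofReal_iff_toReal_le (hne f) ht0).2 ht.1.le

/-- The rearrangements differ strictly on an interval, where `ω > 0` and `φ` is strictly increasing.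
Hence the modular of `f` at the norm of `g` is below `1`, and by continuity it stays below `1` at
some smaller parameter. -/
theorem luxNorm_lt_luxNorm [IsProbabilityMeasure μ] (hφ : IsOrliczFunction φ) (hω : IsWeight ω)
    (hf : BddMeas μ f) (hg : BddMeas μ g) (h : ∀ᵐ x ∂μ, |f x| ≤ |g x|)
    (hlt : μ {x | |f x| < |g x|} ≠ 0) (hpos : 0 < luxNorm μ φ ω g) :
    luxNorm μ φ ω f < luxNorm μ φ ω g := by
  set lam := luxNorm μ φ ω g with hlam
  obtain ⟨a, b, hab, hsub, hlt'⟩ := exists_rearrangement_lt hf hg h hlt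
  have h1 : modular μ φ ω f lam < 1 := by
    refine lt_of_lt_of_le ?_ (modular_luxNorm_le_one hφ hω hg hpos)
    refine lintegral_strict_mono_of_ae_le_of_ae_lt_on (s := Ioo a b)
      (aemeasurable_modular_integrand hφ hω hg hpos) (modular_ne_top hφ hω hf hpos) ?_ ?_ ?_
    · filter_upwards [ae_restrict_mem measurableSet_Ioo] with t ht
      have h0 := rearrangement_nonneg μ f t
      have h1 := rearrangement_mono hf hg h t
      have h2 := (hω.pos t ht).le
      gcongr
      exact hφ.strictMonoOn.monotoneOn (by simp; positivity)
        (by simp only [mem_Ici]; have := h0.trans h1; positivity) (by gcongr)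
    · rw [Measure.restrict_apply measurableSet_Ioo, inter_eq_self_of_subset_left hsub]
      simp [hab]
    · refine .of_forall fun t ht => ?_
      have h0 := rearrangement_nonneg μ f t
      have h1 := hlt' t ht
      have h3 := h0.trans_lt h1
      have h2 := hω.pos t (hsub ht)
      have h4 : φ (rearrangement μ f t / lam) < φ (rearrangement μ g t / lam) :=
        hφ.strictMonoOn (by simp; positivity) (by simp; positivity) (by gcongr)
      have h5 : 0 ≤ φ (rearrangement μ f t / lam) := hφ.nonneg (by positivity)
      rw [ENNReal.ofReal_lt_ofReal_iff_of_nonneg (by positivity)]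
      gcongr
  have hev := ((tendsto_modular hφ hω hf hpos).eventually (gt_mem_nhds h1))
  obtain ⟨s, ⟨hs1, hs2⟩, hs3⟩ := (((hev.filter_mono
    (nhdsWithin_le_nhds (s := Iio lam))).and (nhdsWithin_le_nhds (lt_mem_nhds hpos))).and
      self_mem_nhdsWithin).exists
  exact (luxNorm_le_of_modular_le hs2 hs1.le).trans_lt hs3

theorem luxNorm_pos [IsProbabilityMeasure μ] (hφ : IsOrliczFunction φ) (hω : IsWeight ω)
    (hf : BddMeas μ f) (h : μ {x | f x ≠ 0} ≠ 0) : 0 < luxNorm μ φ ω f := by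
  have h0 : BddMeas μ fun _ : Ω => (0 : ℝ) := ⟨measurable_const, 0, le_rfl, by simp⟩
  obtain ⟨a, b, hab, hsub, hlt⟩ := exists_rearrangement_lt h0 hf (by simp) (by simpa using h)
  by_contra! h1
  have h1 := le_antisymm h1 (luxNorm_nonneg μ φ ω f)
  have hmid : (a + b) / 2 ∈ Ioo a b := ⟨by linarith, by linarith⟩
  set r := rearrangement μ f ((a + b) / 2) with hr
  have hr0 : 0 < r := (rearrangement_nonneg _ _ _).trans_lt (hlt _ hmid)
  set c := (a + b) / 2 with hc
  have hcI := hsub hmid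
  have hwc := hω.pos c hcI
  -- At the parameter `r / k` the argument of `φ` is at least `k` on `(0, c)` and the weight is at
  -- least `ω c` there. Thus the modular exceeds `1`, which norm zero excludes.
  obtain ⟨k, hk, hk1⟩ : ∃ k : ℝ, 1 < φ k * ω c * c ∧ 0 < k := by
    have : Filter.Tendsto (fun k => φ k * (ω c * c)) Filter.atTop Filter.atTop :=
      hφ.tendsto.atTop_mul_const (mul_pos hwc hcI.1)
    obtain ⟨k, h1, h2⟩ := ((this.eventually_gt_atTop 1).and (Filter.eventually_gt_atTop 0)).exists
    exact ⟨k, by rwa [mul_assoc], h2⟩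
  have hk2 : 0 < r / k := by positivity
  have hle := modular_le_one_of_luxNorm_lt (lam := r / k) hφ hω hf (by rwa [h1])
  have : ENNReal.ofReal (φ k * ω c * c) ≤ modular μ φ ω f (r / k) := by
    calc ENNReal.ofReal (φ k * ω c * c)
        = ∫⁻ t in Ioo 0 c, ENNReal.ofReal (φ k * ω c) := by
          rw [setLIntegral_const, Real.volume_Ioo, sub_zero, ENNReal.ofReal_mul]
          have := hφ.pos k hk1
          positivity
      _ ≤ ∫⁻ t in Ioo 0 c, ENNReal.ofReal (φ (rearrangement μ f t / (r / k)) * ω t) := by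
          refine setLIntegral_mono_ae' measurableSet_Ioo (.of_forall fun t ht => ?_)
          have hrt : r ≤ rearrangement μ f t := rearrangement_antitone hf ht.2.le
          have hr' := hr0.trans_le hrt
          have h3 : k ≤ rearrangement μ f t / (r / k) := by
            rw [le_div_iff₀ hk2]
            field_simp
            exact hrt
          have h4 := hφ.strictMonoOn.monotoneOn (show k ∈ Ici 0 from hk1.le)
            (show rearrangement μ f t / (r / k) ∈ Ici 0 by simp only [mem_Ici]; positivity) h3
          have h5 := hω.antitoneOn ⟨ht.1, ht.2.trans hcI.2⟩ hcI ht.2.le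
          have h6 := (hφ.pos k hk1).trans_le h4
          gcongr
      _ ≤ _ := lintegral_mono_set (Ioo_subset_Ioo_right hcI.2.le)
  have h7 := this.trans hle
  rw [ENNReal.ofReal_le_one] at h7
  linarith

end Modular

end

section

/-! ### Positive sublinear functionals as support functions. -/

section Sublinear

variable {E : Type*} [NormedAddCommGroup E] [InnerProductSpace ℝ E]

/-- Sublinear functionals which are positive away from zero, i.e. the support functions of convex
bodies containing the origin in their interior. -/
structure IsPosSublinear (p : E → ℝ) : Prop where
  map_smul : ∀ c : ℝ, 0 < c → ∀ x, p (c • x) = c * p x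
  add_le : ∀ x y, p (x + y) ≤ p x + p y
  pos : ∀ x, x ≠ 0 → 0 < p x
  bdd : ∃ C, ∀ x, p x ≤ C * ‖x‖

/-- The intersection of the half-spaces `⟪x, y⟫ ≤ p x`. -/
def polarBody (p : E → ℝ) : Set E := {y | ∀ x, inner ℝ x y ≤ p x}

variable {p : E → ℝ}

theorem IsPosSublinear.map_zero (hp : IsPosSublinear p) : p 0 = 0 := by
  have := hp.map_smul 2 two_pos 0
  rw [smul_zero] at this
  linarith

theorem IsPosSublinear.nonneg (hp : IsPosSublinear p) (x : E) : 0 ≤ p x := by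
  rcases eq_or_ne x 0 with rfl | h
  · exact hp.map_zero.ge
  · exact (hp.pos x h).le

theorem IsPosSublinear.continuous (hp : IsPosSublinear p) : Continuous p := by
  obtain ⟨C, hC⟩ := hp.bdd
  refine (LipschitzWith.of_le_add_mul (Real.toNNReal C) fun x y => ?_).continuous
  have h1 := hp.add_le y (x - y)
  rw [add_sub_cancel] at h1
  have h2 : C * ‖x - y‖ ≤ Real.toNNReal C * ‖x - y‖ := by
    gcongr
    exact Real.le_coe_toNNReal C
  rw [dist_eq_norm]
  linarith [hC (x - y)]

theorem IsPosSublinear.exists_le [FiniteDimensional ℝ E] (hp : IsPosSublinear p) :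
    ∃ c, 0 < c ∧ ∀ x, c * ‖x‖ ≤ p x := by
  rcases (Metric.sphere (0 : E) 1).eq_empty_or_nonempty with h | h
  · refine ⟨1, one_pos, fun x => ?_⟩
    rcases eq_or_ne x 0 with rfl | hx
    · simp [hp.map_zero]
    · have : ‖x‖⁻¹ • x ∈ Metric.sphere (0 : E) 1 := by
        simp [norm_smul, inv_mul_cancel₀ (norm_ne_zero_iff.2 hx)]
      simp [h] at this
  · obtain ⟨v, hv, hmin⟩ := (isCompact_sphere (0 : E) 1).exists_isMinOn h hp.continuous.continuousOn
    have hv0 : v ≠ 0 := by rintro rfl; simp at hv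
    refine ⟨p v, hp.pos v hv0, fun x => ?_⟩
    rcases eq_or_ne x 0 with rfl | hx
    · simp [hp.map_zero]
    · have hx' := norm_pos_iff.2 hx
      have h1 : p v ≤ p (‖x‖⁻¹ • x) := hmin (by
        simp [norm_smul, inv_mul_cancel₀ (norm_ne_zero_iff.2 hx)])
      rw [hp.map_smul _ (by positivity), inv_mul_eq_div, le_div_iff₀ hx'] at h1
      exact h1

/-- Hahn–Banach: the functional `c • x ↦ c * p x` on the line of `x` is dominated by `p` and
extends. The vector that represents the extension lies in the body and attains the bound. -/
theorem IsPosSublinear.exists_inner_eq [FiniteDimensional ℝ E] (hp : IsPosSublinear p) (x : E) :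
    ∃ y ∈ polarBody p, inner ℝ x y = p x := by
  rcases eq_or_ne x 0 with rfl | hx
  · refine ⟨0, fun x => ?_, by simp [hp.map_zero]⟩
    rw [inner_zero_right]
    exact hp.nonneg x
  obtain ⟨g, hg1, hg2⟩ := exists_extension_of_le_sublinear
    (LinearPMap.mkSpanSingleton (K := ℝ) x (p x) hx) p hp.map_smul hp.add_le (by
      rintro ⟨z, hz⟩
      obtain ⟨c, rfl⟩ := Submodule.mem_span_singleton.1 hz
      refine (LinearPMap.mkSpanSingleton'_apply (σ := RingHom.id ℝ) x (p x) _ c hz).le.trans ?_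
      change c * p x ≤ p (c • x)
      rcases lt_trichotomy c 0 with hc | rfl | hc
      · exact (mul_nonpos_of_nonpos_of_nonneg hc.le (hp.nonneg x)).trans (hp.nonneg _)
      · simp [hp.map_zero]
      · exact (hp.map_smul c hc x).ge)
  refine ⟨(InnerProductSpace.toDual ℝ E).symm g.toContinuousLinearMap, fun z => ?_, ?_⟩
  · rw [real_inner_comm, InnerProductSpace.toDual_symm_apply]
    exact hg2 z
  · rw [real_inner_comm, InnerProductSpace.toDual_symm_apply]
    have := hg1 ⟨x, Submodule.mem_span_singleton_self x⟩
    rw [LinearPMap.mkSpanSingleton_apply] at this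
    exact this

theorem convex_polarBody (p : E → ℝ) : Convex ℝ (polarBody p) := by
  intro y hy z hz a b ha hb hab x
  rw [inner_add_right, inner_smul_right, inner_smul_right]
  have h1 := mul_le_mul_of_nonneg_left (hy x) ha
  have h2 := mul_le_mul_of_nonneg_left (hz x) hb
  calc _ ≤ a * p x + b * p x := add_le_add h1 h2
    _ = p x := by rw [← add_mul, hab, one_mul]

theorem isClosed_polarBody (p : E → ℝ) : IsClosed (polarBody p) := by
  have : polarBody p = ⋂ x, {y | inner ℝ x y ≤ p x} := by ext; simp [polarBody]
  rw [this]
  exact isClosed_iInter fun x => isClosed_le (by fun_prop) continuous_const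

theorem IsPosSublinear.isCompact_polarBody [FiniteDimensional ℝ E] (hp : IsPosSublinear p) : IsCompact (polarBody p) := by
  obtain ⟨C, hC⟩ := hp.bdd
  refine Metric.isCompact_of_isClosed_isBounded (isClosed_polarBody p)
    ((Metric.isBounded_closedBall (x := (0 : E)) (r := |C|)).subset fun y hy => ?_)
  rw [mem_closedBall_zero_iff]
  have h1 := (hy y).trans (hC y)
  rw [real_inner_self_eq_norm_sq] at h1
  rcases (norm_nonneg y).eq_or_lt with h0 | h0
  · rw [← h0]
    exact abs_nonneg C
  · exact (by nlinarith : ‖y‖ ≤ C).trans (le_abs_self C)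

theorem IsPosSublinear.zero_mem_interior_polarBody [FiniteDimensional ℝ E] (hp : IsPosSublinear p) :
    (0 : E) ∈ interior (polarBody p) := by
  obtain ⟨c, hc, hcp⟩ := hp.exists_le
  refine mem_interior.2 ⟨Metric.ball 0 c, fun y hy x => ?_, Metric.isOpen_ball, by simpa⟩
  rw [mem_ball_zero_iff] at hy
  refine (real_inner_le_norm x y).trans (le_trans ?_ (hcp x))
  rw [mul_comm]
  gcongr

end Sublinear

/-! ### The centroid body is a convex body with the prescribed support function. -/

variable {n : ℕ} {φ ω : ℝ → ℝ} {K : Set (EuclideanSpace ℝ (Fin n))}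

theorem IsPosSublinear.isConvexBodyZero {p : EuclideanSpace ℝ (Fin n) → ℝ}
    (hp : IsPosSublinear p) : IsConvexBodyZero (polarBody p) :=
  ⟨convex_polarBody p, hp.isCompact_polarBody, hp.zero_mem_interior_polarBody⟩

theorem IsPosSublinear.supportFn_polarBody {p : EuclideanSpace ℝ (Fin n) → ℝ}
    (hp : IsPosSublinear p) (x : EuclideanSpace ℝ (Fin n)) : supportFn (polarBody p) x = p x := by
  obtain ⟨y, hy, hxy⟩ := hp.exists_inner_eq x
  refine IsGreatest.csSup_eq ⟨⟨y, hy, hxy⟩, ?_⟩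
  rintro _ ⟨z, hz, rfl⟩
  exact hz x

theorem IsConvexBodyZero.zero_mem (hK : IsConvexBodyZero K) : (0 : EuclideanSpace ℝ (Fin n)) ∈ K :=
  interior_subset hK.zero_mem_interior

theorem IsConvexBodyZero.volume_ne_zero (hK : IsConvexBodyZero K) : volume K ≠ 0 :=
  (Measure.measure_pos_of_nonempty_interior _ ⟨_, hK.zero_mem_interior⟩).ne'

theorem IsConvexBodyZero.volume_ne_top (hK : IsConvexBodyZero K) : volume K ≠ ⊤ :=
  hK.isCompact.measure_lt_top.ne

theorem IsConvexBodyZero.measurableSet (hK : IsConvexBodyZero K) : MeasurableSet K :=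
  hK.isCompact.isClosed.measurableSet

theorem IsConvexBodyZero.isProbabilityMeasure (hK : IsConvexBodyZero K) :
    IsProbabilityMeasure (ProbabilityTheory.cond volume K) :=
  ProbabilityTheory.cond_isProbabilityMeasure_of_finite hK.volume_ne_zero hK.volume_ne_top

theorem IsConvexBodyZero.exists_norm_le (hK : IsConvexBodyZero K) :
    ∃ R, 0 < R ∧ ∀ y ∈ K, ‖y‖ ≤ R := by
  obtain ⟨R, hR⟩ := hK.isCompact.isBounded.exists_norm_le
  exact ⟨max R 1, by positivity, fun y hy => (hR y hy).trans (le_max_left _ _)⟩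

theorem ae_cond_mem {s : Set (EuclideanSpace ℝ (Fin n))} (hs : MeasurableSet s) :
    ∀ᵐ y ∂(ProbabilityTheory.cond volume s), y ∈ s := by
  rw [ProbabilityTheory.cond]
  exact Measure.ae_smul_measure (ae_restrict_mem hs) _

theorem IsConvexBodyZero.bddMeas_inner (hK : IsConvexBodyZero K) (x : EuclideanSpace ℝ (Fin n)) :
    BddMeas (ProbabilityTheory.cond volume K) fun y => inner ℝ x y := by
  obtain ⟨R, hR, hKR⟩ := hK.exists_norm_le
  refine ⟨by fun_prop, ‖x‖ * R, by positivity, ?_⟩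
  filter_upwards [ae_cond_mem hK.measurableSet] with y hy
  refine (abs_real_inner_le_norm x y).trans ?_
  gcongr
  exact hKR y hy

theorem centroidNorm_smul (hK : IsConvexBodyZero K) {c : ℝ} (hc : 0 < c)
    (x : EuclideanSpace ℝ (Fin n)) : centroidNorm φ ω K (c • x) = c * centroidNorm φ ω K x := by
  rw [centroidNorm, centroidNorm, ← luxNorm_const_mul (hK.bddMeas_inner x) hc]
  simp only [inner_smul_left, RCLike.conj_to_real]

theorem centroidNorm_neg (x : EuclideanSpace ℝ (Fin n)) :
    centroidNorm φ ω K (-x) = centroidNorm φ ω K x := by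
  refine luxNorm_congr_distribution fun s => ?_
  simp only [distribution, inner_neg_left, abs_neg]

theorem centroidNorm_add_le (hφ : IsOrliczFunction φ) (hω : IsWeight ω) (hK : IsConvexBodyZero K)
    (x y : EuclideanSpace ℝ (Fin n)) :
    centroidNorm φ ω K (x + y) ≤ centroidNorm φ ω K x + centroidNorm φ ω K y := by
  have := hK.isProbabilityMeasure
  refine le_trans (le_of_eq ?_) (luxNorm_add_le hφ hω (hK.bddMeas_inner x) (hK.bddMeas_inner y))
  simp only [centroidNorm, inner_add_left]
  rfl

theorem centroidNorm_pos (hφ : IsOrliczFunction φ) (hω : IsWeight ω) (hK : IsConvexBodyZero K)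
    {x : EuclideanSpace ℝ (Fin n)} (hx : x ≠ 0) : 0 < centroidNorm φ ω K x := by
  have := hK.isProbabilityMeasure
  refine luxNorm_pos hφ hω (hK.bddMeas_inner x) ?_
  rw [ProbabilityTheory.cond_apply hK.measurableSet]
  refine mul_ne_zero (ENNReal.inv_ne_zero.2 hK.volume_ne_top) ?_
  have hopen : IsOpen (interior K ∩ {y | inner ℝ x y ≠ 0}) :=
    isOpen_interior.inter (isOpen_ne_fun (by fun_prop) continuous_const)
  refine (lt_of_lt_of_le (hopen.measure_pos volume ?_)
    (measure_mono (inter_subset_inter_left _ interior_subset))).ne'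
  have hc : Filter.Tendsto (fun t : ℝ => t • x) (nhdsWithin 0 (Ioi 0)) (nhds 0) := by
    have : Continuous fun t : ℝ => t • x := by fun_prop
    simpa using (this.tendsto 0).mono_left nhdsWithin_le_nhds
  obtain ⟨t, ht1, ht2⟩ := ((hc.eventually (isOpen_interior.mem_nhds hK.zero_mem_interior)).and
    self_mem_nhdsWithin).exists
  refine ⟨t • x, ht1, ?_⟩
  rw [mem_ofPred_eq, inner_smul_right, real_inner_self_eq_norm_sq]
  have : 0 < ‖x‖ := norm_pos_iff.2 hx
  have : (0 : ℝ) < t := ht2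
  positivity

theorem isPosSublinear_centroidNorm (hφ : IsOrliczFunction φ) (hω : IsWeight ω)
    (hK : IsConvexBodyZero K) : IsPosSublinear (centroidNorm φ ω K) := by
  refine ⟨fun c hc x => centroidNorm_smul hK hc x, centroidNorm_add_le hφ hω hK,
    fun x => centroidNorm_pos hφ hω hK, ?_⟩
  obtain ⟨R, hR, hKR⟩ := hK.exists_norm_le
  have h1 : BddMeas (ProbabilityTheory.cond volume K) fun _ => (1 : ℝ) :=
    ⟨measurable_const, 1, zero_le_one, by simp⟩
  refine ⟨R * luxNorm (ProbabilityTheory.cond volume K) φ ω fun _ => 1, fun x => ?_⟩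
  rcases eq_or_ne x 0 with rfl | hx
  · have := centroidNorm_smul (φ := φ) (ω := ω) hK two_pos 0
    rw [smul_zero] at this
    simp only [norm_zero, mul_zero]
    linarith
  have hx := norm_pos_iff.2 hx
  rw [mul_right_comm, ← luxNorm_const_mul h1 (by positivity)]
  refine luxNorm_mono hφ hω (hK.bddMeas_inner x) (h1.const_mul _) ?_
  filter_upwards [ae_cond_mem hK.measurableSet] with y hy
  rw [mul_one, abs_of_pos (show 0 < R * ‖x‖ by positivity), mul_comm]
  refine (abs_real_inner_le_norm x y).trans ?_
  gcongr
  exact hKR y hy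

theorem isConvexBodyZero_centroidBody (hφ : IsOrliczFunction φ) (hω : IsWeight ω)
    (hK : IsConvexBodyZero K) : IsConvexBodyZero (centroidBody φ ω K) :=
  (isPosSublinear_centroidNorm hφ hω hK).isConvexBodyZero

theorem supportFn_centroidBody (hφ : IsOrliczFunction φ) (hω : IsWeight ω)
    (hK : IsConvexBodyZero K) (x : EuclideanSpace ℝ (Fin n)) :
    supportFn (centroidBody φ ω K) x = centroidNorm φ ω K x :=
  (isPosSublinear_centroidNorm hφ hω hK).supportFn_polarBody x

end

/-! ### Shears, chords and Steiner symmetrization. -/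

section

variable {n : ℕ}

local notation "𝔼" n => EuclideanSpace ℝ (Fin n)

/-- Shears along `u` preserve volume. -/
theorem measurePreserving_shear {u : 𝔼 n} (hu : ‖u‖ = 1) {m : (𝔼 n) → ℝ} (hm : Measurable m)
    (hmu : ∀ y, ∀ t : ℝ, m (y + t • u) = m y) :
    MeasurePreserving (fun y => y + m y • u) volume volume := by
  have huu : inner ℝ u u = (1 : ℝ) := by rw [real_inner_self_eq_norm_sq, hu, one_pow]
  set k : ℝ → ENNReal := (Ioc (0 : ℝ) 1).indicator 1 with hk
  have hkm : Measurable k := measurable_one.indicator measurableSet_Ioc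
  have hk1 : ∀ a : ℝ, ∫⁻ t, k (a + t) = 1 := fun a => by
    rw [lintegral_add_left_eq_self k a, hk, lintegral_indicator_one measurableSet_Ioc]
    simp
  -- The weight `k` has integral one along every line parallel to `u`. Inserting it and exchanging
  -- integrals turns the integral into one over whole lines, on which the shift by `m` is absorbed
  -- by translation invariance; no coordinates adapted to `u` are needed.
  have key : ∀ (g : (𝔼 n) → ENNReal), Measurable g → ∀ m : (𝔼 n) → ℝ, Measurable m →
      (∀ y, ∀ t : ℝ, m (y + t • u) = m y) →
      ∫⁻ y, g (y + m y • u) = ∫⁻ y, k (inner ℝ u y) * ∫⁻ t : ℝ, g (y + t • u) := by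
    intro g hg m hm hmu
    calc ∫⁻ y, g (y + m y • u) = ∫⁻ y, ∫⁻ t : ℝ, g (y + m y • u) * k (inner ℝ u y + t) := by
          refine lintegral_congr fun y => ?_
          rw [lintegral_const_mul _ (by fun_prop), hk1, mul_one]
      _ = ∫⁻ t : ℝ, ∫⁻ y, g (y + m y • u) * k (inner ℝ u y + t) :=
          lintegral_lintegral_swap (by
            simp only [Function.uncurry_def]
            fun_prop)
      _ = ∫⁻ t : ℝ, ∫⁻ y, g (y + (m y - t) • u) * k (inner ℝ u y) := by
          refine lintegral_congr fun t => ?_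
          rw [← lintegral_add_right_eq_self _ ((-t) • u)]
          refine lintegral_congr fun y => ?_
          rw [hmu, inner_add_right, inner_smul_right, huu, mul_one, neg_add_cancel_right, sub_smul,
            neg_smul]
          congr 2
          abel
      _ = ∫⁻ y, ∫⁻ t : ℝ, g (y + (m y - t) • u) * k (inner ℝ u y) :=
          lintegral_lintegral_swap (by
            simp only [Function.uncurry_def]
            fun_prop)
      _ = ∫⁻ y, k (inner ℝ u y) * ∫⁻ t : ℝ, g (y + t • u) := by
          refine lintegral_congr fun y => ?_
          rw [lintegral_mul_const _ (by fun_prop), mul_comm,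
            lintegral_sub_left_eq_self (fun t : ℝ => g (y + t • u))]
  refine ⟨by fun_prop, Measure.ext fun s hs => ?_⟩
  rw [Measure.map_apply (by fun_prop) hs, ← lintegral_indicator_one hs,
    ← lintegral_indicator_one (hs.preimage (by fun_prop))]
  have hg : Measurable (s.indicator (1 : (𝔼 n) → ENNReal)) := measurable_one.indicator hs
  have h1 := key _ hg m hm hmu
  have h2 := key _ hg (fun _ => 0) measurable_const (fun _ _ => rfl)
  simp only [zero_smul, add_zero] at h2
  rw [h2, ← h1]
  rfl

/-- The orthogonal projection onto `u^⊥`, for a unit vector `u`. -/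
noncomputable def proj (u y : 𝔼 n) : 𝔼 n := y - (inner ℝ u y : ℝ) • u

theorem inner_self_of_norm_eq_one {u : 𝔼 n} (hu : ‖u‖ = 1) : inner ℝ u u = (1 : ℝ) := by
  rw [real_inner_self_eq_norm_sq, hu, one_pow]

theorem starProjection_orthogonal_span_singleton {u : 𝔼 n} (hu : ‖u‖ = 1) (y : 𝔼 n) :
    (ℝ ∙ u)ᗮ.starProjection y = proj u y := by
  rw [Submodule.starProjection_orthogonal_val, Submodule.starProjection_unit_singleton ℝ hu, proj]

theorem continuous_proj (u : 𝔼 n) : Continuous (proj u) := by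
  unfold proj
  fun_prop

theorem proj_add_smul {u : 𝔼 n} (hu : ‖u‖ = 1) (y : 𝔼 n) (t : ℝ) :
    proj u (y + t • u) = proj u y := by
  rw [proj, proj, inner_add_right, inner_smul_right, inner_self_of_norm_eq_one hu, mul_one,
    add_smul]
  abel

theorem proj_of_inner_eq_zero {u y : 𝔼 n} (h : inner ℝ u y = (0 : ℝ)) : proj u y = y := by
  rw [proj, h, zero_smul, sub_zero]

theorem inner_proj_self {u : 𝔼 n} (hu : ‖u‖ = 1) (y : 𝔼 n) : inner ℝ u (proj u y) = (0 : ℝ) := by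
  rw [proj, inner_sub_right, inner_smul_right, inner_self_of_norm_eq_one hu, mul_one, sub_self]

theorem proj_add_inner_smul (u y : 𝔼 n) : proj u y + (inner ℝ u y : ℝ) • u = y := by
  rw [proj, sub_add_cancel]

section Chords

variable {K : Set (𝔼 n)} {u : 𝔼 n}

theorem isCompact_chord_params (hK : IsCompact K) (hu : ‖u‖ = 1) (y : 𝔼 n) :
    IsCompact {t : ℝ | y + t • u ∈ K} := by
  have hcl : IsClosed {t : ℝ | y + t • u ∈ K} :=
    hK.isClosed.preimage (f := fun t : ℝ => y + t • u) (by fun_prop)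
  obtain ⟨R, hR⟩ := hK.isBounded.exists_norm_le
  refine Metric.isCompact_of_isClosed_isBounded hcl
    ((Metric.isBounded_closedBall (x := (0 : ℝ)) (r := R + ‖y‖)).subset fun t ht => ?_)
  rw [mem_closedBall_zero_iff]
  have h1 := hR _ ht
  have h2 : ‖t • u‖ ≤ ‖y + t • u‖ + ‖y‖ := by
    have := norm_sub_le (y + t • u) y
    rwa [add_sub_cancel_left] at this
  rw [norm_smul, hu, mul_one] at h2
  linarith

theorem le_overgraph (hK : IsCompact K) (hu : ‖u‖ = 1) {y : 𝔼 n} {t : ℝ} (h : y + t • u ∈ K) :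
    t ≤ overgraph K u y :=
  le_csSup (isCompact_chord_params hK hu y).bddAbove h

theorem neg_undergraph_le (hK : IsCompact K) (hu : ‖u‖ = 1) {y : 𝔼 n} {t : ℝ}
    (h : y + t • u ∈ K) : -undergraph K u y ≤ t := by
  rw [undergraph, neg_neg]
  exact csInf_le (isCompact_chord_params hK hu y).bddBelow h

theorem overgraph_mem (hK : IsCompact K) (hu : ‖u‖ = 1) {y : 𝔼 n} (h : ∃ t : ℝ, y + t • u ∈ K) :
    y + overgraph K u y • u ∈ K :=
  (isCompact_chord_params hK hu y).sSup_mem h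

theorem undergraph_mem (hK : IsCompact K) (hu : ‖u‖ = 1) {y : 𝔼 n} (h : ∃ t : ℝ, y + t • u ∈ K) :
    y + (-undergraph K u y) • u ∈ K := by
  rw [undergraph, neg_neg]
  exact (isCompact_chord_params hK hu y).sInf_mem h

theorem add_smul_mem_iff (hK : IsCompact K) (hc : Convex ℝ K) (hu : ‖u‖ = 1) {y : 𝔼 n}
    (h : ∃ t : ℝ, y + t • u ∈ K) {t : ℝ} :
    y + t • u ∈ K ↔ -undergraph K u y ≤ t ∧ t ≤ overgraph K u y := by
  refine ⟨fun ht => ⟨neg_undergraph_le hK hu ht, le_overgraph hK hu ht⟩, fun ht => ?_⟩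
  have hconv : Convex ℝ {t : ℝ | y + t • u ∈ K} := by
    intro a ha b hb p q hp hq hpq
    have := hc ha hb hp hq hpq
    rw [mem_ofPred_eq]
    convert this using 1
    rw [smul_add, smul_add, add_smul, smul_smul, smul_smul, smul_eq_mul, smul_eq_mul,
      add_add_add_comm, ← add_smul p q y, hpq, one_smul]
  exact hconv.ordConnected.out (undergraph_mem hK hu h) (overgraph_mem hK hu h) ht

/-- Transfers every fact about upper ends of chords to lower ends on replacing `u` by `-u`. -/
theorem undergraph_eq_overgraph_neg (K : Set (𝔼 n)) (u y : 𝔼 n) :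
    undergraph K u y = overgraph K (-u) y := by
  rw [undergraph, overgraph, Real.sInf_def, neg_neg]
  congr 1
  ext t
  simp

theorem mem_shadow_iff (hu : ‖u‖ = 1) {y : 𝔼 n} :
    y ∈ shadow K u ↔ inner ℝ u y = (0 : ℝ) ∧ ∃ t : ℝ, y + t • u ∈ K := by
  simp only [shadow, starProjection_orthogonal_span_singleton hu]
  constructor
  · rintro ⟨z, hz, rfl⟩
    exact ⟨inner_proj_self hu z, inner ℝ u z, by rwa [proj_add_inner_smul]⟩
  · rintro ⟨h0, t, ht⟩
    exact ⟨_, ht, (proj_add_smul hu y t).trans (proj_of_inner_eq_zero h0)⟩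

/-- The signed distance by which the chord of `K` through `y` is moved by Steiner symmetrization,
with the opposite sign. -/
noncomputable def midShift (K : Set (𝔼 n)) (u y : 𝔼 n) : ℝ :=
  (overgraph K u (proj u y) - undergraph K u (proj u y)) / 2

theorem midShift_add_smul (hu : ‖u‖ = 1) (y : 𝔼 n) (t : ℝ) :
    midShift K u (y + t • u) = midShift K u y := by
  rw [midShift, proj_add_smul hu, midShift]

/-- The symmetral is obtained by sliding each chord so that its midpoint lies on `u^⊥`; undoing the
slide gives membership in `K`. In this form symmetrization is the preimage under a measure
preserving map. -/
theorem mem_steiner_iff (hK : IsCompact K) (hc : Convex ℝ K) (hu : ‖u‖ = 1) {y : 𝔼 n} :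
    y ∈ steiner u K ↔ y + midShift K u y • u ∈ K := by
  constructor
  · rintro ⟨z, hz, t, ht, rfl⟩
    rw [mem_shadow_iff hu] at hz
    rw [midShift_add_smul hu, midShift, proj_of_inner_eq_zero hz.1, add_assoc, ← add_smul,
      add_smul_mem_iff hK hc hu hz.2]
    rw [halfLength, abs_le] at ht
    constructor <;> linarith
  · intro h
    have h' : proj u y + ((inner ℝ u y : ℝ) + midShift K u y) • u ∈ K := by
      rwa [add_smul, ← add_assoc, proj_add_inner_smul]
    refine ⟨proj u y, (mem_shadow_iff hu).2 ⟨inner_proj_self hu y, _, h'⟩, inner ℝ u y, ?_,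
      (proj_add_inner_smul u y).symm⟩
    rw [add_smul_mem_iff hK hc hu ⟨_, h'⟩, midShift] at h'
    rw [halfLength, abs_le]
    constructor <;> linarith

theorem measurable_overgraph_proj (hK : IsCompact K) (hu : ‖u‖ = 1) :
    Measurable fun y => overgraph K u (proj u y) := by
  refine measurable_of_Ici fun c => ?_
  have hP := (continuous_proj u)
  have hiff : ∀ (S : Set (𝔼 n)) (y : 𝔼 n), y ∈ proj u ⁻¹' (proj u '' S) ↔
      ∃ t : ℝ, proj u y + t • u ∈ S := by
    intro S y
    constructor
    · rintro ⟨z, hz, hzy⟩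
      exact ⟨inner ℝ u z, by rwa [← hzy, proj_add_inner_smul]⟩
    · rintro ⟨t, ht⟩
      exact ⟨_, ht, by rw [proj_add_smul hu, proj_of_inner_eq_zero (inner_proj_self hu y)]⟩
  -- The first piece is a cylinder over the projection of a compact set. The second accounts for
  -- lines missing `K`, where the supremum of the empty set is `0` by convention.
  have h : (fun y => overgraph K u (proj u y)) ⁻¹' Ici c =
      proj u ⁻¹' (proj u '' (K ∩ {z | c ≤ inner ℝ u z})) ∪
        ((proj u ⁻¹' (proj u '' K))ᶜ ∩ {_y | c ≤ 0}) := by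
    ext y
    rw [mem_union, mem_inter_iff, mem_compl_iff, hiff, hiff, mem_preimage, mem_Ici]
    have hin : ∀ t : ℝ, inner ℝ u (proj u y + t • u) = t := fun t => by
      rw [inner_add_right, inner_proj_self hu, inner_smul_right, inner_self_of_norm_eq_one hu,
        mul_one, zero_add]
    by_cases hy : ∃ t : ℝ, proj u y + t • u ∈ K
    · constructor
      · intro h
        exact Or.inl ⟨_, overgraph_mem hK hu hy, by rwa [mem_ofPred_eq, hin]⟩
      · rintro (⟨t, ht, htc⟩ | ⟨h, -⟩)
        · rw [mem_ofPred_eq, hin] at htc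
          exact htc.trans (le_overgraph hK hu ht)
        · exact absurd hy h
    · have h0 : overgraph K u (proj u y) = 0 := by
        have : {t : ℝ | proj u y + t • u ∈ K} = ∅ := by
          ext t
          simpa using fun ht => hy ⟨t, ht⟩
        rw [overgraph, this, Real.sSup_empty]
      rw [h0]
      constructor
      · exact fun h => Or.inr ⟨hy, h⟩
      · rintro (⟨t, ht, -⟩ | ⟨-, h⟩)
        · exact absurd ⟨t, ht⟩ hy
        · exact h
  rw [h]
  have hcl : IsClosed {z : 𝔼 n | c ≤ inner ℝ u z} := isClosed_le continuous_const (by fun_prop)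
  exact (((hK.inter_right hcl).image hP).isClosed.preimage hP).measurableSet.union
    (((hK.image hP).isClosed.preimage hP).measurableSet.compl.inter (by simp))

theorem measurable_midShift (hK : IsCompact K) (hu : ‖u‖ = 1) : Measurable (midShift K u) := by
  have h1 := measurable_overgraph_proj hK hu
  have h2 := measurable_overgraph_proj hK (u := -u) (by rwa [norm_neg])
  have h3 : ∀ y, proj (-u) y = proj u y := fun y => by simp [proj]
  simp only [h3] at h2
  unfold midShift
  simp only [undergraph_eq_overgraph_neg]
  exact (h1.sub h2).div_const 2

/-- The volume preserving map which takes the Steiner symmetral of `K` to `K`. -/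
noncomputable def shear (K : Set (𝔼 n)) (u y : 𝔼 n) : 𝔼 n := y + midShift K u y • u

theorem measurePreserving_shear_midShift (hK : IsCompact K) (hu : ‖u‖ = 1) :
    MeasurePreserving (shear K u) volume volume :=
  measurePreserving_shear hu (measurable_midShift hK hu) (midShift_add_smul hu)

theorem steiner_eq_preimage (hK : IsCompact K) (hc : Convex ℝ K) (hu : ‖u‖ = 1) :
    steiner u K = shear K u ⁻¹' K := by
  ext y
  exact mem_steiner_iff hK hc hu

/-- The reflection in `u^⊥`, for a unit vector `u`. -/
noncomputable def refl (u y : 𝔼 n) : 𝔼 n := y - (2 * (inner ℝ u y : ℝ)) • u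

theorem refl_eq_reflection (hu : ‖u‖ = 1) : refl u = (ℝ ∙ u)ᗮ.reflection := by
  ext1 y
  rw [Submodule.reflection_orthogonal_apply, Submodule.reflection_apply,
    Submodule.starProjection_unit_singleton ℝ hu, refl, neg_sub, mul_smul, two_smul, two_smul]

theorem measurePreserving_refl (hu : ‖u‖ = 1) : MeasurePreserving (refl u) volume volume := by
  rw [refl_eq_reflection hu]
  exact LinearIsometryEquiv.measurePreserving _

theorem refl_eq_add_smul (u y : 𝔼 n) : refl u y = y + (-(2 * (inner ℝ u y : ℝ))) • u := by
  rw [refl, neg_smul, sub_eq_add_neg]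

theorem refl_preimage_steiner (hu : ‖u‖ = 1) :
    refl u ⁻¹' steiner u K = steiner u K := by
  have h : ∀ y, y ∈ steiner u K → refl u y ∈ steiner u K := by
    rintro _ ⟨y, hy, t, ht, rfl⟩
    refine ⟨y, hy, -t, by rwa [abs_neg], ?_⟩
    rw [refl, inner_add_right, ((mem_shadow_iff hu).1 hy).1, inner_smul_right,
      inner_self_of_norm_eq_one hu, add_sub_assoc, ← sub_smul]
    congr 2
    ring
  have h2 : ∀ y, refl u (refl u y) = y := fun y => by
    rw [refl_eq_reflection hu, Submodule.reflection_reflection]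
  ext y
  exact ⟨fun hy => by rw [← h2 y]; exact h _ hy, h y⟩

end Chords

end

/-! ### The symmetrization inclusion. -/

section

section MeasurePreserving

variable {Ω Ω' : Type*} [MeasurableSpace Ω] [MeasurableSpace Ω'] {μ : Measure Ω} {ν : Measure Ω'}
  {T : Ω' → Ω} {f : Ω → ℝ} {φ ω : ℝ → ℝ}

theorem BddMeas.comp_measurePreserving (hf : BddMeas μ f) (hT : MeasurePreserving T ν μ) :
    BddMeas ν (f ∘ T) := by
  obtain ⟨M, hM, h⟩ := hf.bdd
  exact ⟨hf.measurable.comp hT.measurable, M, hM, hT.quasiMeasurePreserving.ae h⟩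

theorem luxNorm_comp_measurePreserving (hf : BddMeas μ f) (hT : MeasurePreserving T ν μ) :
    luxNorm ν φ ω (f ∘ T) = luxNorm μ φ ω f :=
  luxNorm_congr_distribution fun _ => hT.measure_preimage
    (measurableSet_lt measurable_const hf.abs.measurable).nullMeasurableSet

end MeasurePreserving

variable {n : ℕ}

local notation "𝔼" n => EuclideanSpace ℝ (Fin n)

theorem measurePreserving_cond_preimage {T : (𝔼 n) → 𝔼 n} (hT : MeasurePreserving T volume volume)
    {s : Set (𝔼 n)} (hs : MeasurableSet s) :
    MeasurePreserving T (ProbabilityTheory.cond volume (T ⁻¹' s))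
      (ProbabilityTheory.cond volume s) := by
  rw [ProbabilityTheory.cond, ProbabilityTheory.cond, hT.measure_preimage hs.nullMeasurableSet]
  exact (hT.restrict_preimage hs).smul_measure _

variable {φ ω : ℝ → ℝ} {K : Set (𝔼 n)} {u : 𝔼 n}

theorem IsConvexBodyZero.measurableSet_steiner (hK : IsConvexBodyZero K) (hu : ‖u‖ = 1) :
    MeasurableSet (steiner u K) := by
  rw [steiner_eq_preimage hK.isCompact hK.convex hu]
  exact hK.measurableSet.preimage (measurePreserving_shear_midShift hK.isCompact hu).measurable

theorem IsConvexBodyZero.isProbabilityMeasure_steiner (hK : IsConvexBodyZero K) (hu : ‖u‖ = 1) :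
    IsProbabilityMeasure (ProbabilityTheory.cond volume (steiner u K)) := by
  have hv : volume (steiner u K) = volume K := by
    rw [steiner_eq_preimage hK.isCompact hK.convex hu]
    exact (measurePreserving_shear_midShift hK.isCompact hu).measure_preimage
      hK.measurableSet.nullMeasurableSet
  exact ProbabilityTheory.cond_isProbabilityMeasure_of_finite (by rw [hv]; exact hK.volume_ne_zero)
    (by rw [hv]; exact hK.volume_ne_top)

theorem measurePreserving_shear_cond (hK : IsConvexBodyZero K) (hu : ‖u‖ = 1) :
    MeasurePreserving (shear K u) (ProbabilityTheory.cond volume (steiner u K))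
      (ProbabilityTheory.cond volume K) := by
  rw [steiner_eq_preimage hK.isCompact hK.convex hu]
  exact measurePreserving_cond_preimage (measurePreserving_shear_midShift hK.isCompact hu)
    hK.measurableSet

theorem measurePreserving_refl_cond (hK : IsConvexBodyZero K) (hu : ‖u‖ = 1) :
    MeasurePreserving (refl u) (ProbabilityTheory.cond volume (steiner u K))
      (ProbabilityTheory.cond volume (steiner u K)) := by
  have := measurePreserving_cond_preimage (measurePreserving_refl hu)
    (hK.measurableSet_steiner hu)
  rwa [refl_preimage_steiner hu] at this

theorem inner_refl (u x y : 𝔼 n) : inner ℝ (refl u x) y = inner ℝ x (refl u y) := by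
  rw [refl, refl, inner_sub_left, inner_sub_right, inner_smul_left, inner_smul_right,
    real_inner_comm u x]
  simp only [RCLike.conj_to_real]
  ring

theorem inner_shear (K : Set (𝔼 n)) (u x y : 𝔼 n) :
    inner ℝ x (shear K u y) = inner ℝ x y + midShift K u y * inner ℝ u x := by
  rw [shear, inner_add_right, inner_smul_right, real_inner_comm x u]

theorem shear_refl (hu : ‖u‖ = 1) (y : 𝔼 n) :
    shear K u (refl u y) = refl u y + midShift K u y • u := by
  rw [shear, refl_eq_add_smul, midShift_add_smul hu]

/-- The reflected point lies on the same line, so both shears move by the same midpoint shift; the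
`u`-components `1` and `-1` make the two contributions cancel. -/
theorem inner_half_add_refl (hu : ‖u‖ = 1) {x₁ x₂ : 𝔼 n} (h₁ : inner ℝ u x₁ = (1 : ℝ))
    (h₂ : inner ℝ u x₂ = (-1 : ℝ)) (y : 𝔼 n) :
    inner ℝ ((1 / 2 : ℝ) • (x₁ + refl u x₂)) y =
      1 / 2 * (inner ℝ x₁ (shear K u y) : ℝ) + 1 / 2 * inner ℝ x₂ (shear K u (refl u y)) := by
  rw [shear_refl hu, inner_shear, inner_add_right, inner_smul_right, real_inner_comm u x₂, h₂, h₁,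
    inner_smul_left, inner_add_left, inner_refl]
  simp only [RCLike.conj_to_real]
  ring

/-- The functional of the symmetral is at most the mean of values of that of the body. -/
theorem centroidNorm_steiner_half_le (hφ : IsOrliczFunction φ) (hω : IsWeight ω)
    (hK : IsConvexBodyZero K) (hu : ‖u‖ = 1) {x₁ x₂ : 𝔼 n} (h₁ : inner ℝ u x₁ = (1 : ℝ))
    (h₂ : inner ℝ u x₂ = (-1 : ℝ)) :
    centroidNorm φ ω (steiner u K) ((1 / 2 : ℝ) • (x₁ + refl u x₂)) ≤
      1 / 2 * centroidNorm φ ω K x₁ + 1 / 2 * centroidNorm φ ω K x₂ := by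
  have := hK.isProbabilityMeasure_steiner hu
  have hT := measurePreserving_shear_cond hK hu
  have hR := measurePreserving_refl_cond hK hu
  have b₁ := (hK.bddMeas_inner x₁).comp_measurePreserving hT
  have b₂ := (hK.bddMeas_inner x₂).comp_measurePreserving hT
  have b₃ := b₂.comp_measurePreserving hR
  have e : (fun y => (inner ℝ ((1 / 2 : ℝ) • (x₁ + refl u x₂)) y : ℝ)) =
      (fun y => 1 / 2 * ((fun y => (inner ℝ x₁ y : ℝ)) ∘ shear K u) y) +
        fun y => 1 / 2 * (((fun y => (inner ℝ x₂ y : ℝ)) ∘ shear K u) ∘ refl u) y := by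
    funext y
    exact inner_half_add_refl hu h₁ h₂ y
  rw [centroidNorm, e]
  refine (luxNorm_add_le hφ hω (b₁.const_mul _) (b₃.const_mul _)).trans (le_of_eq ?_)
  rw [luxNorm_const_mul b₁ (by norm_num), luxNorm_const_mul b₃ (by norm_num),
    luxNorm_comp_measurePreserving b₂ hR, luxNorm_comp_measurePreserving (hK.bddMeas_inner x₁) hT,
    luxNorm_comp_measurePreserving (hK.bddMeas_inner x₂) hT]
  rfl

theorem luxNorm_abs {Ω : Type*} [MeasurableSpace Ω] (μ : Measure Ω) (f : Ω → ℝ) :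
    luxNorm μ φ ω (fun x => |f x|) = luxNorm μ φ ω f :=
  luxNorm_congr_distribution fun s => by simp only [distribution, abs_abs]

/-- The preceding inequality is strict if the two functions have opposite signs somewhere. -/
theorem centroidNorm_steiner_half_lt (hφ : IsOrliczFunction φ) (hω : IsWeight ω)
    (hK : IsConvexBodyZero K) (hu : ‖u‖ = 1) {x₁ x₂ : 𝔼 n} (h₁ : inner ℝ u x₁ = (1 : ℝ))
    (h₂ : inner ℝ u x₂ = (-1 : ℝ))
    (h : ProbabilityTheory.cond volume (steiner u K)
      {y | (inner ℝ x₁ (shear K u y) : ℝ) * inner ℝ x₂ (shear K u (refl u y)) < 0} ≠ 0) :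
    centroidNorm φ ω (steiner u K) ((1 / 2 : ℝ) • (x₁ + refl u x₂)) <
      1 / 2 * centroidNorm φ ω K x₁ + 1 / 2 * centroidNorm φ ω K x₂ := by
  have := hK.isProbabilityMeasure_steiner hu
  have hT := measurePreserving_shear_cond hK hu
  have hR := measurePreserving_refl_cond hK hu
  have b₁ := (hK.bddMeas_inner x₁).comp_measurePreserving hT
  have b₂ := (hK.bddMeas_inner x₂).comp_measurePreserving hT
  have b₃ := b₂.comp_measurePreserving hR
  set f := (fun y => (inner ℝ x₁ y : ℝ)) ∘ shear K u with hf
  set g := ((fun y => (inner ℝ x₂ y : ℝ)) ∘ shear K u) ∘ refl u with hg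
  have e : (fun y => (inner ℝ ((1 / 2 : ℝ) • (x₁ + refl u x₂)) y : ℝ)) =
      (fun y => 1 / 2 * f y) + fun y => 1 / 2 * g y := by
    funext y
    exact inner_half_add_refl hu h₁ h₂ y
  have n₁ : luxNorm (ProbabilityTheory.cond volume (steiner u K)) φ ω (fun y => 1 / 2 * |f y|) =
      1 / 2 * centroidNorm φ ω K x₁ := by
    rw [luxNorm_const_mul b₁.abs (by norm_num), luxNorm_abs,
      luxNorm_comp_measurePreserving (hK.bddMeas_inner x₁) hT, centroidNorm]
  have n₂ : luxNorm (ProbabilityTheory.cond volume (steiner u K)) φ ω (fun y => 1 / 2 * |g y|) =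
      1 / 2 * centroidNorm φ ω K x₂ := by
    rw [luxNorm_const_mul b₃.abs (by norm_num), luxNorm_abs, luxNorm_comp_measurePreserving b₂ hR,
      luxNorm_comp_measurePreserving (hK.bddMeas_inner x₂) hT, centroidNorm]
  -- Comparing with `(|f| + |g|) / 2` instead of `(f + g) / 2` leaves the upper bound unchanged, and
  -- the comparison is strict wherever `f` and `g` have opposite signs.
  have c₁ := b₁.abs.const_mul (1 / 2)
  have c₂ := b₃.abs.const_mul (1 / 2)
  have habs : ∀ y, |((fun y => 1 / 2 * |f y|) + fun y => 1 / 2 * |g y|) y| =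
      1 / 2 * |f y| + 1 / 2 * |g y| := fun y => abs_of_nonneg (by simp only [Pi.add_apply]; positivity)
  rw [← n₁, ← n₂, centroidNorm, e]
  refine lt_of_lt_of_le (luxNorm_lt_luxNorm hφ hω ((b₁.const_mul _).add (b₃.const_mul _))
    (c₁.add c₂) (.of_forall fun y => ?_) (fun h0 => h (measure_mono_null (fun y hy => ?_) h0)) ?_)
    (luxNorm_add_le hφ hω c₁ c₂)
  · rw [habs]
    refine (abs_add_le _ _).trans (le_of_eq ?_)
    rw [abs_mul, abs_mul, abs_of_pos (by norm_num : (0 : ℝ) < 1 / 2)]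
  · have hy' : f y * g y < 0 := hy
    rw [mem_ofPred_eq, habs, Pi.add_apply, ← mul_add, ← mul_add, abs_mul,
      abs_of_pos (by norm_num : (0 : ℝ) < 1 / 2)]
    refine mul_lt_mul_of_pos_left ?_ (by norm_num)
    refine lt_of_le_of_ne (abs_add_le _ _) fun h2 => ?_
    rcases (abs_add_eq_add_abs_iff _ _).1 h2 with h3 | h3
    · exact absurd (mul_nonneg h3.1 h3.2) (not_le.2 hy')
    · exact absurd (mul_nonneg_of_nonpos_of_nonpos h3.1 h3.2) (not_le.2 hy')
  · have hx : x₁ ≠ 0 := by rintro rfl; simp at h₁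
    refine lt_of_lt_of_le (mul_pos (by norm_num : (0 : ℝ) < 1 / 2)
      (centroidNorm_pos hφ hω hK hx)) ?_
    rw [← n₁]
    refine luxNorm_mono hφ hω c₁ (c₁.add c₂) (.of_forall fun y => ?_)
    rw [habs, abs_of_nonneg (by positivity)]
    linarith [abs_nonneg (g y)]

theorem centroidNorm_steiner_of_inner_eq_zero (hK : IsConvexBodyZero K) (hu : ‖u‖ = 1) {x : 𝔼 n}
    (hx : inner ℝ u x = (0 : ℝ)) :
    centroidNorm φ ω (steiner u K) x = centroidNorm φ ω K x := by
  rw [centroidNorm, centroidNorm, ← luxNorm_comp_measurePreserving (hK.bddMeas_inner x)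
    (measurePreserving_shear_cond hK hu)]
  congr 1
  funext y
  rw [Function.comp_apply, inner_shear, hx, mul_zero, add_zero]

theorem centroidNorm_steiner_refl (hK : IsConvexBodyZero K) (hu : ‖u‖ = 1) (x : 𝔼 n) :
    centroidNorm φ ω (steiner u K) (refl u x) = centroidNorm φ ω (steiner u K) x := by
  refine luxNorm_congr_distribution fun s => ?_
  simp only [distribution, inner_refl]
  exact (measurePreserving_refl_cond hK hu).measure_preimage (s := {y | s < |inner ℝ x y|})
    (measurableSet_lt measurable_const (by fun_prop)).nullMeasurableSet

theorem refl_add_smul (hu : ‖u‖ = 1) {z : 𝔼 n} (hz : inner ℝ u z = (0 : ℝ)) (t : ℝ) :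
    refl u (z + t • u) = z + (-t) • u := by
  rw [refl, inner_add_right, hz, inner_smul_right, inner_self_of_norm_eq_one hu, add_sub_assoc,
    ← sub_smul]
  congr 2
  ring

theorem inner_half_add_refl_add_smul (hu : ‖u‖ = 1) {x₁ x₂ z : 𝔼 n} (h₁ : inner ℝ u x₁ = (1 : ℝ))
    (h₂ : inner ℝ u x₂ = (-1 : ℝ)) (hz : inner ℝ u z = (0 : ℝ)) (t : ℝ) :
    inner ℝ ((1 / 2 : ℝ) • (x₁ + refl u x₂)) (z + t • u) =
      1 / 2 * ((inner ℝ x₁ z : ℝ) + inner ℝ x₂ z) + t := by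
  rw [inner_smul_left, inner_add_left, inner_refl, refl_add_smul hu hz, inner_add_right,
    inner_add_right, inner_smul_right, inner_smul_right, real_inner_comm u x₁,
    real_inner_comm u x₂, h₁, h₂, RCLike.conj_to_real]
  ring

/-- By homogeneity the half-spaces need testing only on the slices where the `u`-component of `x` is
`0`, `1` or `-1`. These are respectively a condition on `y`, the upper bounds for `t` and the lower
bounds for `t`. -/
theorem add_smul_mem_polarBody {p : (𝔼 n) → ℝ} (hp : ∀ c : ℝ, 0 < c → ∀ x, p (c • x) = c * p x)
    {y : 𝔼 n} {t : ℝ} (h0 : ∀ x, inner ℝ u x = (0 : ℝ) → inner ℝ x y ≤ p x)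
    (h1 : ∀ x, inner ℝ u x = (1 : ℝ) → t ≤ p x - inner ℝ x y)
    (h2 : ∀ x, inner ℝ u x = (-1 : ℝ) → -t ≤ p x - inner ℝ x y) :
    y + t • u ∈ polarBody p := by
  intro x
  rw [inner_add_right, inner_smul_right, real_inner_comm u x]
  rcases lt_trichotomy (inner ℝ u x : ℝ) 0 with hc | hc | hc
  · have hc' : 0 < -(inner ℝ u x : ℝ) := neg_pos.2 hc
    have := h2 ((-(inner ℝ u x : ℝ))⁻¹ • x) (by
      rw [inner_smul_right, inv_neg, neg_mul, inv_mul_cancel₀ hc.ne])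
    rw [hp _ (inv_pos.2 hc'), inner_smul_left, RCLike.conj_to_real, ← mul_sub, inv_mul_eq_div,
      le_div_iff₀ hc'] at this
    linarith
  · rw [hc, mul_zero, add_zero]
    exact h0 x hc
  · have := h1 ((inner ℝ u x : ℝ)⁻¹ • x) (by rw [inner_smul_right, inv_mul_cancel₀ hc.ne'])
    rw [hp _ (inv_pos.2 hc), inner_smul_left, RCLike.conj_to_real, ← mul_sub, inv_mul_eq_div,
      le_div_iff₀ hc] at this
    linarith

/-- Steiner symmetrization and the Orlicz-Lorentz centroid body. -/
theorem centroidBody_steiner_subset (hφ : IsOrliczFunction φ) (hω : IsWeight ω)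
    (hK : IsConvexBodyZero K) (hu : ‖u‖ = 1) :
    centroidBody φ ω (steiner u K) ⊆ steiner u (centroidBody φ ω K) := by
  intro y hy
  set p := centroidNorm φ ω K with hp
  set z := proj u y with hz
  set s : ℝ := inner ℝ u y with hs
  have hyz : y = z + s • u := (proj_add_inner_smul u y).symm
  have hsm : ∀ c : ℝ, 0 < c → ∀ x, p (c • x) = c * p x := fun c hc x => centroidNorm_smul hK hc x
  have h0 : ∀ x, inner ℝ u x = (0 : ℝ) → inner ℝ x z ≤ p x := by
    intro x hx
    have := hy x
    rw [centroidNorm_steiner_of_inner_eq_zero hK hu hx, hyz, inner_add_right, inner_smul_right,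
      real_inner_comm u x, hx, mul_zero, add_zero] at this
    exact this
  -- The norm over the symmetral is invariant under reflection, so the support inequality holds for
  -- `y` and for its mirror image, that is, for `s` and `-s`.
  have key : ∀ x₁ x₂, inner ℝ u x₁ = (1 : ℝ) → inner ℝ u x₂ = (-1 : ℝ) →
      2 * |s| ≤ (p x₁ - inner ℝ x₁ z) + (p x₂ - inner ℝ x₂ z) := by
    intro x₁ x₂ h₁ h₂
    have h3 := centroidNorm_steiner_half_le hφ hω hK hu h₁ h₂
    have hzu : inner ℝ u z = (0 : ℝ) := inner_proj_self hu y
    have hrz := refl_add_smul hu hzu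
    have h4 := inner_half_add_refl_add_smul hu h₁ h₂ hzu
    have h5 := hy ((1 / 2 : ℝ) • (x₁ + refl u x₂))
    have h6 := hy (refl u ((1 / 2 : ℝ) • (x₁ + refl u x₂)))
    rw [hyz, h4] at h5
    rw [centroidNorm_steiner_refl hK hu, inner_refl, hyz, hrz, h4] at h6
    rcases abs_cases s with ⟨h7, -⟩ | ⟨h7, -⟩ <;> rw [h7] <;> linarith
  have huu := inner_self_of_norm_eq_one hu
  have hun : inner ℝ u (-u) = (-1 : ℝ) := by rw [inner_neg_right, huu]
  -- `sInf A` and `-sInf B` are parameters of points of the line `z + ℝ u` that lie in the centroid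
  -- body. Their difference is at least `2 * |s|`, so the chord through `z` is long enough.
  set A : Set ℝ := (fun x => p x - inner ℝ x z) '' {x | inner ℝ u x = (1 : ℝ)}
  set B : Set ℝ := (fun x => p x - inner ℝ x z) '' {x | inner ℝ u x = (-1 : ℝ)}
  have hA : A.Nonempty := ⟨_, u, huu, rfl⟩
  have hB : B.Nonempty := ⟨_, -u, hun, rfl⟩
  have hAb : BddBelow A := by
    refine ⟨2 * |s| - (p (-u) - inner ℝ (-u) z), ?_⟩
    rintro _ ⟨x, hx, rfl⟩
    have := key x (-u) hx hun
    simp only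
    linarith
  have hBb : BddBelow B := by
    refine ⟨2 * |s| - (p u - inner ℝ u z), ?_⟩
    rintro _ ⟨x, hx, rfl⟩
    have := key u x huu hx
    simp only
    linarith
  have hab : 2 * |s| ≤ sInf A + sInf B := by
    have : ∀ a ∈ A, 2 * |s| - a ≤ sInf B := by
      rintro _ ⟨x, hx, rfl⟩
      refine le_csInf hB ?_
      rintro _ ⟨x', hx', rfl⟩
      have := key x x' hx hx'
      simp only
      linarith
    have : 2 * |s| - sInf B ≤ sInf A := le_csInf hA fun a ha => by linarith [this a ha]
    linarith
  have hA1 : ∀ x, inner ℝ u x = (1 : ℝ) → sInf A ≤ p x - inner ℝ x z :=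
    fun x hx => csInf_le hAb ⟨x, hx, rfl⟩
  have hB1 : ∀ x, inner ℝ u x = (-1 : ℝ) → sInf B ≤ p x - inner ℝ x z :=
    fun x hx => csInf_le hBb ⟨x, hx, rfl⟩
  have habs := abs_nonneg s
  have m1 : z + sInf A • u ∈ centroidBody φ ω K := add_smul_mem_polarBody hsm h0 hA1
    fun x hx => by linarith [hB1 x hx]
  have m2 : z + (-sInf B) • u ∈ centroidBody φ ω K := add_smul_mem_polarBody hsm h0
    (fun x hx => by linarith [hA1 x hx]) fun x hx => by linarith [hB1 x hx]
  have hc := (isConvexBodyZero_centroidBody hφ hω hK).isCompact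
  refine ⟨z, (mem_shadow_iff hu).2 ⟨inner_proj_self hu y, _, m1⟩, s, ?_, hyz⟩
  have g1 := le_overgraph hc hu m1
  have g2 := neg_undergraph_le hc hu m2
  rw [halfLength]
  linarith

end

/-! ### Equality along one direction: midpoints from normals. -/

section

variable {n : ℕ}

local notation "𝔼" n => EuclideanSpace ℝ (Fin n)

variable {φ ω : ℝ → ℝ} {K : Set (𝔼 n)} {u : 𝔼 n}

/-- Concavity on this open set yields continuity there, which is needed to pass from almost
everywhere to everywhere. -/
theorem concaveOn_overgraph_proj (hK : IsConvexBodyZero K) (hu : ‖u‖ = 1) :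
    ConcaveOn ℝ {y | ∃ t : ℝ, y + t • u ∈ interior K} fun y => overgraph K u (proj u y) := by
  have hproj : ∀ y, (∃ t : ℝ, y + t • u ∈ interior K) → ∃ t : ℝ, proj u y + t • u ∈ K := by
    rintro y ⟨t, ht⟩
    refine ⟨inner ℝ u y + t, ?_⟩
    rw [add_smul, ← add_assoc, proj_add_inner_smul]
    exact interior_subset ht
  have hcomb : ∀ (y z : 𝔼 n) (a b s t : ℝ),
      a • (y + s • u) + b • (z + t • u) = (a • y + b • z) + (a * s + b * t) • u := by
    intro y z a b s t
    module
  refine ⟨?_, ?_⟩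
  · rintro y ⟨s, hs⟩ z ⟨t, ht⟩ a b ha hb hab
    refine ⟨a * s + b * t, ?_⟩
    rw [← hcomb]
    exact hK.convex.interior hs ht ha hb hab
  · intro y hy z hz a b ha hb hab
    refine le_overgraph hK.isCompact hu ?_
    have hp : proj u (a • y + b • z) = a • proj u y + b • proj u z := by
      simp only [proj, inner_add_right, inner_smul_right]
      module
    rw [hp, smul_eq_mul, smul_eq_mul, ← hcomb]
    exact hK.convex (overgraph_mem hK.isCompact hu (hproj y hy))
      (overgraph_mem hK.isCompact hu (hproj z hz)) ha hb hab

theorem isOpen_exists_add_smul_mem_interior (K : Set (𝔼 n)) (u : 𝔼 n) :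
    IsOpen {y | ∃ t : ℝ, y + t • u ∈ interior K} := by
  have : {y | ∃ t : ℝ, y + t • u ∈ interior K} = ⋃ t : ℝ, (fun y => y + t • u) ⁻¹' interior K := by
    ext y
    simp
  rw [this]
  exact isOpen_iUnion fun t => isOpen_interior.preimage (by fun_prop)

theorem continuousOn_midShift (hK : IsConvexBodyZero K) (hu : ‖u‖ = 1) :
    ContinuousOn (midShift K u) {y | ∃ t : ℝ, y + t • u ∈ interior K} := by
  have ho := isOpen_exists_add_smul_mem_interior K u
  have h1 := (concaveOn_overgraph_proj hK hu).continuousOn ho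
  have h2 := (concaveOn_overgraph_proj hK (u := -u) (by rwa [norm_neg])).continuousOn
    (isOpen_exists_add_smul_mem_interior K (-u))
  have h3 : ∀ y, proj (-u) y = proj u y := fun y => by simp [proj]
  have h4 : {y | ∃ t : ℝ, y + t • (-u) ∈ interior K} = {y | ∃ t : ℝ, y + t • u ∈ interior K} := by
    ext y
    constructor
    · rintro ⟨t, ht⟩
      exact ⟨-t, by rwa [neg_smul, ← smul_neg]⟩
    · rintro ⟨t, ht⟩
      exact ⟨-t, by rwa [smul_neg, neg_smul, neg_neg]⟩
  rw [h4] at h2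
  simp only [h3, ← undergraph_eq_overgraph_neg] at h2
  exact (h1.sub h2).div_const 2

/-- If `⟪x₁, ·⟫` and the reflected `⟪x₂, ·⟫` have the same sign, then the midpoints of the chords
which meet `x₁^⊥` inside `K` depend linearly on the chord. -/
theorem two_mul_midShift_eq (hK : IsConvexBodyZero K) (hu : ‖u‖ = 1) {x₁ x₂ : 𝔼 n}
    (h₁ : inner ℝ u x₁ = (1 : ℝ)) (h₂ : inner ℝ u x₂ = (-1 : ℝ))
    (h : ProbabilityTheory.cond volume (steiner u K)
      {y | (inner ℝ x₁ (shear K u y) : ℝ) * inner ℝ x₂ (shear K u (refl u y)) < 0} = 0)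
    {z : 𝔼 n} (hz : inner ℝ u z = (0 : ℝ)) (hzK : z - (inner ℝ x₁ z : ℝ) • u ∈ interior K) :
    2 * midShift K u z = inner ℝ x₂ z - inner ℝ x₁ z := by
  by_contra hne
  set D : Set (𝔼 n) := {y | ∃ t : ℝ, y + t • u ∈ interior K} with hD
  have hDo : IsOpen D := isOpen_exists_add_smul_mem_interior K u
  have hm : ContinuousOn (midShift K u) D := continuousOn_midShift hK hu
  set F : (𝔼 n) → ℝ := fun y => ((inner ℝ x₁ y : ℝ) + midShift K u y) *
    (inner ℝ x₂ (refl u y) - midShift K u y) with hF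
  have hFeq : ∀ y, (inner ℝ x₁ (shear K u y) : ℝ) * inner ℝ x₂ (shear K u (refl u y)) = F y := by
    intro y
    rw [shear_refl hu, inner_shear, inner_add_right, inner_smul_right, real_inner_comm u x₂, h₁, h₂]
    simp only [hF]
    ring
  have hrc : Continuous (refl u) := by
    unfold refl
    fun_prop
  have hFc : ContinuousOn F D := by
    have c1 : Continuous fun y : 𝔼 n => (inner ℝ x₁ y : ℝ) := by fun_prop
    have c2 : Continuous fun y : 𝔼 n => (inner ℝ x₂ (refl u y) : ℝ) := by fun_prop
    exact (c1.continuousOn.add hm).mul (c2.continuousOn.sub hm)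
  have hTc : ContinuousOn (shear K u) D := continuousOn_id.add (hm.smul continuousOn_const)
  set W : Set (𝔼 n) := (D ∩ shear K u ⁻¹' interior K) ∩ (D ∩ F ⁻¹' Iio 0) with hW
  have hWo : IsOpen W := (hTc.isOpen_inter_preimage hDo isOpen_interior).inter
    (hFc.isOpen_inter_preimage hDo isOpen_Iio)
  -- On the line `z + t u` the function `F` equals `(t - s₁) * (t - s₂)`. If the zeros differ, `F`
  -- is negative at points between them near `s₁`, which the shear sends close to `z - ⟪x₁, z⟫ u` in
  -- the interior of `K`. By continuity this produces an open set of sign changes.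
  set s₁ : ℝ := -inner ℝ x₁ z - midShift K u z with hs₁
  set s₂ : ℝ := midShift K u z - inner ℝ x₂ z with hs₂
  have hs : s₁ - s₂ ≠ 0 := fun h0 => hne (by rw [hs₁, hs₂] at h0; linarith)
  have hWne : W.Nonempty := by
    have hcont : Filter.Tendsto (fun ε : ℝ => z + (s₁ + ε * (s₂ - s₁) + midShift K u z) • u)
        (nhdsWithin 0 (Ioi 0)) (nhds (z - (inner ℝ x₁ z : ℝ) • u)) := by
      have hc : Continuous fun ε : ℝ => z + (s₁ + ε * (s₂ - s₁) + midShift K u z) • u := by fun_prop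
      have := (hc.tendsto 0).mono_left (nhdsWithin_le_nhds (s := Ioi 0))
      have e : z + (s₁ + 0 * (s₂ - s₁) + midShift K u z) • u = z - (inner ℝ x₁ z : ℝ) • u := by
        rw [hs₁]
        module
      rwa [e] at this
    obtain ⟨ε, ⟨hε1, hε2⟩, hε3⟩ := ((hcont.eventually (isOpen_interior.mem_nhds hzK)).and
      (nhdsWithin_le_nhds (gt_mem_nhds one_pos))).and self_mem_nhdsWithin |>.exists
    have hε3 : 0 < ε := hε3
    have hT : shear K u (z + (s₁ + ε * (s₂ - s₁)) • u) ∈ interior K := by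
      rw [shear, midShift_add_smul hu, add_assoc, ← add_smul]
      exact hε1
    have hyD : z + (s₁ + ε * (s₂ - s₁)) • u ∈ D := ⟨_, hT⟩
    refine ⟨z + (s₁ + ε * (s₂ - s₁)) • u, ⟨hyD, hT⟩, hyD, ?_⟩
    have e : F (z + (s₁ + ε * (s₂ - s₁)) • u) = -(ε * (1 - ε) * (s₁ - s₂) ^ 2) := by
      simp only [hF]
      rw [midShift_add_smul hu, refl_add_smul hu hz, inner_add_right, inner_add_right,
        inner_smul_right, inner_smul_right, real_inner_comm u x₁, real_inner_comm u x₂, h₁, h₂,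
        hs₁, hs₂]
      ring
    rw [mem_preimage, e, mem_Iio, neg_lt_zero]
    have : 0 < 1 - ε := sub_pos.2 hε2
    positivity
  have hv := hWo.measure_pos volume hWne
  rw [ProbabilityTheory.cond_apply (hK.measurableSet_steiner hu)] at h
  have hvt : volume (steiner u K) ≠ ⊤ := by
    rw [steiner_eq_preimage hK.isCompact hK.convex hu,
      (measurePreserving_shear_midShift hK.isCompact hu).measure_preimage
      hK.measurableSet.nullMeasurableSet]
    exact hK.volume_ne_top
  rcases mul_eq_zero.1 h with h | h
  · exact ENNReal.inv_ne_zero.2 hvt h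
  · refine hv.ne' (measure_mono_null ?_ h)
    refine fun y hy => ⟨?_, ?_⟩
    · rw [steiner_eq_preimage hK.isCompact hK.convex hu]
      exact interior_subset (s := K) hy.1.2
    · rw [mem_ofPred_eq, hFeq]
      exact hy.2.2

/-- In the equality case, normals of the centroid body at the end points of a chord parallel to `u`
determine the midpoints of the chords of `K` near the origin. -/
theorem two_mul_midShift_eq_of_centroidBody_eq (hφ : IsOrliczFunction φ) (hω : IsWeight ω)
    (hK : IsConvexBodyZero K) (hu : ‖u‖ = 1)
    (heq : centroidBody φ ω (steiner u K) = steiner u (centroidBody φ ω K)) {x₁ x₂ y : 𝔼 n}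
    (h₁ : inner ℝ u x₁ = (1 : ℝ)) (h₂ : inner ℝ u x₂ = (-1 : ℝ)) (hy0 : inner ℝ u y = (0 : ℝ))
    (hy : ∃ t : ℝ, y + t • u ∈ centroidBody φ ω K)
    (hx₁ : inner ℝ x₁ (y + overgraph (centroidBody φ ω K) u y • u) = centroidNorm φ ω K x₁)
    (hx₂ : inner ℝ x₂ (y + (-undergraph (centroidBody φ ω K) u y) • u) = centroidNorm φ ω K x₂)
    {z : 𝔼 n} (hz : inner ℝ u z = (0 : ℝ)) (hzK : z - (inner ℝ x₁ z : ℝ) • u ∈ interior K) :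
    2 * midShift K u z = inner ℝ x₂ z - inner ℝ x₁ z := by
  refine two_mul_midShift_eq hK hu h₁ h₂ ?_ hz hzK
  by_contra hne
  have hlt := centroidNorm_steiner_half_lt hφ hω hK hu h₁ h₂ hne
  have hc := (isConvexBodyZero_centroidBody hφ hω hK).isCompact
  have hσ : 0 ≤ halfLength (centroidBody φ ω K) u y := by
    obtain ⟨t, ht⟩ := hy
    have g1 := le_overgraph hc hu ht
    have g2 := neg_undergraph_le hc hu ht
    rw [halfLength]
    linarith
  have hmem : y + halfLength (centroidBody φ ω K) u y • u ∈ centroidBody φ ω (steiner u K) := by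
    rw [heq]
    exact ⟨y, (mem_shadow_iff hu).2 ⟨hy0, hy⟩, _, (abs_of_nonneg hσ).le, rfl⟩
  -- The support inequality at the upper end of the symmetrized chord is the reverse of the strict
  -- inequality `hlt`, because `x₁` and `x₂` attain their support values at the two ends of the
  -- chord.
  have h3 := hmem ((1 / 2 : ℝ) • (x₁ + refl u x₂))
  rw [inner_half_add_refl_add_smul hu h₁ h₂ hy0, halfLength] at h3
  rw [inner_add_right, inner_smul_right, real_inner_comm u x₁, h₁] at hx₁
  rw [inner_add_right, inner_smul_right, real_inner_comm u x₂, h₂] at hx₂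
  linarith

/-- A body has a normal at the upper end of each chord through the interior of its shadow. -/
theorem exists_normal_overgraph (hK : IsConvexBodyZero K) (hu : ‖u‖ = 1) {y : 𝔼 n}
    (hy : ∃ t : ℝ, y + t • u ∈ interior K) :
    ∃ x, inner ℝ u x = (1 : ℝ) ∧ ∀ z ∈ K, inner ℝ x z ≤ (inner ℝ x (y + overgraph K u y • u) : ℝ) := by
  obtain ⟨t, ht⟩ := hy
  have hy' : ∃ t : ℝ, y + t • u ∈ K := ⟨t, interior_subset ht⟩
  have htop := overgraph_mem hK.isCompact hu hy'
  have hnot : y + overgraph K u y • u ∉ interior K := by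
    intro hi
    have hc : Filter.Tendsto (fun ε : ℝ => y + (overgraph K u y + ε) • u) (nhdsWithin 0 (Ioi 0))
        (nhds (y + overgraph K u y • u)) := by
      have hc : Continuous fun ε : ℝ => y + (overgraph K u y + ε) • u := by fun_prop
      simpa using (hc.tendsto 0).mono_left (nhdsWithin_le_nhds (s := Ioi 0))
    obtain ⟨ε, h1, h2⟩ := ((hc.eventually (isOpen_interior.mem_nhds hi)).and
      self_mem_nhdsWithin).exists
    have h2 : 0 < ε := h2
    have := le_overgraph hK.isCompact hu (interior_subset h1)
    linarith
  obtain ⟨f, hf⟩ := geometric_hahn_banach_open_point hK.convex.interior isOpen_interior hnot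
  set x₀ : 𝔼 n := (InnerProductSpace.toDual ℝ _).symm f with hx₀
  have hin : ∀ z, inner ℝ x₀ z = f z := fun z => InnerProductSpace.toDual_symm_apply
  have hle : ∀ z ∈ K, f z ≤ f (y + overgraph K u y • u) := by
    have hcl : K ⊆ closure (interior K) := by
      rw [hK.convex.closure_interior_eq_closure_of_nonempty_interior ⟨_, hK.zero_mem_interior⟩]
      exact subset_closure
    intro z hz
    exact closure_minimal (fun w hw => (hf w hw).le)
      (isClosed_le f.continuous continuous_const) (hcl hz)
  have hlt : t < overgraph K u y := by
    refine lt_of_le_of_ne (le_overgraph hK.isCompact hu (interior_subset ht)) ?_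
    rintro rfl
    exact hnot ht
  -- The chord has an interior point strictly below its upper end, so the separating functional
  -- increases along `u` and can be normalized to `u`-component one.
  have hpos : 0 < f u := by
    have h1 := hf _ ht
    rw [map_add, map_add, map_smul, map_smul, smul_eq_mul, smul_eq_mul] at h1
    nlinarith
  refine ⟨(f u)⁻¹ • x₀, ?_, fun z hz => ?_⟩
  · rw [inner_smul_right, real_inner_comm, hin, inv_mul_cancel₀ hpos.ne']
  · rw [inner_smul_left, inner_smul_left, hin, hin, RCLike.conj_to_real]
    exact mul_le_mul_of_nonneg_left (hle z hz) (inv_nonneg.2 hpos.le)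

theorem exists_normal_undergraph (hK : IsConvexBodyZero K) (hu : ‖u‖ = 1) {y : 𝔼 n}
    (hy : ∃ t : ℝ, y + t • u ∈ interior K) :
    ∃ x, inner ℝ u x = (-1 : ℝ) ∧
      ∀ z ∈ K, inner ℝ x z ≤ (inner ℝ x (y + (-undergraph K u y) • u) : ℝ) := by
  obtain ⟨x, h1, h2⟩ := exists_normal_overgraph hK (u := -u) (y := y) (by rwa [norm_neg]) (by
    obtain ⟨t, ht⟩ := hy
    exact ⟨-t, by rwa [smul_neg, neg_smul, neg_neg]⟩)
  refine ⟨x, by rw [inner_neg_left] at h1; linarith, fun z hz => ?_⟩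
  have := h2 z hz
  rwa [smul_neg, ← neg_smul, ← undergraph_eq_overgraph_neg] at this

end

/-! ### Radii and the common hyperplane of midpoints. -/

section

variable {n : ℕ}

local notation "𝔼" n => EuclideanSpace ℝ (Fin n)

variable {φ ω : ℝ → ℝ} {K : Set (𝔼 n)} {u : 𝔼 n}

theorem radialFn_nonneg (K : Set (𝔼 n)) (v : 𝔼 n) : 0 ≤ radialFn K v :=
  Real.sSup_nonneg fun _ h => h.1.le

theorem innerRadius_nonneg (K : Set (𝔼 n)) : 0 ≤ innerRadius K := by
  refine Real.sInf_nonneg ?_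
  rintro _ ⟨v, -, rfl⟩
  exact radialFn_nonneg K v

theorem IsConvexBodyZero.ball_innerRadius_subset (hK : IsConvexBodyZero K) :
    Metric.ball 0 (innerRadius K) ⊆ K := by
  intro z hz
  rw [mem_ball_zero_iff] at hz
  rcases eq_or_ne z 0 with rfl | hz0
  · exact hK.zero_mem
  have hn : 0 < ‖z‖ := norm_pos_iff.2 hz0
  have h1 : innerRadius K ≤ radialFn K (‖z‖⁻¹ • z) := by
    refine csInf_le ⟨0, ?_⟩ ⟨_, ?_, rfl⟩
    · rintro _ ⟨v, -, rfl⟩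
      exact radialFn_nonneg K v
    · simp [norm_smul, inv_mul_cancel₀ hn.ne']
  have h2 := hz.trans_le h1
  have hne : {lam : ℝ | 0 < lam ∧ lam • (‖z‖⁻¹ • z) ∈ K}.Nonempty := by
    by_contra! h
    rw [radialFn, h, Real.sSup_empty] at h2
    linarith
  obtain ⟨lam, ⟨hl0, hl⟩, hlt⟩ := exists_lt_of_lt_csSup hne h2
  have := hK.convex.smul_mem_of_zero_mem hK.zero_mem hl (t := ‖z‖ / lam)
    ⟨by positivity, (div_le_one hl0).2 hlt.le⟩
  rwa [smul_smul, smul_smul, div_mul_cancel₀ _ hl0.ne', mul_inv_cancel₀ hn.ne', one_smul] at this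

theorem IsConvexBodyZero.mem_interior_of_norm_lt (hK : IsConvexBodyZero K) {z : 𝔼 n}
    (hz : ‖z‖ < innerRadius K) : z ∈ interior K :=
  interior_maximal hK.ball_innerRadius_subset Metric.isOpen_ball (mem_ball_zero_iff.2 hz)

theorem IsConvexBodyZero.le_outerRadius (hK : IsConvexBodyZero K) {v : 𝔼 n} (hv : ‖v‖ = 1) {t : ℝ}
    (ht : 0 < t) (htv : t • v ∈ K) : t ≤ outerRadius K := by
  obtain ⟨R, hR, hKR⟩ := hK.exists_norm_le
  have hb : ∀ v : 𝔼 n, ‖v‖ = 1 → ∀ lam ∈ {lam : ℝ | 0 < lam ∧ lam • v ∈ K}, lam ≤ R := by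
    rintro v hv lam ⟨h0, h⟩
    have := hKR _ h
    rwa [norm_smul, hv, mul_one, Real.norm_of_nonneg h0.le] at this
  have h1 : t ≤ radialFn K v := le_csSup ⟨R, hb v hv⟩ ⟨ht, htv⟩
  refine h1.trans (le_csSup ⟨R, ?_⟩ ⟨v, by simpa using hv, rfl⟩)
  rintro _ ⟨v, hv, rfl⟩
  exact Real.sSup_le (hb v (by simpa using hv)) hR.le

theorem inner_eq_centroidNorm_of_normal (hφ : IsOrliczFunction φ) (hω : IsWeight ω)
    (hK : IsConvexBodyZero K) {x q : 𝔼 n} (hq : q ∈ centroidBody φ ω K)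
    (h : ∀ z ∈ centroidBody φ ω K, inner ℝ x z ≤ (inner ℝ x q : ℝ)) :
    inner ℝ x q = centroidNorm φ ω K x := by
  obtain ⟨y, hy, hxy⟩ := (isPosSublinear_centroidNorm hφ hω hK).exists_inner_eq x
  exact le_antisymm (hq x) (hxy ▸ h y hy)

theorem innerRadius_mul_norm_le (hφ : IsOrliczFunction φ) (hω : IsWeight ω)
    (hK : IsConvexBodyZero K) (x : 𝔼 n) :
    innerRadius (centroidBody φ ω K) * ‖x‖ ≤ centroidNorm φ ω K x := by
  rcases eq_or_ne x 0 with rfl | hx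
  · simp [(isPosSublinear_centroidNorm hφ hω hK).map_zero]
  have hn : 0 < ‖x‖ := norm_pos_iff.2 hx
  rw [← le_div_iff₀ hn]
  refine le_of_forall_lt_imp_le_of_dense fun r hr => ?_
  rcases lt_or_ge r 0 with h0 | h0
  · have := (isPosSublinear_centroidNorm hφ hω hK).nonneg x
    exact h0.le.trans (by positivity)
  have hmem : (r / ‖x‖) • x ∈ centroidBody φ ω K := by
    refine (isConvexBodyZero_centroidBody hφ hω hK).ball_innerRadius_subset ?_
    rw [mem_ball_zero_iff, norm_smul, Real.norm_of_nonneg (by positivity), div_mul_cancel₀ _ hn.ne']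
    exact hr
  have := hmem x
  rw [inner_smul_right, real_inner_self_eq_norm_sq] at this
  rw [le_div_iff₀ hn]
  calc r * ‖x‖ = r / ‖x‖ * ‖x‖ ^ 2 := by field_simp
    _ ≤ _ := this

theorem norm_le_norm_add_smul {y : 𝔼 n} (hy : inner ℝ u y = (0 : ℝ)) (t : ℝ) :
    ‖y‖ ≤ ‖y + t • u‖ := by
  rw [← sq_le_sq₀ (norm_nonneg _) (norm_nonneg _), norm_add_sq_real, inner_smul_right,
    real_inner_comm, hy]
  nlinarith [sq_nonneg ‖t • u‖]

/-- The normals at the two ends of the chord of the centroid body through the origin give one linear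
formula for all nearby midpoints. The bound on the distance ensures that the zero of `⟪x₁, ·⟫` on
the line lies in the interior of `K`. -/
theorem exists_submodule_chordMidpoint_mem (hφ : IsOrliczFunction φ) (hω : IsWeight ω)
    (hK : IsConvexBodyZero K) (hu : ‖u‖ = 1)
    (heq : centroidBody φ ω (steiner u K) = steiner u (centroidBody φ ω K)) :
    ∃ H : Submodule ℝ (𝔼 n), Module.finrank ℝ H + 1 = n ∧ ∀ y ∈ shadow K u,
      Metric.infDist 0 (chord K u y) < innerRadius K * innerRadius (centroidBody φ ω K) /
        (4 * outerRadius (centroidBody φ ω K)) → chordMidpoint K u y ∈ H := by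
  set L := centroidBody φ ω K with hLdef
  have hL : IsConvexBodyZero L := isConvexBodyZero_centroidBody hφ hω hK
  have h0 : ∃ t : ℝ, (0 : 𝔼 n) + t • u ∈ interior L := ⟨0, by simpa using hL.zero_mem_interior⟩
  have h0' : ∃ t : ℝ, (0 : 𝔼 n) + t • u ∈ L := ⟨0, by simpa using hL.zero_mem⟩
  have hiz : inner ℝ u (0 : 𝔼 n) = (0 : ℝ) := inner_zero_right _
  obtain ⟨x₁, h₁, hx₁⟩ := exists_normal_overgraph hL hu h0
  obtain ⟨x₂, h₂, hx₂⟩ := exists_normal_undergraph hL hu h0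
  have e₁ := inner_eq_centroidNorm_of_normal hφ hω hK (overgraph_mem hL.isCompact hu h0') hx₁
  have e₂ := inner_eq_centroidNorm_of_normal hφ hω hK (undergraph_mem hL.isCompact hu h0') hx₂
  have key := fun z => two_mul_midShift_eq_of_centroidBody_eq (z := z) hφ hω hK hu heq h₁ h₂ hiz
    h0' e₁ e₂
  -- With this `w`, orthogonality of `y + m u` to `w` reads `m = ⟪x₂ - x₁, y⟫ / 2` for `y` in `u^⊥`.
  set w : 𝔼 n := u - (1 / 2 : ℝ) • proj u (x₂ - x₁) with hw
  have hwu : inner ℝ u w = (1 : ℝ) := by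
    rw [hw, inner_sub_right, inner_smul_right, inner_proj_self hu, inner_self_of_norm_eq_one hu]
    ring
  have hw0 : w ≠ 0 := by
    intro h
    rw [h, inner_zero_right] at hwu
    exact zero_ne_one hwu
  refine ⟨(ℝ ∙ w)ᗮ, ?_, fun y hy hdist => ?_⟩
  · have := Submodule.finrank_add_finrank_orthogonal (ℝ ∙ w)
    rw [finrank_span_singleton hw0, finrank_euclideanSpace_fin] at this
    omega
  obtain ⟨hyu, t, ht⟩ := (mem_shadow_iff hu).1 hy
  have hne : (chord K u y).Nonempty := ⟨y + t • u, ht, t, rfl⟩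
  obtain ⟨q, ⟨-, s, hs⟩, hq⟩ := (Metric.infDist_lt_iff hne).1 hdist
  have hyB : ‖y‖ < innerRadius K * innerRadius L / (4 * outerRadius L) := by
    rw [dist_zero_left, ← hs] at hq
    exact (norm_le_norm_add_smul hyu s).trans_lt hq
  have hg : inner ℝ x₁ (0 + overgraph L u 0 • u) = overgraph L u 0 := by
    rw [zero_add, inner_smul_right, real_inner_comm, h₁, mul_one]
  have hx₁0 : x₁ ≠ 0 := by
    rintro rfl
    simp at h₁
  have hgpos : 0 < overgraph L u 0 := by
    rw [← hg, e₁]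
    exact centroidNorm_pos hφ hω hK hx₁0
  have hgR : overgraph L u 0 ≤ outerRadius L := by
    refine hL.le_outerRadius hu hgpos ?_
    have := overgraph_mem hL.isCompact hu h0'
    rwa [zero_add] at this
  have hrx : innerRadius L * ‖x₁‖ ≤ outerRadius L := by
    refine (innerRadius_mul_norm_le hφ hω hK x₁).trans ?_
    rw [← e₁, hg]
    exact hgR
  have hx1 : 1 ≤ ‖x₁‖ := by
    have := real_inner_le_norm u x₁
    rwa [h₁, hu, one_mul] at this
  have hR := hgpos.trans_le hgR
  have hrK : 0 < innerRadius K := by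
    refine lt_of_le_of_ne (innerRadius_nonneg K) fun h => ?_
    rw [← h, zero_mul, zero_div] at hyB
    exact absurd hyB (not_lt.2 (norm_nonneg y))
  have hyK : ‖y - (inner ℝ x₁ y : ℝ) • u‖ < innerRadius K := by
    have a1 : ‖y - (inner ℝ x₁ y : ℝ) • u‖ ≤ ‖y‖ + ‖x₁‖ * ‖y‖ := by
      refine (norm_sub_le _ _).trans ?_
      rw [norm_smul, hu, mul_one]
      gcongr
      exact norm_inner_le_norm x₁ y
    rw [lt_div_iff₀ (by positivity)] at hyB
    have a3 : 0 ≤ innerRadius K * innerRadius L :=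
      mul_nonneg (innerRadius_nonneg K) (innerRadius_nonneg L)
    -- Since `1 ≤ ‖x₁‖` and `‖x₁‖` is at most the ratio of the outer to the inner radius of `L`, the
    -- factor `1 + ‖x₁‖` costs at most twice that ratio. The constant `4` then leaves half the inner
    -- radius of `K`, hence strict inequality.
    have a2 : ‖y‖ * (1 + ‖x₁‖) * (4 * outerRadius L) ≤ innerRadius K * (2 * outerRadius L) := by
      calc ‖y‖ * (1 + ‖x₁‖) * (4 * outerRadius L) = ‖y‖ * (4 * outerRadius L) * (1 + ‖x₁‖) := by ring
        _ ≤ innerRadius K * innerRadius L * (‖x₁‖ + ‖x₁‖) := by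
            gcongr
        _ = innerRadius K * (2 * (innerRadius L * ‖x₁‖)) := by ring
        _ ≤ _ := by gcongr
    nlinarith
  have hm := key y hyu (hK.mem_interior_of_norm_lt hyK)
  rw [midShift, proj_of_inner_eq_zero hyu] at hm
  rw [Submodule.mem_orthogonal_singleton_iff_inner_right, chordMidpoint, inner_add_right,
    inner_smul_right, real_inner_comm u w, hwu, hw, inner_sub_left, hyu, inner_smul_left, proj,
    inner_sub_left, inner_smul_left, hyu, inner_sub_left]
  simp only [RCLike.conj_to_real]
  linarith

end

/-! ### Analytic and linear criteria for ellipsoids. -/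

section

/-- On a partition into `N + 1` equal steps the increments of `a` telescope, so the total variation
bound is `(a 1 - a 0) / (N + 1)`. No continuity of `a` is needed, so it may come from an arbitrary
choice of normals. -/
theorem eq_of_abs_sub_le_mul_sub {d a : ℝ → ℝ}
    (h : ∀ s t, 0 ≤ s → s ≤ t → t ≤ 1 → |d t - d s| ≤ (a t - a s) * (t - s)) : d 1 = d 0 := by
  have key : ∀ N : ℕ, |d 1 - d 0| ≤ (a 1 - a 0) * (1 / ((N : ℝ) + 1)) := by
    intro N
    have hN : (0 : ℝ) < (N : ℝ) + 1 := by positivity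
    have hsum : ∀ f : ℝ → ℝ, ∑ i ∈ Finset.range (N + 1),
        (f (((i + 1 : ℕ) : ℝ) / (N + 1)) - f ((i : ℝ) / (N + 1))) = f 1 - f 0 := by
      intro f
      rw [Finset.sum_range_sub (fun i : ℕ => f ((i : ℝ) / (N + 1)))]
      simp [div_self hN.ne']
    rw [← hsum d, ← hsum a, Finset.sum_mul]
    refine (Finset.abs_sum_le_sum_abs _ _).trans (Finset.sum_le_sum fun i hi => ?_)
    have hi' : ((i : ℝ) + 1) ≤ N + 1 := by exact_mod_cast Finset.mem_range.1 hi
    have := h ((i : ℝ) / (N + 1)) (((i + 1 : ℕ) : ℝ) / (N + 1)) (by positivity)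
      (by gcongr; simp) (by rw [div_le_one hN]; push_cast; exact hi')
    refine this.trans (le_of_eq ?_)
    congr 1
    push_cast
    field_simp
    ring
  have hlim : Filter.Tendsto (fun N : ℕ => (a 1 - a 0) * (1 / ((N : ℝ) + 1))) Filter.atTop
      (nhds 0) := by
    simpa using tendsto_one_div_add_atTop_nhds_zero_nat.const_mul (a 1 - a 0)
  have h0 : |d 1 - d 0| ≤ 0 := ge_of_tendsto' hlim key
  exact sub_eq_zero.1 (abs_nonpos_iff.1 h0)

variable {n : ℕ}

local notation "𝔼" n => EuclideanSpace ℝ (Fin n)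

/-- A functional whose value at each `w` is attained at a multiple of `w` is a multiple of the
norm. -/
theorem exists_eq_mul_norm {h : (𝔼 n) → ℝ} (hs : ∀ c : ℝ, 0 < c → ∀ x, h (c • x) = c * h x)
    (heven : ∀ x, h (-x) = h x) (hpos : ∀ x, x ≠ 0 → 0 < h x) {C : ℝ} (hC : ∀ x, h x ≤ C * ‖x‖)
    (hin : ∀ v w, w ≠ 0 → (inner ℝ v w : ℝ) * h w ≤ h v * ‖w‖ ^ 2) :
    ∃ r, 0 < r ∧ ∀ x, h x = r * ‖x‖ := by
  have h0 : h 0 = 0 := by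
    have := hs 2 two_pos 0
    rw [smul_zero] at this
    linarith
  have unit : ∀ x y : 𝔼 n, ‖x‖ = 1 → ‖y‖ = 1 → h x = h y := by
    intro x y hx hy
    rcases eq_or_ne (y - (inner ℝ x y : ℝ) • x) 0 with hxy | hxy
    · have hy' : y = (inner ℝ x y : ℝ) • x := sub_eq_zero.1 hxy
      have : |(inner ℝ x y : ℝ)| = 1 := by
        have := congrArg norm hy'
        rwa [norm_smul, hx, hy, mul_one, eq_comm, Real.norm_eq_abs] at this
      rcases eq_or_eq_neg_of_abs_eq this with h1 | h1
      · rw [hy', h1, one_smul]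
      · rw [hy', h1, neg_one_smul, heven]
    · set c : ℝ := inner ℝ x y with hc
      set r := ‖y - c • x‖ with hr
      have hr0 : 0 < r := norm_pos_iff.2 hxy
      set e : 𝔼 n := r⁻¹ • (y - c • x) with he
      have hxx : inner ℝ x x = (1 : ℝ) := inner_self_of_norm_eq_one hx
      have hxe : inner ℝ x e = (0 : ℝ) := by
        rw [he, inner_smul_right, inner_sub_right, inner_smul_right, hxx, ← hc]
        ring
      have hee : inner ℝ e e = (1 : ℝ) := by
        rw [real_inner_self_eq_norm_sq, he, norm_smul, norm_inv, norm_norm, ← hr,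
          inv_mul_cancel₀ hr0.ne', one_pow]
      have hrc : c ^ 2 + r ^ 2 = 1 := by
        rw [hr, norm_sub_sq_real, norm_smul, hx, hy, inner_smul_right, real_inner_comm, ← hc,
          Real.norm_eq_abs, mul_one, sq_abs]
        ring
      have hc1 : -1 ≤ c ∧ c ≤ 1 := abs_le.1 (by rw [← sq_le_one_iff_abs_le_one]; nlinarith)
      set θ := Real.arccos c with hθ
      have hcos : Real.cos θ = c := Real.cos_arccos hc1.1 hc1.2
      have hsin : Real.sin θ = r := by
        rw [hθ, Real.sin_arccos, ← hrc, add_sub_cancel_left, Real.sqrt_sq hr0.le]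
      -- The great circle from `x` to `y`. The hypothesis along it gives `cos (t - s) * h (γ s) ≤ h
      -- (γ t)`, so increments of `h ∘ γ` are quadratically small and `h ∘ γ` is constant.
      set γ : ℝ → 𝔼 n := fun t => Real.cos t • x + Real.sin t • e with hγ
      have hγi : ∀ s t, inner ℝ (γ t) (γ s) = Real.cos (t - s) := by
        intro s t
        simp only [hγ, inner_add_left, inner_add_right, inner_smul_left, inner_smul_right, hxx, hee,
          hxe, real_inner_comm x e, RCLike.conj_to_real, Real.cos_sub]
        ring
      have hγn : ∀ t, ‖γ t‖ = 1 := by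
        intro t
        have := hγi t t
        rw [sub_self, Real.cos_zero, real_inner_self_eq_norm_sq] at this
        exact (pow_eq_one_iff_of_nonneg (norm_nonneg _) two_ne_zero).1 this
      have hγ0 : ∀ t, γ t ≠ 0 := fun t ht => by
        have := hγn t
        rw [ht, norm_zero] at this
        exact zero_ne_one this
      have hψ : ∀ s t, Real.cos (t - s) * h (γ s) ≤ h (γ t) := fun s t => by
        have := hin (γ t) (γ s) (hγ0 s)
        rwa [hγi, hγn, one_pow, mul_one] at this
      have hψC : ∀ t, h (γ t) ≤ C := fun t => by simpa [hγn] using hC (γ t)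
      have hdiff : ∀ s t, h (γ s) - h (γ t) ≤ C * ((t - s) ^ 2 / 2) := by
        intro s t
        have h1 := hψ s t
        have h2 := Real.one_sub_sq_div_two_le_cos (x := t - s)
        have h3 := (hpos _ (hγ0 s)).le
        have h4 : (1 - (t - s) ^ 2 / 2) * h (γ s) ≤ Real.cos (t - s) * h (γ s) := by gcongr
        have h5 : (t - s) ^ 2 / 2 * h (γ s) ≤ (t - s) ^ 2 / 2 * C := by
          gcongr
          exact hψC s
        linarith
      have := eq_of_abs_sub_le_mul_sub (d := fun τ => h (γ (θ * τ)))
        (a := fun τ => C * θ ^ 2 / 2 * τ) (by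
          intro s t _ _ _
          have e1 := hdiff (θ * s) (θ * t)
          have e2 := hdiff (θ * t) (θ * s)
          rw [abs_le]
          constructor <;> nlinarith)
      simp only [mul_one, mul_zero] at this
      have g0 : γ 0 = x := by simp [hγ]
      have g1 : γ θ = y := by
        simp only [hγ]
        rw [hcos, hsin, he, smul_smul, mul_inv_cancel₀ hr0.ne', one_smul, add_sub_cancel]
      rw [g0, g1] at this
      exact this.symm
  by_cases hne : ∃ x : 𝔼 n, x ≠ 0
  · obtain ⟨v, hv⟩ := hne
    have hn : ∀ x : 𝔼 n, x ≠ 0 → ‖‖x‖⁻¹ • x‖ = 1 := fun x hx => by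
      rw [norm_smul, norm_inv, norm_norm, inv_mul_cancel₀ (norm_ne_zero_iff.2 hx)]
    have hv' : ‖v‖⁻¹ • v ≠ 0 := smul_ne_zero (inv_ne_zero (norm_ne_zero_iff.2 hv)) hv
    refine ⟨h (‖v‖⁻¹ • v), hpos _ hv', fun x => ?_⟩
    rcases eq_or_ne x 0 with rfl | hx
    · rw [h0, norm_zero, mul_zero]
    · rw [unit _ _ (hn v hv) (hn x hx), hs _ (inv_pos.2 (norm_pos_iff.2 hx)), mul_comm, ← mul_assoc,
        mul_inv_cancel₀ (norm_ne_zero_iff.2 hx), one_mul]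
  · push Not at hne
    exact ⟨1, one_pos, fun x => by rw [hne x, h0, norm_zero, mul_zero]⟩

/-- A positive definite symmetric form is the standard one in suitable coordinates. -/
theorem exists_linearEquiv_inner_eq {B : LinearMap.BilinForm ℝ (𝔼 n)} (hsymm : ∀ x y, B x y = B y x)
    (hpos : ∀ x, x ≠ 0 → 0 < B x x) :
    ∃ C : (𝔼 n) ≃ₗ[ℝ] 𝔼 n, ∀ x y, B x y = inner ℝ (C x) (C y) := by
  have : Invertible (2 : ℝ) := invertibleOfNonzero two_ne_zero
  obtain ⟨v, hv⟩ := LinearMap.BilinForm.exists_orthogonal_basis (LinearMap.isSymm_def.2 hsymm)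
  have hvv : ∀ i, 0 < B (v i) (v i) := fun i => hpos _ (v.ne_zero i)
  have hunit : ∀ i, IsUnit (Real.sqrt (B (v i) (v i)))⁻¹ := fun i =>
    (inv_ne_zero (Real.sqrt_pos.2 (hvv i)).ne').isUnit
  set b := v.isUnitSMul hunit with hb
  have hbb : ∀ i j, B (b i) (b j) = if i = j then 1 else 0 := by
    intro i j
    rw [hb, Module.Basis.isUnitSMul_apply, Module.Basis.isUnitSMul_apply, map_smul, map_smul,
      LinearMap.smul_apply, smul_eq_mul, smul_eq_mul]
    split_ifs with hij
    · subst hij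
      have := Real.mul_self_sqrt (hvv i).le
      have h2 := (Real.sqrt_pos.2 (hvv i)).ne'
      field_simp
      rw [sq, this]
    · rw [hv hij, mul_zero, mul_zero]
  have hfin : Module.finrank ℝ (𝔼 n) = n := finrank_euclideanSpace_fin
  set b' := b.reindex (finCongr hfin) with hb'
  set o := EuclideanSpace.basisFun (Fin n) ℝ with ho
  have hbb' : ∀ i j, B (b' i) (b' j) = if i = j then 1 else 0 := by
    intro i j
    rw [hb', Module.Basis.reindex_apply, Module.Basis.reindex_apply, hbb]
    simp
  -- The map sending a basis orthonormal for `B` to the standard orthonormal basis.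
  refine ⟨b'.equiv o.toBasis (Equiv.refl _), fun x y => ?_⟩
  have key : B = (LinearMap.BilinForm.comp (innerₗ (𝔼 n))
      (b'.equiv o.toBasis (Equiv.refl _)).toLinearMap
      (b'.equiv o.toBasis (Equiv.refl _)).toLinearMap) := by
    refine b'.ext fun i => b'.ext fun j => ?_
    rw [hbb', LinearMap.BilinForm.comp_apply]
    simp only [LinearEquiv.coe_coe, Module.Basis.equiv_apply, Equiv.refl_apply, innerₗ_apply_apply,
      OrthonormalBasis.coe_toBasis]
    exact (orthonormal_iff_ite.1 o.orthonormal i j).symm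
  rw [key]
  rfl

/-- Support function characterization of origin-centered ellipsoids. -/
theorem isOriginEllipsoid_of_supportFn {K : Set (𝔼 n)} (hK : IsConvexBodyZero K)
    (C : (𝔼 n) ≃ₗ[ℝ] 𝔼 n) {r : ℝ} (hr : 0 < r) (h : ∀ x, supportFn K x = r * ‖C x‖) :
    IsOriginEllipsoid K := by
  have hbd : ∀ x, BddAbove ((fun y => (inner ℝ x y : ℝ)) '' K) := fun x =>
    (hK.isCompact.image (by fun_prop)).bddAbove
  have hmem : ∀ y, y ∈ K ↔ ∀ x, inner ℝ x y ≤ r * ‖C x‖ := by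
    intro y
    constructor
    · intro hy x
      rw [← h x]
      exact le_csSup (hbd x) ⟨y, hy, rfl⟩
    · intro hy
      by_contra hyK
      obtain ⟨f, s, hf, hs⟩ := geometric_hahn_banach_closed_point hK.convex hK.isCompact.isClosed hyK
      set x := (InnerProductSpace.toDual ℝ _).symm f
      have hin : ∀ z, inner ℝ x z = f z := fun z => InnerProductSpace.toDual_symm_apply
      have h1 : supportFn K x ≤ s := by
        refine csSup_le ⟨_, 0, hK.zero_mem, rfl⟩ ?_
        rintro _ ⟨z, hz, rfl⟩
        exact (hin z).trans_le (hf z hz).le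
      have h2 := hy x
      rw [← h, hin] at h2
      linarith
  -- The ball has support function `‖·‖`, so its image under `r` times the adjoint of `C` has
  -- support function `r * ‖C x‖`.
  have hadj : ∀ x z, inner ℝ x (LinearMap.adjoint C.toLinearMap z) = (inner ℝ (C x) z : ℝ) :=
    fun x z => LinearMap.adjoint_inner_right _ _ _
  have hinj : Function.Injective (r • LinearMap.adjoint C.toLinearMap) := by
    rw [← LinearMap.ker_eq_bot, LinearMap.ker_eq_bot']
    intro z hz
    rw [LinearMap.smul_apply, smul_eq_zero] at hz
    have h1 := hadj (C.symm z) z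
    rw [hz.resolve_left hr.ne', inner_zero_right, LinearEquiv.apply_symm_apply] at h1
    exact inner_self_eq_zero.1 h1.symm
  refine ⟨LinearEquiv.ofInjectiveEndo _ hinj, ?_⟩
  set A := LinearEquiv.ofInjectiveEndo _ hinj with hA
  have hAin : ∀ x z, inner ℝ x (A z) = r * (inner ℝ (C x) z : ℝ) := fun x z => by
    rw [hA, LinearEquiv.coe_ofInjectiveEndo, LinearMap.smul_apply, inner_smul_right, hadj]
  ext y
  obtain ⟨z, rfl⟩ := A.surjective y
  rw [hmem, A.injective.mem_set_image, mem_closedBall_zero_iff]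
  simp only [hAin, mul_le_mul_iff_right₀ hr]
  constructor
  · intro hz
    have := hz (C.symm z)
    rw [LinearEquiv.apply_symm_apply, real_inner_self_eq_norm_sq] at this
    rcases (norm_nonneg z).eq_or_lt with h0 | h0
    · rw [← h0]
      exact zero_le_one
    · nlinarith
  · intro hz x
    refine (real_inner_le_norm _ _).trans ?_
    exact mul_le_of_le_one_right (norm_nonneg _) hz

end

/-! ### Equality in direction `u`: symmetry of the centroid body. -/

section

variable {n : ℕ}

local notation "𝔼" n => EuclideanSpace ℝ (Fin n)

variable {φ ω : ℝ → ℝ} {K L : Set (𝔼 n)} {u w : 𝔼 n}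

theorem undergraph_eq_overgraph_neg_right (hsymm : ∀ y ∈ L, -y ∈ L) (u y : 𝔼 n) :
    undergraph L u y = overgraph L u (-y) := by
  rw [undergraph_eq_overgraph_neg, overgraph, overgraph]
  congr 1
  ext t
  constructor
  · intro h
    have := hsymm _ h
    rwa [smul_neg, neg_add, neg_neg] at this
  · intro h
    have := hsymm _ h
    rwa [neg_add, neg_neg, ← smul_neg] at this

theorem neg_mem_centroidBody : ∀ y ∈ centroidBody φ ω K, -y ∈ centroidBody φ ω K := by
  intro y hy x
  have := hy (-x)
  rwa [centroidNorm_neg, inner_neg_left, ← inner_neg_right] at this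

/-- In the equality case, the chords of `K` parallel to `u` near the origin are bisected by `w^⊥`,
where `w` is normal to the centroid body at its boundary point in direction `u`. -/
theorem exists_normal_midShift (hφ : IsOrliczFunction φ) (hω : IsWeight ω)
    (hK : IsConvexBodyZero K) (hu : ‖u‖ = 1)
    (heq : centroidBody φ ω (steiner u K) = steiner u (centroidBody φ ω K)) :
    ∃ w, inner ℝ u w = (1 : ℝ) ∧
      ∀ z, inner ℝ u z = (0 : ℝ) → z - (inner ℝ w z : ℝ) • u ∈ interior K →
        midShift K u z = -inner ℝ w z := by
  have hL := isConvexBodyZero_centroidBody hφ hω hK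
  set L := centroidBody φ ω K with hLdef
  have h0 : ∃ t : ℝ, (0 : 𝔼 n) + t • u ∈ interior L := ⟨0, by simpa using hL.zero_mem_interior⟩
  have h0' : ∃ t : ℝ, (0 : 𝔼 n) + t • u ∈ L := ⟨0, by simpa using hL.zero_mem⟩
  obtain ⟨w, hw, hwn⟩ := exists_normal_overgraph hL hu h0
  have e₁ := inner_eq_centroidNorm_of_normal hφ hω hK (overgraph_mem hL.isCompact hu h0') hwn
  refine ⟨w, hw, fun z hz hzK => ?_⟩
  -- By central symmetry of the centroid body, `-w` is a normal at the opposite end of the chord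
  -- through the origin.
  have e₂ : inner ℝ (-w) ((0 : 𝔼 n) + (-undergraph L u 0) • u) = centroidNorm φ ω K (-w) := by
    rw [undergraph_eq_overgraph_neg_right neg_mem_centroidBody, neg_zero, centroidNorm_neg, ← e₁,
      zero_add, zero_add, neg_smul, inner_neg_neg]
  have := two_mul_midShift_eq_of_centroidBody_eq hφ hω hK hu heq hw
    (by rw [inner_neg_right, hw]) (inner_zero_right _) h0' e₁ e₂ hz hzK
  rw [inner_neg_left] at this
  linarith

/-- The midpoint formulas hold only near the origin; scaling `z` down makes them applicable, and
being linear they extend back to all `z`. -/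
theorem eventually_smul_sub_mem_interior (hK : IsConvexBodyZero K) (x u z : 𝔼 n) :
    ∀ᶠ ε : ℝ in nhdsWithin 0 (Ioi 0), ε • z - (inner ℝ x (ε • z) : ℝ) • u ∈ interior K := by
  have hc : Continuous fun ε : ℝ => ε • z - (inner ℝ x (ε • z) : ℝ) • u := by fun_prop
  have := (hc.tendsto 0).mono_left (nhdsWithin_le_nhds (s := Ioi 0))
  simp only [zero_smul, inner_zero_right, sub_zero] at this
  exact this.eventually (isOpen_interior.mem_nhds hK.zero_mem_interior)

/-- In the equality case, the two normals of the centroid body at the ends of a chord parallel to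
`u` differ by a vector which does not depend on the chord. -/
theorem exists_normals_sub_eq (hφ : IsOrliczFunction φ) (hω : IsWeight ω)
    (hK : IsConvexBodyZero K) (hu : ‖u‖ = 1)
    (heq : centroidBody φ ω (steiner u K) = steiner u (centroidBody φ ω K))
    (hw : inner ℝ u w = (1 : ℝ))
    (hmid : ∀ z, inner ℝ u z = (0 : ℝ) → z - (inner ℝ w z : ℝ) • u ∈ interior K →
        midShift K u z = -inner ℝ w z)
    {y : 𝔼 n} (hyu : inner ℝ u y = (0 : ℝ))
    (hy : ∃ t : ℝ, y + t • u ∈ interior (centroidBody φ ω K)) :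
    ∃ x, inner ℝ u x = (1 : ℝ) ∧
      (∀ z ∈ centroidBody φ ω K,
        inner ℝ x z ≤ (inner ℝ x (y + overgraph (centroidBody φ ω K) u y • u) : ℝ)) ∧
      ∀ z ∈ centroidBody φ ω K, inner ℝ (x - (2 : ℝ) • w) z ≤
        (inner ℝ (x - (2 : ℝ) • w) (y + (-undergraph (centroidBody φ ω K) u y) • u) : ℝ) := by
  have hL := isConvexBodyZero_centroidBody hφ hω hK
  set L := centroidBody φ ω K with hLdef
  obtain ⟨x₁, h₁, hx₁⟩ := exists_normal_overgraph hL hu hy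
  obtain ⟨x₂, h₂, hx₂⟩ := exists_normal_undergraph hL hu hy
  have hy' : ∃ t : ℝ, y + t • u ∈ L := hy.imp fun t ht => interior_subset ht
  have e₁ := inner_eq_centroidNorm_of_normal hφ hω hK (overgraph_mem hL.isCompact hu hy') hx₁
  have e₂ := inner_eq_centroidNorm_of_normal hφ hω hK (undergraph_mem hL.isCompact hu hy') hx₂
  -- The chord through `y` and the chord through the origin give two linear formulas for the same
  -- midpoints of `K`; they must agree on `u^⊥`.
  have hperp : ∀ z, inner ℝ u z = (0 : ℝ) → inner ℝ (x₁ - x₂ - (2 : ℝ) • w) z = (0 : ℝ) := by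
    intro z hz
    obtain ⟨ε, ⟨hε1, hε2⟩, hε3⟩ := ((eventually_smul_sub_mem_interior hK x₁ u z).and
      (eventually_smul_sub_mem_interior hK w u z)).and self_mem_nhdsWithin |>.exists
    have hε3 : (0 : ℝ) < ε := hε3
    have hεz : inner ℝ u (ε • z) = (0 : ℝ) := by rw [inner_smul_right, hz, mul_zero]
    have k1 := two_mul_midShift_eq_of_centroidBody_eq hφ hω hK hu heq h₁ h₂ hyu hy' e₁ e₂ hεz hε1
    rw [hmid _ hεz hε2, inner_smul_right, inner_smul_right, inner_smul_right] at k1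
    rw [inner_sub_left, inner_sub_left, inner_smul_left, RCLike.conj_to_real]
    have : ε * ((inner ℝ x₁ z : ℝ) - inner ℝ x₂ z - 2 * inner ℝ w z) = 0 := by linarith
    exact (mul_eq_zero.1 this).resolve_left hε3.ne'
  have hzero : x₁ - x₂ - (2 : ℝ) • w = 0 := by
    refine ext_inner_right ℝ fun z => ?_
    rw [inner_zero_left, ← proj_add_inner_smul u z, inner_add_right, hperp _ (inner_proj_self hu z),
      inner_smul_right, inner_sub_left, inner_sub_left, inner_smul_left, real_inner_comm u x₁,
      real_inner_comm u x₂, real_inner_comm u w, h₁, h₂, hw, RCLike.conj_to_real]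
    ring
  have hx : x₁ - (2 : ℝ) • w = x₂ := by
    rw [sub_right_comm] at hzero
    exact sub_eq_zero.1 hzero
  refine ⟨x₁, h₁, hx₁, ?_⟩
  rw [hx]
  exact hx₂

/-- In the equality case, all chords of the centroid body parallel to `u` are bisected by `w^⊥`. -/
theorem overgraph_sub_undergraph_centroidBody (hφ : IsOrliczFunction φ) (hω : IsWeight ω)
    (hK : IsConvexBodyZero K) (hu : ‖u‖ = 1)
    (heq : centroidBody φ ω (steiner u K) = steiner u (centroidBody φ ω K))
    (hw : inner ℝ u w = (1 : ℝ))
    (hmid : ∀ z, inner ℝ u z = (0 : ℝ) → z - (inner ℝ w z : ℝ) • u ∈ interior K →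
        midShift K u z = -inner ℝ w z)
    {y : 𝔼 n} (hyu : inner ℝ u y = (0 : ℝ))
    (hy : ∃ t : ℝ, y + t • u ∈ interior (centroidBody φ ω K)) :
    overgraph (centroidBody φ ω K) u y =
      undergraph (centroidBody φ ω K) u y - 2 * inner ℝ w y := by
  have hL := isConvexBodyZero_centroidBody hφ hω hK
  have hex := fun y => exists_normals_sub_eq (y := y) hφ hω hK hu heq hw hmid
  set L := centroidBody φ ω K with hLdef
  have hseg : ∀ τ : ℝ, 0 ≤ τ → τ ≤ 1 → inner ℝ u (τ • y) = (0 : ℝ) ∧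
      ∃ t : ℝ, τ • y + t • u ∈ interior L := by
    intro τ h0 h1
    obtain ⟨t, ht⟩ := hy
    refine ⟨by rw [inner_smul_right, hyu, mul_zero], τ * t, ?_⟩
    rw [mul_smul, ← smul_add]
    exact hL.convex.interior.smul_mem_of_zero_mem hL.zero_mem_interior ht ⟨h0, h1⟩
  choose! x hx1 hx2 hx3 using hex
  -- `D` measures the failure of `w^⊥` to bisect the chord at `τ • y`, and it vanishes at `τ = 0` by
  -- symmetry.
  set D : ℝ → ℝ := fun τ => overgraph L u (τ • y) - undergraph L u (τ • y) +
    2 * inner ℝ w (τ • y) with hD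
  -- Add the support inequality of the upper normal at `s`, tested at the upper end over `t`, to
  -- that of the lower normal at `t`, tested at the lower end over `s`. The lower normal is the
  -- upper one minus `2w`, so only a product of increments remains.
  have hstep : ∀ s t, 0 ≤ s → s ≤ 1 → 0 ≤ t → t ≤ 1 →
      D t - D s ≤ ((inner ℝ (x (t • y)) y : ℝ) - inner ℝ (x (s • y)) y) * (t - s) := by
    intro s t hs0 hs1 ht0 ht1
    obtain ⟨as, bs⟩ := hseg s hs0 hs1
    obtain ⟨at', bt⟩ := hseg t ht0 ht1
    have m1 := overgraph_mem hL.isCompact hu (bt.imp fun _ h => interior_subset h)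
    have m2 := undergraph_mem hL.isCompact hu (bs.imp fun _ h => interior_subset h)
    have k1 := hx2 _ as bs _ m1
    have k2 := hx3 _ at' bt _ m2
    simp only [inner_add_right, inner_smul_right, inner_sub_left, inner_smul_left,
      RCLike.conj_to_real, real_inner_comm u w, hw] at k1 k2
    rw [real_inner_comm u (x (s • y)), hx1 _ as bs] at k1
    rw [real_inner_comm u (x (t • y)), hx1 _ at' bt] at k2
    simp only [hD, inner_smul_right]
    linarith
  have := eq_of_abs_sub_le_mul_sub (d := D) (a := fun τ => inner ℝ (x (τ • y)) y) (by
    intro s t hs hst ht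
    have e1 := hstep s t hs (hst.trans ht) (hs.trans hst) ht
    have e2 := hstep t s (hs.trans hst) ht hs (hst.trans ht)
    rw [abs_le]
    constructor <;> linarith)
  simp only [hD, one_smul, zero_smul, inner_zero_right, mul_zero, add_zero] at this
  rw [undergraph_eq_overgraph_neg_right neg_mem_centroidBody u 0, neg_zero, sub_self] at this
  linarith

/-- The oblique reflection `y ↦ y - 2 ⟪w, y⟫ u`. -/
noncomputable def obliqueRefl (u w y : 𝔼 n) : 𝔼 n := y - (2 * (inner ℝ w y : ℝ)) • u

theorem continuous_obliqueRefl (u w : 𝔼 n) : Continuous (obliqueRefl u w) := by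
  unfold obliqueRefl
  fun_prop

theorem inner_obliqueRefl (hw : inner ℝ u w = (1 : ℝ)) (y : 𝔼 n) :
    inner ℝ w (obliqueRefl u w y) = (-inner ℝ w y : ℝ) := by
  rw [obliqueRefl, inner_sub_right, inner_smul_right, real_inner_comm u w, hw]
  ring

theorem obliqueRefl_obliqueRefl (hw : inner ℝ u w = (1 : ℝ)) (y : 𝔼 n) :
    obliqueRefl u w (obliqueRefl u w y) = y := by
  rw [obliqueRefl, inner_obliqueRefl hw, obliqueRefl]
  module

/-- The oblique reflection is the orthogonal reflection in `u^⊥` followed by a shear along `u`. -/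
theorem measurePreserving_obliqueRefl (hu : ‖u‖ = 1) (hw : inner ℝ u w = (1 : ℝ)) :
    MeasurePreserving (obliqueRefl u w) volume volume := by
  have huu := inner_self_of_norm_eq_one hu
  have hs := measurePreserving_shear hu (m := fun y => 2 * (inner ℝ u y : ℝ) - 2 * inner ℝ w y)
    (by fun_prop) (by
      intro y t
      simp only [inner_add_right, inner_smul_right, huu, real_inner_comm u w, hw]
      ring)
  have := hs.comp (measurePreserving_refl hu)
  convert this using 1
  funext y
  simp only [Function.comp_apply, refl, obliqueRefl, inner_sub_right, inner_smul_right, huu,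
    real_inner_comm u w, hw]
  module

/-- The oblique reflection exchanges the two halves of a chord bisected by `w^⊥`. This settles
interior points; the boundary follows by closure, and the reverse inclusion by involutivity. -/
theorem obliqueRefl_preimage_centroidBody (hφ : IsOrliczFunction φ) (hω : IsWeight ω)
    (hK : IsConvexBodyZero K) (hu : ‖u‖ = 1)
    (heq : centroidBody φ ω (steiner u K) = steiner u (centroidBody φ ω K))
    (hw : inner ℝ u w = (1 : ℝ))
    (hmid : ∀ z, inner ℝ u z = (0 : ℝ) → z - (inner ℝ w z : ℝ) • u ∈ interior K →
        midShift K u z = -inner ℝ w z) :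
    obliqueRefl u w ⁻¹' centroidBody φ ω K = centroidBody φ ω K := by
  have hL := isConvexBodyZero_centroidBody hφ hω hK
  have hbis := fun y => overgraph_sub_undergraph_centroidBody (y := y) hφ hω hK hu heq hw hmid
  set L := centroidBody φ ω K with hLdef
  have hint : ∀ y ∈ interior L, obliqueRefl u w y ∈ L := by
    intro y hy
    have hyz := proj_add_inner_smul u y
    set z := proj u y with hz
    set s : ℝ := inner ℝ u y with hs
    have hzu : inner ℝ u z = (0 : ℝ) := inner_proj_self hu y
    have hzi : ∃ t : ℝ, z + t • u ∈ interior L := ⟨s, by rwa [hyz]⟩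
    have hzL : ∃ t : ℝ, z + t • u ∈ L := hzi.imp fun t ht => interior_subset ht
    have hb := hbis z hzu hzi
    have hwy : inner ℝ w y = inner ℝ w z + s := by
      rw [← hyz, inner_add_right, inner_smul_right, real_inner_comm u w, hw, mul_one]
    have e : obliqueRefl u w y = z + (-s - 2 * inner ℝ w z) • u := by
      rw [obliqueRefl, hwy, ← hyz]
      module
    have hyL : z + s • u ∈ L := by
      rw [hyz]
      exact interior_subset hy
    rw [add_smul_mem_iff hL.isCompact hL.convex hu hzL] at hyL
    rw [e, add_smul_mem_iff hL.isCompact hL.convex hu hzL]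
    constructor <;> linarith
  have hsub : ∀ y ∈ L, obliqueRefl u w y ∈ L := by
    have hcl : L ⊆ closure (interior L) := by
      rw [hL.convex.closure_interior_eq_closure_of_nonempty_interior ⟨_, hL.zero_mem_interior⟩]
      exact subset_closure
    intro y hy
    exact closure_minimal (fun z hz => hint z hz)
      (hL.isCompact.isClosed.preimage (continuous_obliqueRefl u w)) (hcl hy)
  ext y
  refine ⟨fun hy => ?_, hsub y⟩
  rw [← obliqueRefl_obliqueRefl hw y]
  exact hsub _ hy

/-- The bilinear form of second moments of a set. -/
noncomputable def momentForm (L : Set (𝔼 n)) (x y : 𝔼 n) : ℝ :=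
  ∫ z in L, (inner ℝ x z : ℝ) * inner ℝ y z

theorem momentForm_comm (L : Set (𝔼 n)) (x y : 𝔼 n) : momentForm L x y = momentForm L y x := by
  simp only [momentForm, mul_comm]

theorem IsConvexBodyZero.integrableOn_inner_mul_inner (hL : IsConvexBodyZero L) (x y : 𝔼 n) :
    IntegrableOn (fun z => (inner ℝ x z : ℝ) * inner ℝ y z) L :=
  ContinuousOn.integrableOn_compact hL.isCompact (by fun_prop)

theorem IsConvexBodyZero.momentForm_add_left (hL : IsConvexBodyZero L) (x x' y : 𝔼 n) :
    momentForm L (x + x') y = momentForm L x y + momentForm L x' y := by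
  rw [momentForm, momentForm, momentForm, ← integral_add (hL.integrableOn_inner_mul_inner x y)
    (hL.integrableOn_inner_mul_inner x' y)]
  simp only [inner_add_left, add_mul]

theorem momentForm_smul_left (L : Set (𝔼 n)) (c : ℝ) (x y : 𝔼 n) :
    momentForm L (c • x) y = c * momentForm L x y := by
  rw [momentForm, momentForm, ← integral_const_mul]
  simp only [inner_smul_left, RCLike.conj_to_real, mul_assoc]

theorem IsConvexBodyZero.momentForm_self_pos (hL : IsConvexBodyZero L) {x : 𝔼 n} (hx : x ≠ 0) :
    0 < momentForm L x x := by
  rw [momentForm, setIntegral_pos_iff_support_of_nonneg_ae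
    (.of_forall fun z => mul_self_nonneg _) (hL.integrableOn_inner_mul_inner x x)]
  have hopen : IsOpen (interior L ∩ {y | inner ℝ x y ≠ (0 : ℝ)}) :=
    isOpen_interior.inter (isOpen_ne_fun (by fun_prop) continuous_const)
  refine lt_of_lt_of_le (hopen.measure_pos volume ?_) (measure_mono fun z hz =>
    ⟨mul_self_ne_zero.2 hz.2, interior_subset hz.1⟩)
  have hc : Filter.Tendsto (fun t : ℝ => t • x) (nhdsWithin 0 (Ioi 0)) (nhds 0) := by
    have : Continuous fun t : ℝ => t • x := by fun_prop
    simpa using (this.tendsto 0).mono_left nhdsWithin_le_nhds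
  obtain ⟨t, ht1, ht2⟩ := ((hc.eventually (isOpen_interior.mem_nhds hL.zero_mem_interior)).and
    self_mem_nhdsWithin).exists
  refine ⟨t • x, ht1, ?_⟩
  rw [mem_ofPred_eq, inner_smul_right, real_inner_self_eq_norm_sq]
  have : 0 < ‖x‖ := norm_pos_iff.2 hx
  have : (0 : ℝ) < t := ht2
  positivity

/-- If the oblique reflection preserves `L`, then `u` and `w` are conjugate with respect to the
moment form. -/
theorem IsConvexBodyZero.momentForm_eq_of_preimage (hL : IsConvexBodyZero L) (hu : ‖u‖ = 1)
    (hw : inner ℝ u w = (1 : ℝ)) (hpre : obliqueRefl u w ⁻¹' L = L) (x : 𝔼 n) :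
    momentForm L x w = inner ℝ x u * momentForm L w w := by
  have hinj : Function.Injective (obliqueRefl u w) :=
    (show Function.Involutive (obliqueRefl u w) from obliqueRefl_obliqueRefl hw).injective
  have h := (measurePreserving_obliqueRefl hu hw).setIntegral_preimage_emb
    ((continuous_obliqueRefl u w).measurableEmbedding hinj)
    (fun z => (inner ℝ x z : ℝ) * inner ℝ w z) L
  rw [hpre] at h
  -- The reflection changes the sign of `⟪w, ·⟫` and alters `⟪x, ·⟫` by a multiple of `⟪w, ·⟫`;
  -- integrating over the invariant body gives the conjugacy relation.
  have e : ∀ z, (inner ℝ x (obliqueRefl u w z) : ℝ) * inner ℝ w (obliqueRefl u w z) =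
      2 * inner ℝ x u * ((inner ℝ w z : ℝ) * inner ℝ w z) - (inner ℝ x z : ℝ) * inner ℝ w z := by
    intro z
    rw [inner_obliqueRefl hw, obliqueRefl, inner_sub_right, inner_smul_right]
    ring
  simp only [e] at h
  rw [integral_sub ((hL.integrableOn_inner_mul_inner w w).const_mul _)
    (hL.integrableOn_inner_mul_inner x w), integral_const_mul] at h
  rw [momentForm, momentForm]
  linarith

end

/-! ### Equality in all directions: `K` is an ellipsoid. -/

section

variable {n : ℕ}

local notation "𝔼" n => EuclideanSpace ℝ (Fin n)

variable {φ ω : ℝ → ℝ} {K : Set (𝔼 n)} {u w : 𝔼 n}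

theorem IsConvexBodyZero.neg_mem_of_midShift_zero (hK : IsConvexBodyZero K)
    (h : ∀ u : 𝔼 n, ‖u‖ = 1 → midShift K u 0 = 0) : ∀ y ∈ K, -y ∈ K := by
  intro y hy
  rcases eq_or_ne y 0 with rfl | hy0
  · rwa [neg_zero]
  have hn : 0 < ‖y‖ := norm_pos_iff.2 hy0
  set u : 𝔼 n := ‖y‖⁻¹ • y with hudef
  have hu : ‖u‖ = 1 := by rw [hudef, norm_smul, norm_inv, norm_norm, inv_mul_cancel₀ hn.ne']
  have hyu : y = 0 + ‖y‖ • u := by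
    rw [hudef, smul_smul, mul_inv_cancel₀ hn.ne', one_smul, zero_add]
  have hmem : (0 : 𝔼 n) + ‖y‖ • u ∈ K := by rwa [← hyu]
  have hne : ∃ t : ℝ, (0 : 𝔼 n) + t • u ∈ K := ⟨_, hmem⟩
  have hm := h u hu
  rw [midShift, proj_of_inner_eq_zero (inner_zero_right u)] at hm
  rw [add_smul_mem_iff hK.isCompact hK.convex hu hne] at hmem
  have : -y = 0 + (-‖y‖) • u := by
    conv_lhs => rw [hyu]
    module
  rw [this, add_smul_mem_iff hK.isCompact hK.convex hu hne]
  constructor <;> linarith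

/-- If the chords of a symmetric body parallel to `u` near the origin are bisected by `w^⊥`, then
`w` is normal to the body at its boundary point in direction `u`. -/
theorem IsConvexBodyZero.inner_le_overgraph_zero (hK : IsConvexBodyZero K) (hu : ‖u‖ = 1)
    (hsymm : ∀ y ∈ K, -y ∈ K) (hw : inner ℝ u w = (1 : ℝ))
    (hmid : ∀ z, inner ℝ u z = (0 : ℝ) → z - (inner ℝ w z : ℝ) • u ∈ interior K →
        midShift K u z = -inner ℝ w z) {y : 𝔼 n} (hy : y ∈ K) :
    inner ℝ w y ≤ overgraph K u 0 := by
  have hyz := proj_add_inner_smul u y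
  set z := proj u y with hz
  set s : ℝ := inner ℝ u y with hs
  have hzu : inner ℝ u z = (0 : ℝ) := inner_proj_self hu y
  have hwy : inner ℝ w y = inner ℝ w z + s := by
    rw [← hyz, inner_add_right, inner_smul_right, real_inner_comm u w, hw, mul_one]
  obtain ⟨ε, ⟨hε1, hε2⟩, hε3⟩ := ((eventually_smul_sub_mem_interior hK w u z).and
    (nhdsWithin_le_nhds (gt_mem_nhds one_pos))).and self_mem_nhdsWithin |>.exists
  have hε3 : (0 : ℝ) < ε := hε3
  have hεz : inner ℝ u (ε • z) = (0 : ℝ) := by rw [inner_smul_right, hzu, mul_zero]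
  have hm := hmid _ hεz hε1
  rw [midShift, proj_of_inner_eq_zero hεz, undergraph_eq_overgraph_neg_right hsymm,
    inner_smul_right] at hm
  have h0 : ∃ t : ℝ, (0 : 𝔼 n) + t • u ∈ K := ⟨0, by simpa using hK.zero_mem⟩
  have htop := overgraph_mem hK.isCompact hu h0
  -- This point of the segment from the top of the central chord to `y` bounds the overgraph at `ε •
  -- z` from below. The overgraphs at `ε • z` and `-(ε • z)` have mean at most the value at `0`,
  -- while `hm` gives their difference; combining these bounds it from above.
  have hcomb : ε • z + ((1 - ε) * overgraph K u 0 + ε * s) • u ∈ K := by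
    have := hK.convex htop hy (sub_nonneg.2 hε2.le) hε3.le (by ring)
    rw [← hyz] at this
    convert this using 1
    module
  have g1 := le_overgraph hK.isCompact hu hcomb
  have hneg : ∃ t : ℝ, -(ε • z) + t • u ∈ K := by
    refine ⟨-((1 - ε) * overgraph K u 0 + ε * s), ?_⟩
    have := hsymm _ hcomb
    convert this using 1
    module
  have m1 := overgraph_mem hK.isCompact hu ⟨_, hcomb⟩
  have m2 := overgraph_mem hK.isCompact hu hneg
  have hmem : (0 : 𝔼 n) + ((overgraph K u (ε • z) + overgraph K u (-(ε • z))) / 2) • u ∈ K := by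
    have := hK.convex m1 m2 (by norm_num : (0 : ℝ) ≤ 1 / 2) (by norm_num : (0 : ℝ) ≤ 1 / 2)
      (by norm_num)
    convert this using 1
    module
  have g2 := le_overgraph hK.isCompact hu hmem
  rw [hwy]
  have : ε * (inner ℝ w z + s) ≤ ε * overgraph K u 0 := by linarith
  exact le_of_mul_le_mul_left this hε3

theorem IsConvexBodyZero.inner_le_supportFn (hK : IsConvexBodyZero K) (x : 𝔼 n) {y : 𝔼 n}
    (hy : y ∈ K) : inner ℝ x y ≤ supportFn K x :=
  le_csSup (hK.isCompact.image (by fun_prop : Continuous fun y => (inner ℝ x y : ℝ))).bddAbove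
    ⟨y, hy, rfl⟩

theorem supportFn_le {x : 𝔼 n} (hK : IsConvexBodyZero K) {c : ℝ}
    (h : ∀ y ∈ K, inner ℝ x y ≤ c) : supportFn K x ≤ c := by
  refine csSup_le ⟨_, 0, hK.zero_mem, rfl⟩ ?_
  rintro _ ⟨y, hy, rfl⟩
  exact h y hy

theorem IsConvexBodyZero.supportFn_smul (hK : IsConvexBodyZero K) {c : ℝ} (hc : 0 < c) (x : 𝔼 n) :
    supportFn K (c • x) = c * supportFn K x := by
  refine le_antisymm (supportFn_le hK fun y hy => ?_) ?_
  · rw [inner_smul_left, RCLike.conj_to_real]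
    exact mul_le_mul_of_nonneg_left (hK.inner_le_supportFn x hy) hc.le
  · rw [← le_div_iff₀' hc]
    refine supportFn_le hK fun y hy => ?_
    rw [le_div_iff₀' hc]
    have := hK.inner_le_supportFn (c • x) hy
    rwa [inner_smul_left, RCLike.conj_to_real] at this

theorem IsConvexBodyZero.supportFn_pos (hK : IsConvexBodyZero K) {x : 𝔼 n} (hx : x ≠ 0) :
    0 < supportFn K x := by
  have hc : Filter.Tendsto (fun t : ℝ => t • x) (nhdsWithin 0 (Ioi 0)) (nhds 0) := by
    have : Continuous fun t : ℝ => t • x := by fun_prop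
    simpa using (this.tendsto 0).mono_left nhdsWithin_le_nhds
  obtain ⟨t, ht1, ht2⟩ := ((hc.eventually (isOpen_interior.mem_nhds hK.zero_mem_interior)).and
    self_mem_nhdsWithin).exists
  refine lt_of_lt_of_le ?_ (hK.inner_le_supportFn x (interior_subset ht1))
  rw [inner_smul_right, real_inner_self_eq_norm_sq]
  have : 0 < ‖x‖ := norm_pos_iff.2 hx
  have : (0 : ℝ) < t := ht2
  positivity

theorem IsConvexBodyZero.supportFn_neg (hK : IsConvexBodyZero K) (hsymm : ∀ y ∈ K, -y ∈ K)
    (x : 𝔼 n) : supportFn K (-x) = supportFn K x := by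
  refine le_antisymm (supportFn_le hK fun y hy => ?_) (supportFn_le hK fun y hy => ?_)
  · rw [inner_neg_left, ← inner_neg_right]
    exact hK.inner_le_supportFn x (hsymm y hy)
  · rw [← inner_neg_neg]
    exact hK.inner_le_supportFn (-x) (hsymm y hy)

/-- A symmetric convex body is an ellipsoid if its normals in each direction are the conjugate
directions with respect to a positive definite form. -/
theorem IsConvexBodyZero.isOriginEllipsoid_of_conjugate (hK : IsConvexBodyZero K)
    (hsymm : ∀ y ∈ K, -y ∈ K) {B : LinearMap.BilinForm ℝ (𝔼 n)} (hB : ∀ x y, B x y = B y x)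
    (hpos : ∀ x, x ≠ 0 → 0 < B x x)
    (h : ∀ u : 𝔼 n, ‖u‖ = 1 → ∃ w, inner ℝ u w = (1 : ℝ) ∧ (∀ x, B x w = inner ℝ x u * B w w) ∧
      ∀ y ∈ K, inner ℝ w y ≤ overgraph K u 0) : IsOriginEllipsoid K := by
  obtain ⟨C, hC⟩ := exists_linearEquiv_inner_eq hB hpos
  have key : ∀ v w, w ≠ 0 → B v w * supportFn K w ≤ supportFn K v * B w w := by
    intro v w hw
    -- `a` represents `B w`. The conjugate direction `w'` of its unit multiple `u` is then a
    -- positive multiple of `w`, so the support function at `w` is attained at the boundary point of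
    -- `K` on the ray of `a`. Testing `v` against this point gives the inequality.
    set a : 𝔼 n := (InnerProductSpace.toDual ℝ (𝔼 n)).symm (B w).toContinuousLinearMap with ha
    have hav : ∀ x, inner ℝ x a = B x w := fun x => by
      rw [real_inner_comm, ha, InnerProductSpace.toDual_symm_apply, hB]
      rfl
    have ha0 : a ≠ 0 := by
      intro h0
      have := hav w
      rw [h0, inner_zero_right] at this
      exact (hpos w hw).ne this
    have hn : 0 < ‖a‖ := norm_pos_iff.2 ha0
    have hu : ‖‖a‖⁻¹ • a‖ = 1 := by rw [norm_smul, norm_inv, norm_norm, inv_mul_cancel₀ hn.ne']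
    obtain ⟨w', hw'1, hw'2, hw'3⟩ := h _ hu
    set u : 𝔼 n := ‖a‖⁻¹ • a with hudef
    have hw'0 : w' ≠ 0 := by
      rintro rfl
      simp at hw'1
    have hb := hpos w' hw'0
    set c := ‖a‖ / B w' w' with hcdef
    have hc : 0 < c := by positivity
    have hcw : w = c • w' := by
      by_contra hne
      refine (hpos _ (sub_ne_zero.2 hne)).ne' ?_
      rw [map_sub (B (w - c • w')), map_smul, hw'2, ← hav, hudef, inner_smul_right, smul_eq_mul,
        hcdef]
      field_simp
      ring
    have h0 : ∃ t : ℝ, (0 : 𝔼 n) + t • u ∈ K := ⟨0, by simpa using hK.zero_mem⟩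
    have htop := overgraph_mem hK.isCompact hu h0
    rw [zero_add] at htop
    have h1 := hK.inner_le_supportFn v htop
    have h2 : supportFn K w' ≤ overgraph K u 0 := supportFn_le hK hw'3
    have h3 := hK.inner_le_supportFn w' htop
    rw [inner_smul_right] at h1
    rw [inner_smul_right, real_inner_comm, hw'1, mul_one] at h3
    have h4 := le_antisymm h2 h3
    rw [hcw, hK.supportFn_smul hc, map_smul (B v), map_smul (B (c • w')), hB (c • w') w',
      map_smul (B w'), hw'2 v, h4]
    simp only [smul_eq_mul]
    calc c * (inner ℝ v u * B w' w') * (c * overgraph K u 0)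
        = (overgraph K u 0 * inner ℝ v u) * (c * (c * B w' w')) := by ring
      _ ≤ supportFn K v * (c * (c * B w' w')) := by gcongr
  obtain ⟨R, hR, hKR⟩ := hK.exists_norm_le
  set Cs := C.symm.toLinearMap.toContinuousLinearMap with hCs
  -- In the coordinates given by `C` the form `B` is the inner product, and `key` becomes the
  -- hypothesis that support is attained in the radial direction.
  obtain ⟨r, hr, hh⟩ := exists_eq_mul_norm (h := fun x => supportFn K (C.symm x))
    (fun c hc x => by rw [map_smul, hK.supportFn_smul hc])
    (fun x => by rw [map_neg, hK.supportFn_neg hsymm])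
    (fun x hx => hK.supportFn_pos (by simpa using hx)) (C := ‖Cs‖ * R)
    (fun x => supportFn_le hK fun y hy => by
      have h1 : ‖C.symm x‖ ≤ ‖Cs‖ * ‖x‖ := Cs.le_opNorm x
      calc (inner ℝ (C.symm x) y : ℝ) ≤ ‖C.symm x‖ * ‖y‖ := real_inner_le_norm _ _
        _ ≤ ‖Cs‖ * ‖x‖ * R := mul_le_mul h1 (hKR y hy) (norm_nonneg _) (by positivity)
        _ = ‖Cs‖ * R * ‖x‖ := by ring)
    (fun v w hw => by
      have := key (C.symm v) (C.symm w) (by simpa using hw)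
      rwa [hC, hC, LinearEquiv.apply_symm_apply, LinearEquiv.apply_symm_apply,
        real_inner_self_eq_norm_sq] at this)
  refine isOriginEllipsoid_of_supportFn hK C hr fun x => ?_
  have := hh (C x)
  rwa [LinearEquiv.symm_apply_apply] at this

/-- For each `u` the same `w` serves twice: it bisects the chords of `K` near the origin, hence is a
normal of `K`, and it bisects the chords of the centroid body, hence is conjugate to `u`. The moment
form is that of the centroid body, since for `K` bisection is known only near the origin. -/
theorem isOriginEllipsoid_of_centroidBody_eq (hφ : IsOrliczFunction φ) (hω : IsWeight ω)
    (hK : IsConvexBodyZero K)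
    (heq : ∀ u : 𝔼 n, ‖u‖ = 1 →
      centroidBody φ ω (steiner u K) = steiner u (centroidBody φ ω K)) :
    IsOriginEllipsoid K := by
  have hL := isConvexBodyZero_centroidBody hφ hω hK
  have hex := fun (u : 𝔼 n) (hu : ‖u‖ = 1) => exists_normal_midShift hφ hω hK hu (heq u hu)
  have hsymm : ∀ y ∈ K, -y ∈ K := by
    refine hK.neg_mem_of_midShift_zero fun u hu => ?_
    obtain ⟨w, -, hmid⟩ := hex u hu
    have := hmid 0 (inner_zero_right u) (by simpa using hK.zero_mem_interior)
    rwa [inner_zero_right, neg_zero] at this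
  have hadd := hL.momentForm_add_left
  have hsmul := momentForm_smul_left (centroidBody φ ω K)
  have hcomm := momentForm_comm (centroidBody φ ω K)
  refine hK.isOriginEllipsoid_of_conjugate hsymm
    (B := LinearMap.mk₂ ℝ (momentForm (centroidBody φ ω K)) hadd hsmul
      (fun x y y' => by rw [hcomm, hadd, hcomm y, hcomm y'])
      (fun c x y => by rw [hcomm, hsmul, hcomm y, smul_eq_mul]))
    hcomm (fun x hx => hL.momentForm_self_pos hx) fun u hu => ?_
  obtain ⟨w, hw, hmid⟩ := hex u hu
  refine ⟨w, hw, fun x => ?_, fun y hy => hK.inner_le_overgraph_zero hu hsymm hw hmid hy⟩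
  exact hL.momentForm_eq_of_preimage hu hw
    (obliqueRefl_preimage_centroidBody hφ hω hK hu (heq u hu) hw hmid) x

end

end OrliczLorentz

theorem mainTheorem2 (n : ℕ) (hn : 1 ≤ n) (φ ω : ℝ → ℝ)
    (hφ : OrliczLorentz.IsOrliczFunction φ) (hω : OrliczLorentz.IsWeight ω)
    (K : Set (EuclideanSpace ℝ (Fin n))) (hK : OrliczLorentz.IsConvexBodyZero K) :
    (OrliczLorentz.IsConvexBodyZero (OrliczLorentz.centroidBody φ ω K) ∧
      ∀ x : EuclideanSpace ℝ (Fin n),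
        OrliczLorentz.supportFn (OrliczLorentz.centroidBody φ ω K) x =
          OrliczLorentz.centroidNorm φ ω K x) ∧
    (∀ u : EuclideanSpace ℝ (Fin n), ‖u‖ = 1 →
      OrliczLorentz.centroidBody φ ω (OrliczLorentz.steiner u K) ⊆
          OrliczLorentz.steiner u (OrliczLorentz.centroidBody φ ω K) ∧
      (OrliczLorentz.centroidBody φ ω (OrliczLorentz.steiner u K) =
          OrliczLorentz.steiner u (OrliczLorentz.centroidBody φ ω K) →
        ∃ H : Submodule ℝ (EuclideanSpace ℝ (Fin n)), Module.finrank ℝ H + 1 = n ∧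
          ∀ y ∈ OrliczLorentz.shadow K u,
            Metric.infDist 0 (OrliczLorentz.chord K u y) <
              OrliczLorentz.innerRadius K *
                OrliczLorentz.innerRadius (OrliczLorentz.centroidBody φ ω K) /
                (4 * OrliczLorentz.outerRadius (OrliczLorentz.centroidBody φ ω K)) →
            OrliczLorentz.chordMidpoint K u y ∈ H)) ∧
    ((∀ u : EuclideanSpace ℝ (Fin n), ‖u‖ = 1 →
        OrliczLorentz.centroidBody φ ω (OrliczLorentz.steiner u K) =
          OrliczLorentz.steiner u (OrliczLorentz.centroidBody φ ω K)) →
      OrliczLorentz.IsOriginEllipsoid K) := by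
  have hp := OrliczLorentz.isConvexBodyZero_centroidBody hφ hω hK
  refine ⟨⟨hp, OrliczLorentz.supportFn_centroidBody hφ hω hK⟩, fun u hu =>
    ⟨OrliczLorentz.centroidBody_steiner_subset hφ hω hK hu, fun heq =>
      OrliczLorentz.exists_submodule_chordMidpoint_mem hφ hω hK hu heq⟩, fun heq =>
    OrliczLorentz.isOriginEllipsoid_of_centroidBody_eq hφ hω hK heq⟩
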